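/- Setting. Let $\mathcal S$ and $\mathcal B$ be finite sets of seller and buyer operators, and fix a seller $s\in\mathcal S$ with a finite set $\mathcal L_s$ of licensed sub-bands. Sub-band $l\in\mathcal L_s$ is used by the operators in a set $Q_l$ with $s\in Q_l$ and $Q_l\setminus\{s\}\subseteq\mathcal B$. For each operator $k$, the base stations form a homogeneous Poisson point process in $\mathbb R^2$ with intensity $\lambda_k>0$; the users of $s$ form a homogeneous Poisson point process $\Psi_s$ in $\mathbb R^2$ with intensity $\mu_s>0$. Let $\alpha>2$ be the path loss exponent, $\sigma^2\ge 0$ the noise power, $P^{\rm S}>0$ the transmit power of the base stations of sellers, and $\zeta_s>0$ the interference threshold. A typical user of $s$ is located at the origin. Denote by $x_f^{k}$ the distance from the origin to base station $f$ of operator $k$, and by $h_{f,l}^{k}$ the corresponding channel gain on sub-band $l$, which is exponential with mean $1$. The user is served by the base station $0$ of $s$ that provides the maximum average received power. The transmit power $P_{f,l}^{b}$ on sub-band $l$ of base station $f$ of buyer $b\in Q_l\setminus\{s\}$ has the law of $$P_l^{\rm B}=\zeta_s/H_l,\qquad H_l=\max_{y_i\in\Psi_s} h_{i,l}\,\|{\rm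 x}^{\rm B}-y_i\|^{-\alpha},$$ where ${\rm x}^{\rm B}\in\mathbb R^2$ is an arbitrary location and the $h_{i,l}$ are independent exponentials of mean $1$, independent of $\Psi_s$. On each sub-band $l$, the base station processes of the operators in $Q_l$, the gains $h^k_{f,l}$ ($k\in Q_l$) and the powers $P_{f,l}^b$ ($b\in Q_l\setminus\{s\}$) are all mutually independent. The SINR of the typical user on sub-band $l$ is $$\gamma_l=\frac{P^{\rm S}h_{0,l}^{s}(x_0^{s})^{-\alpha}}{\sum_{f\ne 0}P^{\rm S}h_{f,l}^{s}(x_f^{s})^{-\alpha}+\sum_{b\in Q_l\setminus\{s\}}\sum_{f}P_{f,l}^{b}h_{f,l}^{b}(x_f^{b})^{-\alpha}+\sigma^2}.$$ Theorem. Let $\mathbb P[\,\cdot\,]$ and $\mathbb E_{\gamma_l}$ refer to the conditional law of $\gamma_l$ given the buyers' transmit powers on sub-band $l$, and let $\mathbb E_{P_l}$ be the expectation over these powers. Then $\mathbb E[(P_l^{\rm B})^{2/\alpha}]$ and $\mathbb E[\ln(1+\gamma_l)]$ are finite for every $l\in\mathcal L_s$, the integrals below converge, and the average rate $\mathcal R_s^{\rm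 S}=\sum_{l\in\mathcal L_s}\mathbb E_{P_l}\big[\mathbb E_{\gamma_l}[\ln(1+\gamma_l)]\big]$ of the typical user of $s$ satisfies $$\mathcal R_s^{\rm S}=\sum_{l\in\mathcal L_s}\mathbb E_{P_l}\Big[\int_0^\infty\mathbb P[\ln(1+\gamma_l)>t]\,{\rm d}t\Big]$$ $$=\sum_{l\in\mathcal L_s}\int_0^\infty\!\!\int_0^\infty \pi\lambda_s (P^{\rm S})^{2/\alpha}\exp\!\big(-\beta_t\sigma^2z^{\alpha/2}\big)\exp\!\big(-\pi\lambda_s (P^{\rm S})^{2/\alpha}z\big)\,\mathcal L_{l,\beta_t}\big(\beta_t z^{\alpha/2}\big)\,{\rm d}z\,{\rm d}t,$$ where $\beta_t=e^t-1$ and $$\mathcal L_{l,\beta}(\kappa)=\exp\!\big(-\pi\lambda_s (P^{\rm S})^{2/\alpha}\kappa^{2/\alpha}\rho(\alpha,\beta)\big)\exp\!\Big(-\pi\Big(\sum_{b\in Q_l\setminus\{s\}}\lambda_b\Big)\mathbb E\big[(P_l^{\rm B})^{2/\alpha}\big]\kappa^{2/\alpha}\rho(\alpha,\infty)\Big),$$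 $$\rho(\alpha,\beta)=\int_{\beta^{-2/\alpha}}^\infty\frac{{\rm d}\nu}{1+\nu^{\alpha/2}},\qquad \rho(\alpha,\infty)=\int_0^\infty\frac{{\rm d}\nu}{1+\nu^{\alpha/2}}.$$ -/

import Mathlib

open MeasureTheory ProbabilityTheory Set
open scoped ENNReal

noncomputable section

namespace SpectrumSharing

/-- The plane with its Euclidean norm. -/
abbrev Plane : Type := EuclideanSpace ℝ (Fin 2)

/-- The number of points of the enumerated point configuration `X` in the set `B`. -/
def pointCount {Ω E : Type*} (X : ℕ → Ω → E) (B : Set E) (ω : Ω) : ℝ≥0∞ :=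
  ∑' n, B.indicator (fun _ => (1 : ℝ≥0∞)) (X n ω)

/-- `X` enumerates the points of a Poisson point process with intensity measure `Λ`:
the number of points in a set of finite measure `Λ B` is Poisson with mean `Λ B`, and the numbers
of points in disjoint sets are independent. -/
structure IsPoissonProcess {Ω E : Type*} [MeasurableSpace Ω] [MeasurableSpace E]
    (X : ℕ → Ω → E) (Λ : Measure E) (Pr : Measure Ω) : Prop where
  measurable : ∀ n, Measurable (X n)
  count_law : ∀ B : Set E, MeasurableSet B → Λ B ≠ ∞ → ∀ k : ℕ,
    Pr {ω | pointCount X B ω = (k : ℝ≥0∞)} =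
      ENNReal.ofReal (Real.exp (-(Λ B).toReal) * (Λ B).toReal ^ k / (k.factorial : ℝ))
  count_indep : ∀ (m : ℕ) (B : Fin m → Set E), (∀ i, MeasurableSet (B i)) →
    Pairwise (fun i j => Disjoint (B i) (B j)) →
    iIndepFun (fun i => pointCount X (B i)) Pr

/-- A homogeneous Poisson point process in the plane with intensity `c`. -/
def IsHomogeneousPPP {Ω : Type*} [MeasurableSpace Ω]
    (X : ℕ → Ω → Plane) (c : ℝ) (Pr : Measure Ω) : Prop :=
  IsPoissonProcess X (ENNReal.ofReal c • (volume : Measure Plane)) Pr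

/-- The deterministic parameters of the spectrum sharing system. -/
structure Network (O : Type*) [DecidableEq O] where
  /-- the set of seller operators -/
  sellers : Finset O
  /-- the set of buyer operators -/
  buyers : Finset O
  /-- the number of licensed sub-bands of a seller -/
  numBands : O → ℕ
  /-- the operators sharing a sub-band -/
  group : (s : O) → Fin (numBands s) → Finset O
  seller_mem_group : ∀ s ∈ sellers, ∀ l, s ∈ group s l
  group_subset : ∀ s ∈ sellers, ∀ l, (group s l).erase s ⊆ buyers
  /-- base station intensities -/
  bsIntensity : O → ℝ
  /-- user intensities -/
  ueIntensity : O → ℝ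
  bsIntensity_pos : ∀ k ∈ sellers ∪ buyers, 0 < bsIntensity k
  ueIntensity_pos : ∀ k ∈ sellers ∪ buyers, 0 < ueIntensity k
  /-- path loss exponent -/
  α : ℝ
  two_lt_α : 2 < α
  /-- transmit power of the base stations of sellers -/
  PS : ℝ
  PS_pos : 0 < PS
  /-- maximum interference thresholds -/
  ζ : O → ℝ
  ζ_pos : ∀ s ∈ sellers, 0 < ζ s
  /-- the noise power is `σ ^ 2` -/
  σ : ℝ

variable {O : Type*} [DecidableEq O]

/-- The random quantities that enter the downlink of a typical user, located at the origin, of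
seller `s`. -/
structure Downlink (N : Network O) (s : O) (Ω : Type*) where
  /-- `bs k f` is the location of base station `f` of operator `k` -/
  bs : O → ℕ → Ω → Plane
  /-- `gain l k f` is the channel gain, on sub-band `l`, from base station `f` of operator `k` to
  the typical user -/
  gain : Fin (N.numBands s) → O → ℕ → Ω → ℝ
  /-- `buyerPower l b f` is the transmit power, on sub-band `l`, of base station `f` of buyer `b` -/
  buyerPower : Fin (N.numBands s) → O → ℕ → Ω → ℝ
  /-- locations of the users of seller `s` -/
  ue : ℕ → Ω → Plane
  /-- location of an arbitrary buyer base station -/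
  buyerSite : Plane
  /-- `ueGain l i` is the channel gain, on sub-band `l`, between user `i` and the buyer base
  station at `buyerSite` -/
  ueGain : Fin (N.numBands s) → ℕ → Ω → ℝ

namespace Downlink

variable {N : Network O} {s : O} {Ω : Type*}

/-- The largest interference channel gain between the buyer base station at `buyerSite` and the
users of seller `s`. -/
def largestGain (D : Downlink N s Ω) (l : Fin (N.numBands s)) (ω : Ω) : ℝ :=
  ⨆ i, D.ueGain l i ω * ‖D.buyerSite - D.ue i ω‖ ^ (-N.α)

/-- The maximal power that keeps the interference at all users of seller `s` below `ζ s`. -/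
def allowedPower (D : Downlink N s Ω) (l : Fin (N.numBands s)) (ω : Ω) : ℝ :=
  N.ζ s / D.largestGain l ω

/-- The transmit power on sub-band `l` of base station `f` of operator `k`. -/
def txPower (D : Downlink N s Ω) (l : Fin (N.numBands s)) (k : O) (f : ℕ) (ω : Ω) : ℝ :=
  if k = s then N.PS else D.buyerPower l k f ω

/-- The base station of seller `s` that serves the typical user: the one providing the maximum
average received power (almost surely there is exactly one). -/
def serving (D : Downlink N s Ω) (ω : Ω) : ℕ :=
  sInf {f : ℕ | ∀ j, N.PS * ‖D.bs s j ω‖ ^ (-N.α) ≤ N.PS * ‖D.bs s f ω‖ ^ (-N.α)}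

/-- The interference at the typical user on sub-band `l`. -/
def interference (D : Downlink N s Ω) (l : Fin (N.numBands s)) (ω : Ω) : ℝ :=
  (∑' f, if f = D.serving ω then 0 else N.PS * D.gain l s f ω * ‖D.bs s f ω‖ ^ (-N.α)) +
    ∑ b ∈ (N.group s l).erase s,
      ∑' f, D.buyerPower l b f ω * D.gain l b f ω * ‖D.bs b f ω‖ ^ (-N.α)

/-- The SINR at the typical user on sub-band `l`. -/
def sinr (D : Downlink N s Ω) (l : Fin (N.numBands s)) (ω : Ω) : ℝ :=
  N.PS * D.gain l s (D.serving ω) ω * ‖D.bs s (D.serving ω) ω‖ ^ (-N.α) /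
    (D.interference l ω + N.σ ^ 2)

/-- The transmit powers, on sub-band `l`, of all base stations of the buyers sharing it. -/
def buyerPowers (D : Downlink N s Ω) (l : Fin (N.numBands s)) (ω : Ω) :
    {b // b ∈ (N.group s l).erase s} → ℕ → ℝ :=
  fun b f => D.buyerPower l b f ω

/-- The probabilistic assumptions. Sub-band by sub-band, the networks of the sharing operators are
independent, each one being a homogeneous Poisson process of base stations that carry independent
marks: Rayleigh fading gains and, for buyers, transmit powers distributed as the allowed power
`ζ s / H`, where `H` is the largest gain towards a Poisson process of users. Nothing is assumed
about the joint law of different sub-bands. -/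
structure IsModel [MeasurableSpace Ω] (D : Downlink N s Ω) (Pr : Measure Ω) : Prop where
  ue_ppp : IsHomogeneousPPP D.ue (N.ueIntensity s) Pr
  ueGain_law : ∀ l i, HasLaw (D.ueGain l i) (expMeasure 1) Pr
  ueGain_indep : ∀ l, iIndepFun (fun i => D.ueGain l i) Pr
  ue_indep_ueGain : ∀ l, IndepFun (fun ω i => D.ue i ω) (fun ω i => D.ueGain l i ω) Pr
  bs_ppp : ∀ k ∈ N.sellers ∪ N.buyers, IsHomogeneousPPP (D.bs k) (N.bsIntensity k) Pr
  gain_law : ∀ l, ∀ k ∈ N.group s l, ∀ f, HasLaw (D.gain l k f) (expMeasure 1) Pr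
  power_law : ∀ l, ∀ b ∈ (N.group s l).erase s, ∀ f,
    IdentDistrib (D.buyerPower l b f) (D.allowedPower l) Pr Pr
  operators_indep : ∀ l, iIndepFun (fun (k : {k // k ∈ N.group s l}) ω =>
    ((fun f => D.bs k f ω), (fun f => (D.gain l k f ω, D.txPower l k f ω)))) Pr
  bs_indep_marks : ∀ l, ∀ k ∈ N.group s l,
    IndepFun (fun ω f => D.bs k f ω) (fun ω f => (D.gain l k f ω, D.txPower l k f ω)) Pr
  marks_indep : ∀ l, ∀ k ∈ N.group s l,
    iIndepFun (fun f ω => (D.gain l k f ω, D.txPower l k f ω)) Pr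
  gain_indep_power : ∀ l, ∀ k ∈ N.group s l, ∀ f,
    IndepFun (D.gain l k f) (D.txPower l k f) Pr

variable [MeasurableSpace Ω]

/-- The conditional law of the SINR on sub-band `l` given the buyers' transmit powers. -/
def sinrLaw (D : Downlink N s Ω) (Pr : Measure Ω) [IsFiniteMeasure Pr]
    (l : Fin (N.numBands s)) : Kernel ({b // b ∈ (N.group s l).erase s} → ℕ → ℝ) ℝ :=
  condDistrib (D.sinr l) (D.buyerPowers l) Pr

/-- The average rate of the typical user: the sum over the sub-bands of
`E_P [E_γ [ln (1 + γ)]]`. -/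
def averageRate (D : Downlink N s Ω) (Pr : Measure Ω) [IsFiniteMeasure Pr] : ℝ :=
  ∑ l, ∫ p, (∫ γ, Real.log (1 + γ) ∂(D.sinrLaw Pr l p)) ∂(Pr.map (D.buyerPowers l))

/-- The expectation `E [P ^ (2 / α)]` of a buyer's transmit power `P` on sub-band `l`. -/
def powerMoment (D : Downlink N s Ω) (Pr : Measure Ω) (l : Fin (N.numBands s)) : ℝ :=
  ∫ ω, D.allowedPower l ω ^ (2 / N.α) ∂Pr

end Downlink

/-- `ρ(α, β)` for finite `β`. -/
def rho (α β : ℝ) : ℝ := ∫ ν in Ioi (β ^ (-(2 / α))), 1 / (1 + ν ^ (α / 2))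

/-- `ρ(α, ∞)`. -/
def rhoInf (α : ℝ) : ℝ := ∫ ν in Ioi (0 : ℝ), 1 / (1 + ν ^ (α / 2))

/-- The Laplace transform expression of the interference at a typical user of seller `s` on
sub-band `l`, at the point `κ` and for the threshold `β`; `M` is the moment `E [P ^ (2 / α)]`. -/
def laplaceInterference (N : Network O) (s : O) (l : Fin (N.numBands s)) (M β κ : ℝ) : ℝ :=
  Real.exp (-(Real.pi * N.bsIntensity s * N.PS ^ (2 / N.α) * κ ^ (2 / N.α) * rho N.α β)) *
  Real.exp (-(Real.pi * (∑ b ∈ (N.group s l).erase s, N.bsIntensity b) * M * κ ^ (2 / N.α) *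
    rhoInf N.α))

/-- The integrand, in `z`, of the coverage probability at threshold `β`. -/
def coverageIntegrand (N : Network O) (s : O) (l : Fin (N.numBands s)) (M β z : ℝ) : ℝ :=
  Real.pi * N.bsIntensity s * N.PS ^ (2 / N.α) *
    Real.exp (-(β * N.σ ^ 2 * z ^ (N.α / 2))) *
    Real.exp (-(Real.pi * N.bsIntensity s * N.PS ^ (2 / N.α) * z)) *
    laplaceInterference N s l M β (β * z ^ (N.α / 2))

end SpectrumSharing

end

/-!
A homogeneous Poisson process on the plane becomes, after passing to squared distances, a Poisson
process of intensity `π c` on the half line. Its smallest point `z` is therefore exponential, and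
given `z` the remaining points form a Poisson process on `(z, ∞)`. The nearest base station is the
serving one; as its Rayleigh gain is exponential, the coverage probability given everything else is
`exp (-κ (I + σ²))`, with `I` the interference and `κ` proportional to the threshold. So coverage is
the Laplace transform of `I`, which the Laplace functional of marked Poisson processes evaluates:
the other base stations of the seller contribute `ρ(α, β)`, because they lie beyond `z`, and those
of the buyers contribute `ρ(α, ∞)` and the moment `E [P ^ (2 / α)]`. Integrating the tail
`P [γ > e ^ t - 1]` over `t` gives the mean of `ln (1 + γ)`; it is finite because the tail is at
most `1` and decays like `e ^ (-2 t / α)`.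
-/

namespace SpectrumSharing

open Filter Topology

/-- The function `x ↦ exp (-x)` on the extended nonnegative reals. Allowing the value `∞`, where
it vanishes, lets Laplace functionals include void probabilities. -/
noncomputable def expNeg (x : ℝ≥0∞) : ℝ≥0∞ := EReal.exp (-(x : EReal))

/-- The function `y ↦ -log y`, truncated at zero; it is inverse to `expNeg` on the unit
interval. -/
noncomputable def negLog (y : ℝ≥0∞) : ℝ≥0∞ := (-(ENNReal.log y)).toENNReal

section ExpNeg

@[simp] lemma expNeg_zero : expNeg 0 = 1 := by simp [expNeg]

@[simp] lemma expNeg_top : expNeg ∞ = 0 := by simp [expNeg]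

lemma expNeg_ofReal {r : ℝ} (hr : 0 ≤ r) :
    expNeg (ENNReal.ofReal r) = ENNReal.ofReal (Real.exp (-r)) := by
  rw [expNeg, EReal.coe_ennreal_ofReal, max_eq_left hr, ← EReal.coe_neg, EReal.exp_coe]

lemma expNeg_add (x y : ℝ≥0∞) : expNeg (x + y) = expNeg x * expNeg y := by
  rw [expNeg, expNeg, expNeg, ← EReal.exp_add, EReal.coe_ennreal_add,
    EReal.neg_add (.inl (EReal.coe_ennreal_ne_bot _)) (.inr (EReal.coe_ennreal_ne_bot _)),
    sub_eq_add_neg]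

lemma continuous_expNeg : Continuous expNeg :=
  ENNReal.continuous_exp.comp (continuous_neg.comp continuous_coe_ennreal_ereal)

@[fun_prop] lemma measurable_expNeg : Measurable expNeg := continuous_expNeg.measurable

lemma expNeg_antitone : Antitone expNeg := fun x y h => by
  simpa only [expNeg, EReal.exp_le_exp_iff, EReal.neg_le_neg_iff,
    EReal.coe_ennreal_le_coe_ennreal_iff] using h

lemma expNeg_le_one (x : ℝ≥0∞) : expNeg x ≤ 1 := by
  simpa using expNeg_antitone (zero_le (a := x))

lemma expNeg_ne_top (x : ℝ≥0∞) : expNeg x ≠ ∞ :=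
  ne_top_of_le_ne_top ENNReal.one_ne_top (expNeg_le_one x)

lemma expNeg_eq_zero_iff {x : ℝ≥0∞} : expNeg x = 0 ↔ x = ∞ := by
  simp [expNeg]

lemma expNeg_sum {ι : Type*} (s : Finset ι) (f : ι → ℝ≥0∞) :
    expNeg (∑ i ∈ s, f i) = ∏ i ∈ s, expNeg (f i) := by
  classical
  induction s using Finset.induction_on with
  | empty => simp
  | insert a s ha ih => rw [Finset.sum_insert ha, Finset.prod_insert ha, expNeg_add, ih]

lemma expNeg_mul_natCast (a : ℝ≥0∞) (k : ℕ) : expNeg (a * k) = expNeg a ^ k := by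
  simpa [mul_comm] using expNeg_sum (Finset.range k) fun _ => a

lemma tendsto_expNeg_sum_range (f : ℕ → ℝ≥0∞) :
    Tendsto (fun n => ∏ i ∈ Finset.range n, expNeg (f i)) atTop (𝓝 (expNeg (∑' i, f i))) := by
  simp_rw [← expNeg_sum]
  exact (continuous_expNeg.tendsto _).comp (ENNReal.tendsto_nat_tsum f)

lemma tendsto_one_sub_expNeg {ι : Type*} {l : Filter ι} {f : ι → ℝ≥0∞} {x : ℝ≥0∞}
    (h : Tendsto f l (𝓝 x)) : Tendsto (fun i => 1 - expNeg (f i)) l (𝓝 (1 - expNeg x)) :=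
  ENNReal.Tendsto.sub tendsto_const_nhds ((continuous_expNeg.tendsto x).comp h)
    (.inl ENNReal.one_ne_top)

lemma one_sub_expNeg_mono : Monotone fun x => 1 - expNeg x :=
  fun _ _ h => tsub_le_tsub_left (expNeg_antitone h) 1

lemma lintegral_expNeg_le_one {α : Type*} [MeasurableSpace α] (μ : Measure α)
    [IsProbabilityMeasure μ] (f : α → ℝ≥0∞) : ∫⁻ a, expNeg (f a) ∂μ ≤ 1 := by
  simpa using lintegral_mono (μ := μ) fun a => expNeg_le_one (f a)

end ExpNeg

section NegLog

lemma expNeg_negLog {y : ℝ≥0∞} (hy : y ≤ 1) : expNeg (negLog y) = y := by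
  rw [expNeg, negLog, EReal.coe_toENNReal (by simpa using hy), neg_neg, ENNReal.exp_log]

lemma negLog_antitone : Antitone negLog := fun _ _ h =>
  EReal.toENNReal_le_toENNReal (EReal.neg_le_neg_iff.2 (ENNReal.log_le_log h))

lemma continuous_negLog : Continuous negLog :=
  EReal.continuous_toENNReal.comp (continuous_neg.comp ENNReal.continuous_log)

@[fun_prop] lemma measurable_negLog : Measurable negLog := continuous_negLog.measurable

lemma expNeg_negLog_inv_one_add (x : ℝ≥0∞) : expNeg (negLog (1 + x)⁻¹) = (1 + x)⁻¹ :=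
  expNeg_negLog (ENNReal.inv_le_one.2 le_self_add)

lemma negLog_inv_one_add_ne_top {x : ℝ≥0∞} (hx : x ≠ ∞) : negLog (1 + x)⁻¹ ≠ ∞ := by
  rw [Ne, ← expNeg_eq_zero_iff, expNeg_negLog_inv_one_add]
  simpa using hx

end NegLog

section Laplace

variable {Ω : Type*} [MeasurableSpace Ω] {Pr : Measure Ω} [IsProbabilityMeasure Pr]

/- As `c → 0`, the Laplace transform `E exp (-c S)` tends to the probability that `S` is finite. -/
lemma ae_ne_top_of_tendsto_laplace {S : Ω → ℝ≥0∞} (hS : AEMeasurable S Pr) {c : ℕ → ℝ≥0∞}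
    (hc : ∀ n, c n ≠ 0) (h : Tendsto (fun n => ∫⁻ ω, expNeg (c n * S ω) ∂Pr) atTop (𝓝 1)) :
    ∀ᵐ ω ∂Pr, S ω ≠ ∞ := by
  have hfin : NullMeasurableSet {ω | S ω ≠ ∞} Pr :=
    hS.nullMeasurableSet_preimage (measurableSet_singleton ∞).compl
  have hle (n) : ∫⁻ ω, expNeg (c n * S ω) ∂Pr ≤ Pr {ω | S ω ≠ ∞} := by
    rw [← lintegral_indicator_one₀ hfin]
    refine lintegral_mono fun ω => ?_
    by_cases hω : S ω = ∞
    · simp [hω, ENNReal.mul_top (hc n)]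
    · rw [indicator_of_mem (by exact hω)]
      exact expNeg_le_one _
  have hone : Pr {ω | S ω ≠ ∞} = 1 := le_antisymm prob_le_one (le_of_tendsto' h hle)
  simpa [ae_iff, compl_def] using (prob_compl_eq_zero_iff₀ hfin).2 hone

lemma lintegral_expNeg_tsum_infinitePi {𝓜 : Type*} [MeasurableSpace 𝓜] (ν : Measure 𝓜)
    [IsProbabilityMeasure ν] {g : ℕ → 𝓜 → ℝ≥0∞} (hg : ∀ n, Measurable (g n)) :
    ∫⁻ m, expNeg (∑' n, g n (m n)) ∂(Measure.infinitePi fun _ : ℕ => ν) =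
      expNeg (∑' n, negLog (∫⁻ y, expNeg (g n y) ∂ν)) := by
  have hfin (n) : ∫⁻ m, ∏ i ∈ Finset.range n, expNeg (g i (m i))
      ∂(Measure.infinitePi fun _ : ℕ => ν) =
      ∏ i ∈ Finset.range n, expNeg (negLog (∫⁻ y, expNeg (g i y) ∂ν)) := by
    rw [lintegral_prod_eq_prod_lintegral_of_indepFun (Finset.range n)
      (fun i (m : ℕ → 𝓜) => expNeg (g i (m i)))
      (iIndepFun_infinitePi (X := fun i y => expNeg (g i y)) fun i => by fun_prop)
      fun i => by fun_prop]
    refine Finset.prod_congr rfl fun i _ => ?_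
    rw [expNeg_negLog (lintegral_expNeg_le_one ν _)]
    conv_rhs => rw [← Measure.infinitePi_map_eval (fun _ : ℕ => ν) i]
    rw [lintegral_map (by fun_prop) (by fun_prop)]
  refine tendsto_nhds_unique ?_ (tendsto_expNeg_sum_range _)
  simp_rw [← hfin]
  exact tendsto_lintegral_of_dominated_convergence (fun _ => 1) (fun n => by fun_prop)
    (fun n => ae_of_all _ fun m => Finset.prod_le_one' fun i _ => expNeg_le_one _) (by simp)
    (ae_of_all _ fun m => tendsto_expNeg_sum_range _)

lemma lintegral_comp_prodMk_of_indepFun {𝓤 𝓥 : Type*} [MeasurableSpace 𝓤] [MeasurableSpace 𝓥]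
    {U : Ω → 𝓤} {V : Ω → 𝓥} (hU : AEMeasurable U Pr) (hV : AEMeasurable V Pr)
    (h : IndepFun U V Pr) {F : 𝓤 × 𝓥 → ℝ≥0∞} (hF : Measurable F) :
    ∫⁻ ω, F (U ω, V ω) ∂Pr = ∫⁻ ω, ∫⁻ v, F (U ω, v) ∂(Pr.map V) ∂Pr := by
  have := Measure.isProbabilityMeasure_map (μ := Pr) hV
  rw [← lintegral_map' hF.aemeasurable (hU.prodMk hV),
    (indepFun_iff_map_prod_eq_prod_map_map hU hV).1 h, lintegral_prod _ hF.aemeasurable,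
    lintegral_map' (hF.lintegral_prod_right').aemeasurable hU]

end Laplace

section Poisson

lemma pairwise_disjoint_pointCount_eq {Ω E : Type*} (X : ℕ → Ω → E) (B : Set E) :
    Pairwise fun i j : ℕ =>
      Disjoint ({ω | pointCount X B ω = (i : ℝ≥0∞)}) ({ω | pointCount X B ω = (j : ℝ≥0∞)}) :=
  (pairwise_disjoint_fiber _).comp_of_injective Nat.cast_injective

lemma two_le_pointCount {Ω E : Type*} {X : ℕ → Ω → E} {B : Set E} {ω : Ω} {i j : ℕ} (hij : i ≠ j)
    (hi : X i ω ∈ B) (hj : X j ω ∈ B) : 2 ≤ pointCount X B ω := by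
  refine le_trans ?_ (ENNReal.sum_le_tsum {i, j})
  rw [Finset.sum_pair hij, indicator_of_mem hi, indicator_of_mem hj]
  norm_num

lemma tsum_simpleFunc_eq_sum_pointCount {Ω E : Type*} [MeasurableSpace E] (X : ℕ → Ω → E)
    (f : SimpleFunc E ℝ≥0∞) (ω : Ω) :
    ∑' n, f (X n ω) = ∑ y : f.range, (y : ℝ≥0∞) * pointCount X (f ⁻¹' {(y : ℝ≥0∞)}) ω := by
  simp_rw [pointCount, ← ENNReal.tsum_mul_left]
  rw [← Summable.tsum_finsetSum fun _ _ => ENNReal.summable]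
  refine tsum_congr fun n => ?_
  rw [Finset.sum_eq_single (⟨f (X n ω), f.mem_range_self _⟩ : f.range)]
  · simp
  · intro y _ hy
    rw [indicator_of_notMem, mul_zero]
    exact fun h => hy (Subtype.ext (by simpa using h.symm))
  · simp

variable {Ω E : Type*} [MeasurableSpace Ω] [MeasurableSpace E]

lemma measurable_pointCount {X : ℕ → Ω → E} (hX : ∀ n, Measurable (X n)) {B : Set E}
    (hB : MeasurableSet B) : Measurable (pointCount X B) :=
  Measurable.tsum fun n => (measurable_const.indicator hB).comp (hX n)

lemma exists_seq_simpleFunc_tendsto (Λ : Measure E) [SigmaFinite Λ] {f : E → ℝ≥0∞}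
    (hf : Measurable f) :
    ∃ g : ℕ → SimpleFunc E ℝ≥0∞, (∀ x, Monotone fun m => g m x) ∧
      (∀ x, Tendsto (fun m => g m x) atTop (𝓝 (f x))) ∧ ∀ m, ∀ y ≠ 0, Λ (g m ⁻¹' {y}) ≠ ∞ := by
  have hg (m x) : (SimpleFunc.eapprox f m).restrict (spanningSets Λ m) x =
      (spanningSets Λ m).indicator (SimpleFunc.eapprox f m) x := by
    rw [SimpleFunc.restrict_apply _ (measurableSet_spanningSets Λ m)]
  refine ⟨fun m => (SimpleFunc.eapprox f m).restrict (spanningSets Λ m), fun x m m' h => ?_,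
    fun x => ?_, fun m y hy => ?_⟩
  · simp only [hg]
    exact (indicator_le_indicator_of_subset (monotone_spanningSets Λ h)
      (fun _ => zero_le) x).trans (indicator_le_indicator (SimpleFunc.monotone_eapprox f h x))
  · obtain ⟨m₀, hm₀⟩ := mem_iUnion.1 ((iUnion_spanningSets Λ).ge (mem_univ x))
    refine (SimpleFunc.tendsto_eapprox hf x).congr' ?_
    filter_upwards [eventually_ge_atTop m₀] with m hm
    rw [hg, indicator_of_mem (monotone_spanningSets Λ hm hm₀)]
  · refine ne_top_of_le_ne_top (measure_spanningSets_lt_top Λ m).ne (measure_mono fun x hx => ?_)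
    by_contra hxm
    rw [mem_preimage, mem_singleton_iff, hg, indicator_of_notMem hxm] at hx
    exact hy hx.symm

lemma tsum_poisson_mul_pow {x y : ℝ} (hx : 0 ≤ x) (hy : 0 ≤ y) :
    ∑' k : ℕ, ENNReal.ofReal (Real.exp (-x) * x ^ k / (k.factorial : ℝ)) * ENNReal.ofReal y ^ k =
      ENNReal.ofReal (Real.exp (-((1 - y) * x))) := by
  have hterm (k : ℕ) :
      ENNReal.ofReal (Real.exp (-x) * x ^ k / (k.factorial : ℝ)) * ENNReal.ofReal y ^ k =
        ENNReal.ofReal (Real.exp (-x) * ((x * y) ^ k / (k.factorial : ℝ))) := by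
    rw [← ENNReal.ofReal_pow hy, ← ENNReal.ofReal_mul (by positivity)]
    congr 1
    rw [mul_pow]; ring
  have hsum : HasSum (fun k : ℕ => Real.exp (-x) * ((x * y) ^ k / (k.factorial : ℝ)))
      (Real.exp (-x) * Real.exp (x * y)) := by
    rw [Real.exp_eq_exp_ℝ]
    exact (NormedSpace.expSeries_div_hasSum_exp (x * y)).mul_left _
  simp_rw [hterm]
  rw [← ENNReal.ofReal_tsum_of_nonneg (fun k => by positivity) hsum.summable, hsum.tsum_eq,
    ← Real.exp_add]
  congr 2; ring

namespace IsPoissonProcess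

variable {X : ℕ → Ω → E} {Λ : Measure E} {Pr : Measure Ω}

lemma map {E' : Type*} [MeasurableSpace E'] (hX : IsPoissonProcess X Λ Pr) {φ : E → E'}
    (hφ : Measurable φ) : IsPoissonProcess (fun n ω => φ (X n ω)) (Λ.map φ) Pr where
  measurable n := hφ.comp (hX.measurable n)
  count_law B hB hΛ k := by
    rw [Measure.map_apply hφ hB] at hΛ ⊢
    exact hX.count_law (φ ⁻¹' B) (hφ hB) hΛ k
  count_indep m B hB hd :=
    hX.count_indep m (fun i => φ ⁻¹' B i) (fun i => hφ (hB i))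
      (fun _ _ hij => (hd hij).preimage φ)

lemma iIndepFun_pointCount (hX : IsPoissonProcess X Λ Pr) {ι : Type*} [Finite ι] {B : ι → Set E}
    (hB : ∀ i, MeasurableSet (B i)) (hd : Pairwise fun i j => Disjoint (B i) (B j)) :
    iIndepFun (fun i => pointCount X (B i)) Pr := by
  obtain ⟨m, ⟨e⟩⟩ := Finite.exists_equiv_fin ι
  simpa [Function.comp_def] using (hX.count_indep m (fun i => B (e.symm i)) (fun i => hB _)
    (hd.comp_of_injective e.symm.injective)).precomp e.injective

section Count

variable {B : Set E}

lemma measurableSet_pointCount_eq (hX : IsPoissonProcess X Λ Pr) (hB : MeasurableSet B)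
    (k : ℝ≥0∞) : MeasurableSet ({ω | pointCount X B ω = k}) :=
  measurable_pointCount hX.measurable hB (measurableSet_singleton _)

variable [IsProbabilityMeasure Pr]

lemma ae_exists_natCast (hX : IsPoissonProcess X Λ Pr) (hB : MeasurableSet B) (hΛ : Λ B ≠ ∞) :
    ∀ᵐ ω ∂Pr, ∃ k : ℕ, pointCount X B ω = k := by
  have hmeas (k : ℕ) := hX.measurableSet_pointCount_eq hB k
  have hmass : Pr (⋃ k : ℕ, {ω | pointCount X B ω = (k : ℝ≥0∞)}) = 1 := by
    rw [measure_iUnion (pairwise_disjoint_pointCount_eq X B) hmeas]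
    have := tsum_poisson_mul_pow (ENNReal.toReal_nonneg (a := Λ B)) zero_le_one
    simp only [ENNReal.ofReal_one, one_pow, mul_one, sub_self, zero_mul, neg_zero,
      Real.exp_zero] at this
    rw [← this]
    exact tsum_congr fun k => hX.count_law B hB hΛ k
  filter_upwards [(mem_ae_iff_prob_eq_one (.iUnion hmeas)).2 hmass] with ω hω
  simpa using hω

lemma lintegral_expNeg_mul_pointCount (hX : IsPoissonProcess X Λ Pr) (hB : MeasurableSet B)
    (hΛ : Λ B ≠ ∞) (a : ℝ≥0∞) :
    ∫⁻ ω, expNeg (a * pointCount X B ω) ∂Pr = expNeg ((1 - expNeg a) * Λ B) := by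
  have hcover : (univ : Set Ω) =ᵐ[Pr] ⋃ k : ℕ, {ω | pointCount X B ω = (k : ℝ≥0∞)} := by
    filter_upwards [hX.ae_exists_natCast hB hΛ] with ω hω
    exact propext ⟨fun _ => mem_iUnion.2 hω, fun _ => trivial⟩
  have hmeas (k : ℕ) := hX.measurableSet_pointCount_eq hB k
  have hterm (k : ℕ) :
      ∫⁻ ω in {ω | pointCount X B ω = (k : ℝ≥0∞)}, expNeg (a * pointCount X B ω) ∂Pr =
        ENNReal.ofReal (Real.exp (-(Λ B).toReal) * (Λ B).toReal ^ k / (k.factorial : ℝ)) *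
          ENNReal.ofReal (expNeg a).toReal ^ k := by
    rw [setLIntegral_congr_fun (g := fun _ => expNeg a ^ k) (hmeas k)
      (fun ω hω => by rw [show pointCount X B ω = k from hω, expNeg_mul_natCast]),
      setLIntegral_const, hX.count_law B hB hΛ k, mul_comm,
      ENNReal.ofReal_toReal (expNeg_ne_top _)]
  have hle : (expNeg a).toReal ≤ 1 := by
    simpa using ENNReal.toReal_mono ENNReal.one_ne_top (expNeg_le_one a)
  rw [← setLIntegral_univ, setLIntegral_congr hcover,
    lintegral_iUnion hmeas (pairwise_disjoint_pointCount_eq X B)]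
  simp_rw [hterm]
  rw [tsum_poisson_mul_pow ENNReal.toReal_nonneg ENNReal.toReal_nonneg,
    ← expNeg_ofReal (mul_nonneg (by linarith) ENNReal.toReal_nonneg),
    ENNReal.ofReal_mul (by linarith), ENNReal.ofReal_toReal hΛ,
    ENNReal.ofReal_sub _ ENNReal.toReal_nonneg, ENNReal.ofReal_one,
    ENNReal.ofReal_toReal (expNeg_ne_top _)]

lemma measure_two_le_pointCount_le (hX : IsPoissonProcess X Λ Pr) (hB : MeasurableSet B)
    (hΛ : Λ B ≠ ∞) : Pr {ω | 2 ≤ pointCount X B ω} ≤ Λ B ^ 2 := by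
  have hsub : {ω | 2 ≤ pointCount X B ω} ⊆ ({ω | pointCount X B ω = ((0 : ℕ) : ℝ≥0∞)} ∪
      {ω | pointCount X B ω = ((1 : ℕ) : ℝ≥0∞)})ᶜ := by
    intro ω hω
    simp only [mem_ofPred_eq] at hω
    simp only [mem_compl_iff, mem_union, mem_ofPred_eq, not_or]
    constructor <;> intro h <;> rw [h] at hω <;> norm_num at hω
  have hexp := Real.add_one_le_exp (-(Λ B).toReal)
  have hx : 0 ≤ (Λ B).toReal := ENNReal.toReal_nonneg
  refine (measure_mono hsub).trans ?_
  rw [prob_compl_eq_one_sub ((hX.measurableSet_pointCount_eq hB _).union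
      (hX.measurableSet_pointCount_eq hB _)),
    measure_union (pairwise_disjoint_pointCount_eq X B zero_ne_one)
      (hX.measurableSet_pointCount_eq hB _),
    hX.count_law B hB hΛ 0, hX.count_law B hB hΛ 1,
    ← ENNReal.ofReal_add (by positivity) (by positivity), ← ENNReal.ofReal_one,
    ← ENNReal.ofReal_sub _ (by positivity)]
  refine (ENNReal.ofReal_le_ofReal (q := (Λ B).toReal ^ 2) ?_).trans_eq
    (by rw [ENNReal.ofReal_pow hx, ENNReal.ofReal_toReal hΛ])
  simp only [pow_zero, mul_one, Nat.factorial_zero, Nat.cast_one, div_one, pow_one,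
    Nat.factorial_one]
  nlinarith

lemma ae_forall_notMem (hX : IsPoissonProcess X Λ Pr) (hB : MeasurableSet B) (h0 : Λ B = 0) :
    ∀ᵐ ω ∂Pr, ∀ n, X n ω ∉ B := by
  have hone : Pr ({ω | pointCount X B ω = ((0 : ℕ) : ℝ≥0∞)}) = 1 := by
    simpa [h0] using hX.count_law B hB (by simp [h0]) 0
  filter_upwards [(mem_ae_iff_prob_eq_one (hX.measurableSet_pointCount_eq hB _)).2 hone]
    with ω hω n hn
  simp only [Nat.cast_zero, pointCount,
    ENNReal.tsum_eq_zero] at hω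
  simpa [hn] using hω n

lemma ae_finite (hX : IsPoissonProcess X Λ Pr) (hB : MeasurableSet B) (hΛ : Λ B ≠ ∞) :
    ∀ᵐ ω ∂Pr, {n | X n ω ∈ B}.Finite := by
  filter_upwards [hX.ae_exists_natCast hB hΛ] with ω ⟨k, hk⟩
  refine (ENNReal.finite_const_le_of_tsum_ne_top
    (a := fun n => B.indicator (fun _ => (1 : ℝ≥0∞)) (X n ω))
    (hk.trans_ne (ENNReal.natCast_ne_top k)) one_ne_zero).subset fun n hn => ?_
  simp only [mem_ofPred_eq] at hn ⊢
  simp [hn]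

end Count

variable [IsProbabilityMeasure Pr]

lemma lintegral_expNeg_simpleFunc (hX : IsPoissonProcess X Λ Pr) (f : SimpleFunc E ℝ≥0∞)
    (hf : ∀ y ≠ 0, Λ (f ⁻¹' {y}) ≠ ∞) :
    ∫⁻ ω, expNeg (∑' n, f (X n ω)) ∂Pr = expNeg (∫⁻ x, (1 - expNeg (f x)) ∂Λ) := by
  have hB (y : f.range) : MeasurableSet (f ⁻¹' {(y : ℝ≥0∞)}) := f.measurableSet_fiber _
  have hcount (y : f.range) := measurable_pointCount hX.measurable (hB y)
  have hind : iIndepFun (fun y : f.range => pointCount X (f ⁻¹' {(y : ℝ≥0∞)})) Pr :=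
    hX.iIndepFun_pointCount hB ((pairwise_disjoint_fiber f).comp_of_injective
      Subtype.val_injective)
  have hterm (y : f.range) : ∫⁻ ω, expNeg (y * pointCount X (f ⁻¹' {(y : ℝ≥0∞)}) ω) ∂Pr =
      expNeg ((1 - expNeg y) * Λ (f ⁻¹' {(y : ℝ≥0∞)})) := by
    by_cases h0 : (y : ℝ≥0∞) = 0
    · simp [h0]
    · exact hX.lintegral_expNeg_mul_pointCount (hB y) (hf _ h0) _
  simp_rw [tsum_simpleFunc_eq_sum_pointCount, expNeg_sum]
  rw [lintegral_prod_eq_prod_lintegral_of_indepFun Finset.univ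
    (fun (y : f.range) ω => expNeg (y * pointCount X (f ⁻¹' {(y : ℝ≥0∞)}) ω))
    (hind.comp (fun y c => expNeg (y * c)) fun y => by fun_prop) fun y => by fun_prop]
  simp_rw [hterm]
  rw [← expNeg_sum, show (fun x => 1 - expNeg (f x)) = f.map fun y => 1 - expNeg y from rfl,
    SimpleFunc.lintegral_eq_lintegral, SimpleFunc.map_lintegral, ← Finset.sum_coe_sort f.range]

variable [SigmaFinite Λ]

theorem laplace_functional (hX : IsPoissonProcess X Λ Pr) {f : E → ℝ≥0∞} (hf : Measurable f) :
    ∫⁻ ω, expNeg (∑' n, f (X n ω)) ∂Pr = expNeg (∫⁻ x, (1 - expNeg (f x)) ∂Λ) := by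
  obtain ⟨g, hmono, htend, hfin⟩ := exists_seq_simpleFunc_tendsto Λ hf
  have hgm (m) : Measurable (g m) := (g m).measurable
  have hXm := hX.measurable
  have hsum (ω) : Tendsto (fun m => ∑' n, g m (X n ω)) atTop (𝓝 (∑' n, f (X n ω))) := by
    simp_rw [← lintegral_count]
    exact lintegral_tendsto_of_tendsto_of_monotone
      (fun m => (measurable_of_countable _).aemeasurable)
      (ae_of_all _ fun n => hmono _) (ae_of_all _ fun n => htend _)
  have hleft : Tendsto (fun m => ∫⁻ ω, expNeg (∑' n, g m (X n ω)) ∂Pr) atTop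
      (𝓝 (∫⁻ ω, expNeg (∑' n, f (X n ω)) ∂Pr)) :=
    tendsto_lintegral_of_dominated_convergence (fun _ => 1)
      (fun m => measurable_expNeg.comp (Measurable.tsum fun n => by fun_prop))
      (fun m => ae_of_all _ fun ω => expNeg_le_one _) (by simp)
      (ae_of_all _ fun ω => (continuous_expNeg.tendsto _).comp (hsum ω))
  have hright : Tendsto (fun m => expNeg (∫⁻ x, (1 - expNeg (g m x)) ∂Λ)) atTop
      (𝓝 (expNeg (∫⁻ x, (1 - expNeg (f x)) ∂Λ))) :=
    (continuous_expNeg.tendsto _).comp <| lintegral_tendsto_of_tendsto_of_monotone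
      (fun m => by fun_prop) (ae_of_all _ fun x => one_sub_expNeg_mono.comp (hmono x))
      (ae_of_all _ fun x => tendsto_one_sub_expNeg (htend x))
  refine tendsto_nhds_unique hleft (hright.congr fun m => ?_)
  exact (hX.lintegral_expNeg_simpleFunc (g m) (hfin m)).symm

theorem marked_laplace_functional {𝓜 : Type*} [MeasurableSpace 𝓜] {M : ℕ → Ω → 𝓜}
    {ν : Measure 𝓜} [IsProbabilityMeasure ν] (hX : IsPoissonProcess X Λ Pr)
    (hM : ∀ n, HasLaw (M n) ν Pr) (hMi : iIndepFun M Pr)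
    (hXM : IndepFun (fun ω n => X n ω) (fun ω n => M n ω) Pr) {g : E × 𝓜 → ℝ≥0∞}
    (hg : Measurable g) :
    ∫⁻ ω, expNeg (∑' n, g (X n ω, M n ω)) ∂Pr =
      expNeg (∫⁻ x, (1 - ∫⁻ m, expNeg (g (x, m)) ∂ν) ∂Λ) := by
  have hMm : AEMeasurable (fun ω n => M n ω) Pr :=
    aemeasurable_pi_iff.2 fun n => (hM n).aemeasurable
  have hXm : Measurable (fun ω n => X n ω) := measurable_pi_iff.2 hX.measurable
  have hlaw : Pr.map (fun ω n => M n ω) = Measure.infinitePi fun _ : ℕ => ν := by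
    rw [hMi.map_fun_eq_infinitePi_map₀ hMm]
    exact congrArg _ (funext fun n => (hM n).map_eq)
  have hmark : Measurable fun x => negLog (∫⁻ m, expNeg (g (x, m)) ∂ν) :=
    measurable_negLog.comp
      (Measurable.lintegral_prod_right' (f := fun p => expNeg (g p)) (by fun_prop))
  rw [lintegral_comp_prodMk_of_indepFun hXm.aemeasurable hMm hXM
    (F := fun p : (ℕ → E) × (ℕ → 𝓜) => expNeg (∑' n, g (p.1 n, p.2 n)))
    (measurable_expNeg.comp (Measurable.tsum fun n => by fun_prop)), hlaw]
  calc ∫⁻ ω, ∫⁻ m, expNeg (∑' n, g (X n ω, m n)) ∂(Measure.infinitePi fun _ : ℕ => ν) ∂Pr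
      = ∫⁻ ω, expNeg (∑' n, negLog (∫⁻ y, expNeg (g (X n ω, y)) ∂ν)) ∂Pr :=
        lintegral_congr fun ω =>
          lintegral_expNeg_tsum_infinitePi ν (g := fun n y => g (X n ω, y)) fun n => by fun_prop
    _ = expNeg (∫⁻ x, (1 - ∫⁻ m, expNeg (g (x, m)) ∂ν) ∂Λ) := by
        simp_rw [hX.laplace_functional hmark, expNeg_negLog (lintegral_expNeg_le_one ν _)]

lemma ae_tsum_ne_top (hX : IsPoissonProcess X Λ Pr) {f : E → ℝ≥0∞} (hf : Measurable f)
    (hfin : ∀ᵐ x ∂Λ, f x ≠ ∞) (hint : ∫⁻ x, (1 - expNeg (f x)) ∂Λ ≠ ∞) :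
    ∀ᵐ ω ∂Pr, ∑' n, f (X n ω) ≠ ∞ := by
  have hXm := hX.measurable
  refine ae_ne_top_of_tendsto_laplace (c := fun n => ((n : ℝ≥0∞) + 1)⁻¹)
    (Measurable.tsum fun n => by fun_prop).aemeasurable (fun n => by simp) ?_
  simp_rw [← ENNReal.tsum_mul_left,
    hX.laplace_functional (f := fun x => _ * f x) (hf.const_mul _)]
  suffices h : Tendsto (fun n : ℕ => ∫⁻ x, (1 - expNeg (((n : ℝ≥0∞) + 1)⁻¹ * f x)) ∂Λ) atTop
      (𝓝 (∫⁻ _, 0 ∂Λ)) by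
    simpa [Function.comp_def] using (continuous_expNeg.tendsto _).comp h
  refine tendsto_lintegral_of_dominated_convergence (fun x => 1 - expNeg (f x))
    (fun n => by fun_prop) (fun n => ae_of_all _ fun x => ?_) hint ?_
  · exact one_sub_expNeg_mono (mul_le_of_le_one_left zero_le (ENNReal.inv_le_one.2 (by simp)))
  · filter_upwards [hfin] with x hx
    have hinv : Tendsto (fun n : ℕ => ((n : ℝ≥0∞) + 1)⁻¹) atTop (𝓝 0) := by
      simpa using (tendsto_add_atTop_iff_nat 1).2 ENNReal.tendsto_inv_nat_nhds_zero
    simpa using tendsto_one_sub_expNeg (ENNReal.Tendsto.mul_const hinv (.inr hx))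

end IsPoissonProcess
end Poisson

section HalfLine

variable {Ω : Type*} [MeasurableSpace Ω]

/-- The points of `U` form a homogeneous Poisson process of intensity `c` on the half-line. The
squared distances to the origin of a planar process are of this kind. -/
def IsHalfLinePPP (U : ℕ → Ω → ℝ) (c : ℝ) (Pr : Measure Ω) : Prop :=
  IsPoissonProcess U (ENNReal.ofReal c • (volume : Measure ℝ).restrict (Ioi 0)) Pr

instance (c : ℝ) : SigmaFinite (ENNReal.ofReal c • (volume : Measure ℝ).restrict (Ioi 0)) :=
  inferInstanceAs (SigmaFinite (c.toNNReal • (volume : Measure ℝ).restrict (Ioi 0)))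

instance (c : ℝ) :
    IsLocallyFiniteMeasure (ENNReal.ofReal c • (volume : Measure ℝ).restrict (Ioi 0)) :=
  inferInstanceAs (IsLocallyFiniteMeasure (c.toNNReal • (volume : Measure ℝ).restrict (Ioi 0)))

lemma volume_sq_norm_le (b : ℝ) :
    volume {x : Plane | ‖x‖ ^ 2 ≤ b} = ENNReal.ofReal (Real.pi * b) := by
  rcases lt_or_ge b 0 with hb | hb
  · rw [ENNReal.ofReal_of_nonpos (mul_nonpos_of_nonneg_of_nonpos Real.pi_pos.le hb.le)]
    have hempty : {x : Plane | ‖x‖ ^ 2 ≤ b} = ∅ :=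
      eq_empty_of_forall_notMem fun x hx => (hb.trans_le (sq_nonneg ‖x‖)).not_ge hx
    rw [hempty, measure_empty]
  · have hball : {x : Plane | ‖x‖ ^ 2 ≤ b} = Metric.closedBall 0 (√b) := by
      ext x
      simpa using (Real.le_sqrt (norm_nonneg x) hb).symm
    rw [hball, EuclideanSpace.volume_closedBall_fin_two,
      ← ENNReal.ofReal_pow (Real.sqrt_nonneg _), Real.sq_sqrt hb, ← ENNReal.ofReal_mul hb, mul_comm]

lemma map_sq_norm_volume :
    (volume : Measure Plane).map (fun x => ‖x‖ ^ 2) =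
      ENNReal.ofReal Real.pi • (volume : Measure ℝ).restrict (Ioi 0) := by
  symm
  refine Measure.ext_of_Ioc _ _ fun a b hab => ?_
  have hdiff : (fun x : Plane => ‖x‖ ^ 2) ⁻¹' Ioc a b = {x | ‖x‖ ^ 2 ≤ b} \ {x | ‖x‖ ^ 2 ≤ a} := by
    ext x
    simp [and_comm]
  have hmeas : MeasurableSet {x : Plane | ‖x‖ ^ 2 ≤ a} :=
    measurableSet_le (by fun_prop) (by fun_prop)
  have hsub : {x : Plane | ‖x‖ ^ 2 ≤ a} ⊆ {x | ‖x‖ ^ 2 ≤ b} := fun x hx => le_trans hx hab.le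
  rw [Measure.map_apply (by fun_prop) measurableSet_Ioc, hdiff,
    measure_sdiff hsub hmeas.nullMeasurableSet
      (by rw [volume_sq_norm_le]; exact ENNReal.ofReal_ne_top),
    volume_sq_norm_le, volume_sq_norm_le,
    Measure.smul_apply, Measure.restrict_apply measurableSet_Ioc, Ioc_inter_Ioi, Real.volume_Ioc,
    smul_eq_mul, ENNReal.ofReal_mul Real.pi_pos.le, ENNReal.ofReal_mul Real.pi_pos.le,
    ← ENNReal.mul_sub (by simp)]
  congr 1
  rcases le_total a 0 with ha | ha
  · simp [max_eq_right ha, ENNReal.ofReal_of_nonpos ha]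
  · rw [max_eq_left ha, ENNReal.ofReal_sub _ ha]

lemma exists_mem_Ico_div {x : ℝ} {V : ℕ} (h0 : 0 ≤ x) (hV : x < V) (m : ℕ) :
    ∃ k ∈ Finset.range (V * (m + 1)), x ∈ Ico ((k : ℝ) / (m + 1)) ((k + 1 : ℝ) / (m + 1)) := by
  have hm : (0 : ℝ) < m + 1 := by positivity
  have hx : 0 ≤ x * (m + 1) := by positivity
  refine ⟨⌊x * (m + 1)⌋₊, ?_, ?_⟩
  · rw [Finset.mem_range, Nat.floor_lt hx]
    push_cast
    gcongr
  · rw [mem_Ico, div_le_iff₀ hm, lt_div_iff₀ hm]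
    exact ⟨Nat.floor_le hx, Nat.lt_floor_add_one _⟩

lemma IsHomogeneousPPP.sq_norm {X : ℕ → Ω → Plane} {c : ℝ} {Pr : Measure Ω} (hc : 0 ≤ c)
    (hX : IsHomogeneousPPP X c Pr) :
    IsHalfLinePPP (fun n ω => ‖X n ω‖ ^ 2) (Real.pi * c) Pr := by
  have := IsPoissonProcess.map hX (φ := fun x : Plane => ‖x‖ ^ 2) (by fun_prop)
  rwa [Measure.map_smul, map_sq_norm_volume, smul_smul, ← ENNReal.ofReal_mul hc,
    mul_comm c] at this

namespace IsHalfLinePPP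

variable {U : ℕ → Ω → ℝ} {c : ℝ} {Pr : Measure Ω} [IsProbabilityMeasure Pr]

lemma ae_pos (hU : IsHalfLinePPP U c Pr) : ∀ᵐ ω ∂Pr, ∀ n, 0 < U n ω := by
  filter_upwards [IsPoissonProcess.ae_forall_notMem hU (measurableSet_Iic (a := (0 : ℝ)))
    (by simp [Measure.restrict_apply, Iic_inter_Ioi])] with ω hω n
  simpa using hω n

lemma ae_finite_le (hU : IsHalfLinePPP U c Pr) : ∀ᵐ ω ∂Pr, ∀ v : ℝ, {n | U n ω ≤ v}.Finite := by
  have hnat (k : ℕ) : ∀ᵐ ω ∂Pr, {n | U n ω ∈ Iic (k : ℝ)}.Finite := by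
    refine IsPoissonProcess.ae_finite hU measurableSet_Iic ?_
    rw [Measure.smul_apply, Measure.restrict_apply measurableSet_Iic, Iic_inter_Ioi,
      Real.volume_Ioc, smul_eq_mul]
    finiteness
  filter_upwards [ae_all_iff.2 hnat] with ω hω v
  obtain ⟨k, hk⟩ := exists_nat_ge v
  exact (hω k).subset fun n hn => le_trans hn hk

lemma ae_exists_forall_le (hU : IsHalfLinePPP U c Pr) : ∀ᵐ ω ∂Pr, ∃ j, ∀ i, U j ω ≤ U i ω := by
  filter_upwards [hU.ae_finite_le] with ω hω
  obtain ⟨j, hj, hmin⟩ := (hω (U 0 ω)).exists_minimalFor (fun n => U n ω) _ ⟨0, le_refl (U 0 ω)⟩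
  refine ⟨j, fun i => ?_⟩
  by_contra! hlt
  exact absurd (hmin (hlt.le.trans hj) hlt.le) (not_le.2 hlt)

lemma measure_two_le_pointCount_Ico_le (hU : IsHalfLinePPP U c Pr) (a b : ℝ) :
    Pr {ω | 2 ≤ pointCount U (Ico a b) ω} ≤ ENNReal.ofReal (|c| * (b - a)) ^ 2 := by
  have hle : (ENNReal.ofReal c • (volume : Measure ℝ).restrict (Ioi 0)) (Ico a b) ≤
      ENNReal.ofReal (|c| * (b - a)) := by
    rw [Measure.smul_apply, smul_eq_mul, ENNReal.ofReal_mul (abs_nonneg c), ← Real.volume_Ico]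
    exact mul_le_mul' (ENNReal.ofReal_le_ofReal (le_abs_self c)) (Measure.restrict_apply_le _ _)
  exact (IsPoissonProcess.measure_two_le_pointCount_le hU measurableSet_Ico
    (ne_top_of_le_ne_top ENNReal.ofReal_ne_top hle)).trans (pow_le_pow_left₀ zero_le hle 2)

/- Two coinciding points below `V` share one of the `V (m + 1)` cells of length `1 / (m + 1)`. -/
lemma measure_exists_eq_le (hU : IsHalfLinePPP U c Pr) (V m : ℕ) :
    Pr {ω | ∃ i j, i ≠ j ∧ U i ω = U j ω ∧ 0 ≤ U i ω ∧ U i ω < V} ≤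
      ENNReal.ofReal (V * c ^ 2 * (1 / (m + 1))) := by
  have : (0 : ℝ) < m + 1 := by positivity
  have hcover : {ω | ∃ i j, i ≠ j ∧ U i ω = U j ω ∧ 0 ≤ U i ω ∧ U i ω < V} ⊆
      ⋃ k ∈ Finset.range (V * (m + 1)),
        {ω | 2 ≤ pointCount U (Ico ((k : ℝ) / (m + 1)) ((k + 1 : ℝ) / (m + 1))) ω} := by
    rintro ω ⟨i, j, hij, heq, h0, hV⟩
    obtain ⟨k, hk, hmem⟩ := exists_mem_Ico_div h0 hV m
    exact mem_biUnion hk (two_le_pointCount hij hmem (heq ▸ hmem))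
  calc Pr {ω | ∃ i j, i ≠ j ∧ U i ω = U j ω ∧ 0 ≤ U i ω ∧ U i ω < V}
      ≤ ∑ k ∈ Finset.range (V * (m + 1)),
        Pr {ω | 2 ≤ pointCount U (Ico ((k : ℝ) / (m + 1)) ((k + 1 : ℝ) / (m + 1))) ω} :=
        (measure_mono hcover).trans (measure_biUnion_finset_le _ _)
    _ ≤ ∑ k ∈ Finset.range (V * (m + 1)),
        ENNReal.ofReal (|c| * ((k + 1 : ℝ) / (m + 1) - (k : ℝ) / (m + 1))) ^ 2 :=
        Finset.sum_le_sum fun k _ => hU.measure_two_le_pointCount_Ico_le _ _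
    _ = ∑ k ∈ Finset.range (V * (m + 1)), ENNReal.ofReal (c ^ 2 * (1 / (m + 1)) ^ 2) :=
        Finset.sum_congr rfl fun k _ => by
          rw [← sub_div, add_sub_cancel_left, ← ENNReal.ofReal_pow (by positivity), mul_pow, sq_abs]
    _ = ENNReal.ofReal (V * c ^ 2 * (1 / (m + 1))) := by
        rw [Finset.sum_const, Finset.card_range, nsmul_eq_mul, ← ENNReal.ofReal_natCast,
          ← ENNReal.ofReal_mul (by positivity)]
        congr 1
        push_cast
        field_simp

lemma ae_injective (hU : IsHalfLinePPP U c Pr) :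
    ∀ᵐ ω ∂Pr, Function.Injective fun n => U n ω := by
  have hzero (V : ℕ) :
      Pr {ω | ∃ i j, i ≠ j ∧ U i ω = U j ω ∧ 0 ≤ U i ω ∧ U i ω < V} = 0 := by
    have hlim := ENNReal.tendsto_ofReal
      ((tendsto_one_div_add_atTop_nhds_zero_nat (𝕜 := ℝ)).const_mul (V * c ^ 2))
    rw [mul_zero, ENNReal.ofReal_zero] at hlim
    exact le_antisymm (ge_of_tendsto' hlim (hU.measure_exists_eq_le V)) zero_le
  filter_upwards [ae_all_iff.2 fun V => measure_eq_zero_iff_ae_notMem.1 (hzero V), hU.ae_pos]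
    with ω hω hpos i j heq
  by_contra hij
  obtain ⟨V, hV⟩ := exists_nat_gt (U i ω)
  exact hω V ⟨i, j, hij, heq, (hpos i).le, hV⟩

end IsHalfLinePPP
end HalfLine

section ExpMeasure

lemma lintegral_expMeasure {r : ℝ} {f : ℝ → ℝ≥0∞} (hf : Measurable f) :
    ∫⁻ x, f x ∂expMeasure r =
      ∫⁻ x in Ioi 0, ENNReal.ofReal (r * Real.exp (-(r * x))) * f x := by
  have hpdf : Measurable (exponentialPDF r) := (measurable_exponentialPDFReal r).ennreal_ofReal
  rw [show expMeasure r = volume.withDensity (exponentialPDF r) from rfl,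
    lintegral_withDensity_eq_lintegral_mul _ hpdf hf,
    ← setLIntegral_congr (Ioi_ae_eq_Ici (a := (0 : ℝ)) (μ := volume)).symm,
    ← lintegral_indicator measurableSet_Ici]
  refine lintegral_congr fun x => ?_
  rcases lt_or_ge x 0 with hx | hx
  · rw [indicator_of_notMem (by simpa using hx), Pi.mul_apply, exponentialPDF_of_neg hx, zero_mul]
  · rw [indicator_of_mem (by simpa using hx), Pi.mul_apply, exponentialPDF_of_nonneg hx]

lemma expMeasure_Ioi {r : ℝ} (hr : 0 < r) {t : ℝ} (ht : 0 ≤ t) :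
    expMeasure r (Ioi t) = expNeg (ENNReal.ofReal (r * t)) := by
  have := isProbabilityMeasure_expMeasure hr
  have hcdf := cdf_expMeasure_eq hr t
  rw [cdf_eq_real, if_pos ht] at hcdf
  rw [expNeg_ofReal (by positivity), ← ofReal_measureReal, ← compl_Iic,
    probReal_compl_eq_one_sub measurableSet_Iic, hcdf, sub_sub_cancel]

lemma expMeasure_singleton (r x : ℝ) : expMeasure r {x} = 0 :=
  withDensity_absolutelyContinuous _ _ (by simp)

lemma expMeasure_Iio_zero (r : ℝ) : expMeasure r (Iio 0) = 0 := by
  rw [show expMeasure r = volume.withDensity (exponentialPDF r) from rfl,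
    withDensity_apply _ measurableSet_Iio,
    setLIntegral_congr_fun (g := fun _ => 0) measurableSet_Iio fun x hx => exponentialPDF_of_neg hx,
    lintegral_zero]

end ExpMeasure

section FirstPoint

/-- The least point of the grid of mesh `1 / (m + 1)` above `u`, for `0 ≤ u`. -/
noncomputable def gridAbove (m : ℕ) (u : ℝ) : ℝ := ((⌊u * (m + 1)⌋₊ : ℝ) + 1) / (m + 1)

lemma lt_gridAbove (m : ℕ) (u : ℝ) : u < gridAbove m u := by
  rw [gridAbove, lt_div_iff₀ (by positivity)]
  exact Nat.lt_floor_add_one _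

lemma gridAbove_le {u : ℝ} (hu : 0 ≤ u) (m : ℕ) : gridAbove m u ≤ u + 1 / (m + 1) := by
  have hm : (0 : ℝ) < m + 1 := by positivity
  rw [gridAbove, div_le_iff₀ hm, add_mul, one_div_mul_cancel hm.ne']
  gcongr
  exact Nat.floor_le (by positivity)

lemma tendsto_gridAbove {u : ℝ} (hu : 0 ≤ u) :
    Tendsto (fun m => gridAbove m u) atTop (𝓝 u) := by
  refine tendsto_of_tendsto_of_tendsto_of_le_of_le tendsto_const_nhds ?_
    (fun m => (lt_gridAbove m u).le) (gridAbove_le hu)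
  simpa using (tendsto_one_div_add_atTop_nhds_zero_nat (𝕜 := ℝ)).const_add u

@[fun_prop] lemma measurable_gridAbove (m : ℕ) : Measurable (gridAbove m) := by
  have hfloor : Measurable fun u : ℝ => (⌊u * (m + 1)⌋₊ : ℝ) :=
    measurable_from_nat.comp (Nat.measurable_floor.comp (by fun_prop))
  exact (hfloor.add_const 1).div_const _

lemma lintegral_eq_tsum_setLIntegral_fiber {α : Type*} [MeasurableSpace α] {μ : Measure α}
    {κ : α → ℕ} (hκ : Measurable κ) (f : α → ℝ≥0∞) :
    ∫⁻ a, f a ∂μ = ∑' k, ∫⁻ a in κ ⁻¹' {k}, f a ∂μ := by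
  rw [← lintegral_iUnion (fun k => hκ (measurableSet_singleton k)) (pairwise_disjoint_fiber κ),
    ← preimage_iUnion, iUnion_of_singleton, preimage_univ, setLIntegral_univ]

lemma measurable_indicator_Ici_apply {k : ℝ → ℝ → ℝ≥0∞} (hk : Measurable (Function.uncurry k)) :
    Measurable fun p : ℝ × ℝ => (Ici p.1).indicator (k p.1) p.2 :=
  hk.indicator (measurableSet_le measurable_fst measurable_snd)

lemma measurable_setLIntegral_Ici {k : ℝ → ℝ → ℝ≥0∞} (hk : Measurable (Function.uncurry k)) :
    Measurable fun t => ∫⁻ v in Ici t, k t v := by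
  simp_rw [← lintegral_indicator measurableSet_Ici]
  exact (measurable_indicator_Ici_apply hk).lintegral_prod_right'

lemma tendsto_lintegral_mul_expNeg {α : Type*} [MeasurableSpace α] {μ : Measure α}
    {F : α → ℝ≥0∞} (hF : Measurable F) (hFint : ∫⁻ a, F a ∂μ ≠ ∞) {X : ℕ → α → ℝ≥0∞}
    {Y : α → ℝ≥0∞} (hX : ∀ m, Measurable (X m))
    (hlim : ∀ᵐ a ∂μ, Tendsto (fun m => X m a) atTop (𝓝 (Y a))) :
    Tendsto (fun m => ∫⁻ a, F a * expNeg (X m a) ∂μ) atTop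
      (𝓝 (∫⁻ a, F a * expNeg (Y a) ∂μ)) := by
  refine tendsto_lintegral_of_dominated_convergence F (fun m => by fun_prop)
    (fun m => ae_of_all _ fun a => mul_le_of_le_one_right' (expNeg_le_one _)) hFint ?_
  filter_upwards [hlim, ae_lt_top hF hFint] with a ha hFa
  exact ENNReal.Tendsto.const_mul ((continuous_expNeg.tendsto _).comp ha) (.inr hFa.ne)

lemma tendsto_lintegral_indicator_gridAbove {α : Type*} [MeasurableSpace α] {ρ : Measure α}
    {V : α → ℝ} (hV : Measurable V) (hVpos : ∀ᵐ x ∂ρ, 0 < V x) {g : ℝ → ℝ → ℝ≥0∞}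
    (hg : ∀ t, Measurable (g t)) (hmono : ∀ v > 0, ∀ u u', 0 < u → u ≤ u' → g u v ≤ g u' v)
    (hcont : ∀ v > 0, ∀ u > 0, ContinuousAt (fun u => g u v) u)
    (hfin : ∀ R : ℕ, ∫⁻ x, g (R + 1) (V x) ∂ρ ≠ ∞) {u : ℝ} (hu : 0 < u) :
    Tendsto (fun m => ∫⁻ x, (Ici (gridAbove m u)).indicator (g (gridAbove m u)) (V x) ∂ρ) atTop
      (𝓝 (∫⁻ x, (Ioi u).indicator (g u) (V x) ∂ρ)) := by
  obtain ⟨R, hR⟩ := exists_nat_ge u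
  have hgrid (m : ℕ) : gridAbove m u ≤ R + 1 :=
    (gridAbove_le hu.le m).trans (add_le_add hR (div_le_one_of_le₀ (by simp) (by positivity)))
  refine tendsto_lintegral_of_dominated_convergence (fun x => g (R + 1) (V x))
    (fun m => ((hg _).indicator measurableSet_Ici).comp hV) (fun m => ?_) (hfin R) ?_
  · filter_upwards [hVpos] with x hx
    exact (indicator_le_self _ _ _).trans
      (hmono _ hx _ _ (hu.trans (lt_gridAbove m u)) (hgrid m))
  · filter_upwards [hVpos] with x hx
    by_cases hux : u < V x
    · rw [indicator_of_mem (by exact hux)]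
      refine ((hcont _ hx u hu).tendsto.comp (tendsto_gridAbove hu.le)).congr' ?_
      filter_upwards [(tendsto_gridAbove hu.le).eventually_le_const hux] with m hm
      exact (indicator_of_mem (s := Ici (gridAbove m u)) hm _).symm
    · rw [indicator_of_notMem (by exact hux)]
      refine tendsto_const_nhds.congr fun m => ?_
      exact (indicator_of_notMem (s := Ici (gridAbove m u))
        (not_le.2 ((not_lt.1 hux).trans_lt (lt_gridAbove m u))) _).symm

lemma measurable_uncurry_one_sub_expNeg {g : ℝ → ℝ → ℝ≥0∞}
    (hg : Measurable (Function.uncurry g)) :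
    Measurable (Function.uncurry fun u v => 1 - expNeg (g u v)) :=
  (measurable_expNeg.comp hg).const_sub 1

lemma tendsto_setLIntegral_Ici_gridAbove {g : ℝ → ℝ → ℝ≥0∞}
    (hgm : Measurable (Function.uncurry g))
    (hmono : ∀ v > 0, ∀ u u', 0 < u → u ≤ u' → g u v ≤ g u' v)
    (hcont : ∀ v > 0, ∀ u > 0, ContinuousAt (fun u => g u v) u)
    (hint : ∀ u > 0, ∫⁻ v in Ioi 0, (1 - expNeg (g u v)) ≠ ∞) {u : ℝ} (hu : 0 < u) :
    Tendsto (fun m => ∫⁻ v in Ici (gridAbove m u), (1 - expNeg (g (gridAbove m u) v))) atTop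
      (𝓝 (∫⁻ v in Ioi u, (1 - expNeg (g u v)))) := by
  have hsub (m : ℕ) : Ici (gridAbove m u) ⊆ Ioi 0 :=
    fun v hv => hu.trans ((lt_gridAbove m u).trans_le hv)
  have hlim := tendsto_lintegral_indicator_gridAbove (ρ := volume.restrict (Ioi 0))
    (g := fun u v => 1 - expNeg (g u v)) measurable_id (ae_restrict_mem measurableSet_Ioi)
    (fun t => (measurable_uncurry_one_sub_expNeg hgm).comp measurable_prodMk_left)
    (fun v hv u u' hu huu' => one_sub_expNeg_mono (hmono v hv u u' hu huu'))
    (fun v hv u hu => tendsto_one_sub_expNeg (hcont v hv u hu))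
    (fun R => hint _ (by positivity)) hu
  simpa only [id, setLIntegral_indicator measurableSet_Ici,
    setLIntegral_indicator measurableSet_Ioi, inter_eq_left.2 (Ioi_subset_Ioi hu.le),
    inter_eq_left.2 (hsub _)] using hlim

namespace IsHalfLinePPP

variable {Ω : Type*} [MeasurableSpace Ω] {U : ℕ → Ω → ℝ} {c : ℝ} {Pr : Measure Ω}

lemma measurable_iInf (hU : IsHalfLinePPP U c Pr) : Measurable fun ω => ⨅ n, U n ω :=
  Measurable.iInf (IsPoissonProcess.measurable hU)

variable [IsProbabilityMeasure Pr]

lemma ae_le_iInf_iff (hU : IsHalfLinePPP U c Pr) :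
    ∀ᵐ ω ∂Pr, ∀ a, a ≤ ⨅ n, U n ω ↔ ∀ n, a ≤ U n ω := by
  filter_upwards [hU.ae_pos] with ω hω a
  exact le_ciInf_iff ⟨0, forall_mem_range.2 fun n => (hω n).le⟩

lemma ae_iInf_pos (hU : IsHalfLinePPP U c Pr) : ∀ᵐ ω ∂Pr, 0 < ⨅ n, U n ω := by
  filter_upwards [hU.ae_pos, hU.ae_le_iInf_iff, hU.ae_exists_forall_le] with ω hω hle ⟨j, hj⟩
  exact (hω j).trans_le ((hle _).2 hj)

/- The event `a ≤ ⨅ n, U n` is encoded in the Laplace functional by the value `∞` on `Iio a`. -/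
lemma ae_indicator_le_iInf_eq (hU : IsHalfLinePPP U c Pr) (a : ℝ) (h : ℝ → ℝ≥0∞) :
    {ω | a ≤ ⨅ n, U n ω}.indicator (fun ω => expNeg (∑' n, h (U n ω))) =ᵐ[Pr]
      fun ω => expNeg (∑' n, ((Iio a).indicator (fun _ => ∞) (U n ω) + h (U n ω))) := by
  filter_upwards [hU.ae_le_iInf_iff] with ω hω
  rw [ENNReal.tsum_add, expNeg_add]
  by_cases hmem : a ≤ ⨅ n, U n ω
  · rw [indicator_of_mem (by exact hmem), (ENNReal.tsum_eq_zero
      (f := fun n => (Iio a).indicator (fun _ => ∞) (U n ω))).2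
      fun n => indicator_of_notMem (s := Iio a) (not_lt.2 ((hω a).1 hmem n)) _, expNeg_zero,
      one_mul]
  · rw [indicator_of_notMem (by exact hmem)]
    rw [hω a] at hmem
    push Not at hmem
    obtain ⟨n, hn⟩ := hmem
    rw [ENNReal.tsum_eq_top_of_eq_top ⟨n, indicator_of_mem (by exact hn) _⟩, expNeg_top, zero_mul]

lemma setLIntegral_le_iInf (hU : IsHalfLinePPP U c Pr) {a b : ℝ} (hb : 0 < b)
    (hab : a ≤ b) {h : ℝ → ℝ≥0∞} (hh : Measurable h) :
    ∫⁻ ω in {ω | a ≤ ⨅ n, U n ω}, expNeg (∑' n, (Ici b).indicator h (U n ω)) ∂Pr =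
      expNeg (ENNReal.ofReal c * ENNReal.ofReal a) *
        expNeg (ENNReal.ofReal c * ∫⁻ v in Ici b, (1 - expNeg (h v))) := by
  have hm : Measurable fun v => (Iio a).indicator (fun _ => (∞ : ℝ≥0∞)) v + (Ici b).indicator h v :=
    (measurable_const.indicator measurableSet_Iio).add (hh.indicator measurableSet_Ici)
  have hsplit (v : ℝ) :
      1 - expNeg ((Iio a).indicator (fun _ => ∞) v + (Ici b).indicator h v) =
        (Iio a).indicator 1 v + (Ici b).indicator (fun v => 1 - expNeg (h v)) v := by
    by_cases hva : v < a
    · simp [indicator, hva, not_le.2 (hva.trans_le hab)]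
    · by_cases hbv : b ≤ v <;> simp [indicator, hva, hbv]
  rw [← lintegral_indicator (measurableSet_le measurable_const hU.measurable_iInf),
    lintegral_congr_ae (hU.ae_indicator_le_iInf_eq a _),
    IsPoissonProcess.laplace_functional hU hm, ← expNeg_add, ← mul_add]
  simp_rw [hsplit]
  rw [lintegral_smul_measure, lintegral_add_left (measurable_one.indicator measurableSet_Iio),
    lintegral_indicator_one measurableSet_Iio, lintegral_indicator measurableSet_Ici,
    Measure.restrict_restrict measurableSet_Ici, Measure.restrict_apply measurableSet_Iio,
    Iio_inter_Ioi, Real.volume_Ioo, sub_zero, smul_eq_mul,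
    inter_eq_left.2 (show Ici b ⊆ Ioi 0 from fun v hv => hb.trans_le hv)]

lemma measure_le_iInf (hU : IsHalfLinePPP U c Pr) (a : ℝ) :
    Pr {ω | a ≤ ⨅ n, U n ω} = expNeg (ENNReal.ofReal c * ENNReal.ofReal a) := by
  simpa using hU.setLIntegral_le_iInf (a := a) (b := max a 1) (by positivity) (le_max_left _ _)
    (h := fun _ => 0) measurable_const

lemma map_iInf (hU : IsHalfLinePPP U c Pr) (hc : 0 < c) :
    Pr.map (fun ω => ⨅ n, U n ω) = expMeasure c := by
  have := isProbabilityMeasure_expMeasure hc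
  have := Measure.isProbabilityMeasure_map (μ := Pr) hU.measurable_iInf.aemeasurable
  refine Measure.ext_of_Ici _ _ fun a => ?_
  rw [Measure.map_apply hU.measurable_iInf measurableSet_Ici]
  refine (hU.measure_le_iInf a).trans ?_
  rcases lt_or_ge a 0 with ha | ha
  · rw [ENNReal.ofReal_of_nonpos ha.le, mul_zero, expNeg_zero, ← compl_Iio,
      prob_compl_eq_one_sub measurableSet_Iio,
      measure_mono_null (Iio_subset_Iio ha.le) (expMeasure_Iio_zero c), tsub_zero]
  · rw [← Ioi_insert, insert_eq, measure_union (by simp) measurableSet_Ioi,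
      expMeasure_singleton, zero_add, expMeasure_Ioi hc ha, ENNReal.ofReal_mul hc.le]

lemma setLIntegral_iInf_mem_Ico (hU : IsHalfLinePPP U c Pr) (a : ℝ) {b : ℝ} (hb : 0 < b)
    {h : ℝ → ℝ≥0∞} (hh : Measurable h) :
    ∫⁻ ω in {ω | ⨅ n, U n ω ∈ Ico a b}, expNeg (∑' n, (Ici b).indicator h (U n ω)) ∂Pr =
      Pr {ω | ⨅ n, U n ω ∈ Ico a b} *
        expNeg (ENNReal.ofReal c * ∫⁻ v in Ici b, (1 - expNeg (h v))) := by
  rcases lt_or_ge b a with hba | hab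
  · simp [Ico_eq_empty_of_le hba.le]
  have hdiff : {ω | ⨅ n, U n ω ∈ Ico a b} = {ω | a ≤ ⨅ n, U n ω} \ {ω | b ≤ ⨅ n, U n ω} := by
    ext ω
    simp
  have hmeas : MeasurableSet {ω | b ≤ ⨅ n, U n ω} :=
    measurableSet_le measurable_const hU.measurable_iInf
  have hsub : {ω | b ≤ ⨅ n, U n ω} ⊆ {ω | a ≤ ⨅ n, U n ω} := fun ω hω => hab.trans hω
  have hadd := lintegral_union (μ := Pr) hmeas
    (disjoint_sdiff_left (s := {ω | b ≤ ⨅ n, U n ω}) (t := {ω | a ≤ ⨅ n, U n ω}))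
    (f := fun ω => expNeg (∑' n, (Ici b).indicator h (U n ω)))
  rw [sdiff_union_of_subset hsub, hU.setLIntegral_le_iInf hb hab hh,
    hU.setLIntegral_le_iInf hb le_rfl hh] at hadd
  rw [hdiff, measure_sdiff hsub hmeas.nullMeasurableSet (measure_ne_top _ _), hU.measure_le_iInf,
    hU.measure_le_iInf, ENNReal.sub_mul (fun _ _ => expNeg_ne_top _)]
  exact ENNReal.eq_sub_of_add_eq (ENNReal.mul_ne_top (expNeg_ne_top _) (expNeg_ne_top _)) hadd.symm

lemma setLIntegral_iInf_mem (hU : IsHalfLinePPP U c Pr) {b : ℝ} (hb : 0 < b) {A : Set ℝ}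
    (hA : MeasurableSet A) (hAb : A ⊆ Iio b) {F h : ℝ → ℝ≥0∞} (hF : Measurable F)
    (hh : Measurable h) :
    ∫⁻ ω in {ω | ⨅ n, U n ω ∈ A},
        F (⨅ n, U n ω) * expNeg (∑' n, (Ici b).indicator h (U n ω)) ∂Pr =
      ∫⁻ ω in {ω | ⨅ n, U n ω ∈ A},
        F (⨅ n, U n ω) * expNeg (ENNReal.ofReal c * ∫⁻ v in Ici b, (1 - expNeg (h v))) ∂Pr := by
  have hUm := IsPoissonProcess.measurable hU
  have hIm := hU.measurable_iInf
  have hT (n) : Measurable fun ω => (Ici b).indicator h (U n ω) :=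
    (hh.indicator measurableSet_Ici).comp (hUm n)
  have hT' : Measurable fun ω => expNeg (∑' n, (Ici b).indicator h (U n ω)) :=
    measurable_expNeg.comp (Measurable.tsum hT)
  set E : Ω → ℝ≥0∞ := fun ω => expNeg (∑' n, (Ici b).indicator h (U n ω))
  set C := expNeg (ENNReal.ofReal c * ∫⁻ v in Ici b, (1 - expNeg (h v)))
  have : IsFiniteMeasure (Pr.withDensity E) :=
    isFiniteMeasure_withDensity
      (ne_top_of_le_ne_top ENNReal.one_ne_top (lintegral_expNeg_le_one Pr _))
  have : IsFiniteMeasure (C • Pr.map fun ω => ⨅ n, U n ω) :=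
    Measure.smul_finite _ (expNeg_ne_top _)
  have hlaw : ((Pr.withDensity E).map fun ω => ⨅ n, U n ω).restrict (Iio b) =
      (C • Pr.map fun ω => ⨅ n, U n ω).restrict (Iio b) := by
    refine Measure.ext_of_Ici _ _ fun a => ?_
    rw [Measure.restrict_apply measurableSet_Ici, Measure.restrict_apply measurableSet_Ici,
      Ici_inter_Iio, Measure.map_apply hIm measurableSet_Ico, Measure.smul_apply,
      Measure.map_apply hIm measurableSet_Ico, withDensity_apply _ (hIm measurableSet_Ico),
      smul_eq_mul, mul_comm]
    exact hU.setLIntegral_iInf_mem_Ico a hb hh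
  have hFm : Measurable fun ω => F (⨅ n, U n ω) := hF.comp hIm
  calc ∫⁻ ω in {ω | ⨅ n, U n ω ∈ A}, F (⨅ n, U n ω) * E ω ∂Pr
      = ∫⁻ u in A, F u ∂(Pr.withDensity E).map fun ω => ⨅ n, U n ω := by
        rw [setLIntegral_map hA hF hIm,
          setLIntegral_withDensity_eq_setLIntegral_mul _ hT' hFm (hIm hA)]
        simp only [Pi.mul_apply, mul_comm]
        rfl
    _ = ∫⁻ u in A, F u ∂(C • Pr.map fun ω => ⨅ n, U n ω) := by
        rw [← inter_eq_left.2 hAb, ← Measure.restrict_restrict hA, hlaw,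
          Measure.restrict_restrict hA]
    _ = ∫⁻ ω in {ω | ⨅ n, U n ω ∈ A}, F (⨅ n, U n ω) * C ∂Pr := by
        rw [Measure.restrict_smul, lintegral_smul_measure, setLIntegral_map hA hF hIm,
          lintegral_mul_const _ hFm, smul_eq_mul, mul_comm]
        rfl

lemma lintegral_mul_expNeg_tsum_gridAbove (hU : IsHalfLinePPP U c Pr) (m : ℕ) {F : ℝ → ℝ≥0∞}
    (hF : Measurable F) {g : ℝ → ℝ → ℝ≥0∞} (hg : ∀ t, Measurable (g t)) :
    ∫⁻ ω, F (⨅ n, U n ω) * expNeg (∑' n, (Ici (gridAbove m (⨅ n, U n ω))).indicator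
        (g (gridAbove m (⨅ n, U n ω))) (U n ω)) ∂Pr =
      ∫⁻ ω, F (⨅ n, U n ω) * expNeg (ENNReal.ofReal c * ∫⁻ v in Ici (gridAbove m (⨅ n, U n ω)),
        (1 - expNeg (g (gridAbove m (⨅ n, U n ω)) v))) ∂Pr := by
  have hκ : Measurable fun u : ℝ => ⌊u * (m + 1)⌋₊ := Nat.measurable_floor.comp (by fun_prop)
  have hfib := fun k => hκ (measurableSet_singleton k)
  rw [lintegral_eq_tsum_setLIntegral_fiber (hκ.comp hU.measurable_iInf),
    lintegral_eq_tsum_setLIntegral_fiber (hκ.comp hU.measurable_iInf)]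
  refine tsum_congr fun k => ?_
  have hcongr (Φ : ℝ → Ω → ℝ≥0∞) :
      ∫⁻ ω in {ω | ⌊(⨅ n, U n ω) * (m + 1)⌋₊ = k}, Φ (gridAbove m (⨅ n, U n ω)) ω ∂Pr =
        ∫⁻ ω in {ω | ⌊(⨅ n, U n ω) * (m + 1)⌋₊ = k}, Φ (((k : ℝ) + 1) / (m + 1)) ω ∂Pr :=
    setLIntegral_congr_fun (hU.measurable_iInf (hfib k)) fun ω hω => by
      simp only [gridAbove, show ⌊(⨅ n, U n ω) * (m + 1)⌋₊ = k from hω]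
  refine (hcongr fun t ω => F (⨅ n, U n ω) * expNeg (∑' n, (Ici t).indicator (g t) (U n ω))).trans
    (Eq.trans ?_ (hcongr fun t ω => F (⨅ n, U n ω) *
      expNeg (ENNReal.ofReal c * ∫⁻ v in Ici t, (1 - expNeg (g t v)))).symm)
  exact hU.setLIntegral_iInf_mem (by positivity) (hfib k)
    (fun u hu => hu ▸ lt_gridAbove m u) hF (hg _)

lemma ae_tsum_ne_top (hU : IsHalfLinePPP U c Pr) {f : ℝ → ℝ≥0∞} (hf : Measurable f)
    (hfin : ∀ v > 0, f v ≠ ∞) (hint : ∫⁻ v in Ioi 0, (1 - expNeg (f v)) ≠ ∞) :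
    ∀ᵐ ω ∂Pr, ∑' n, f (U n ω) ≠ ∞ := by
  refine IsPoissonProcess.ae_tsum_ne_top hU hf ?_ ?_
  · refine Measure.smul_absolutelyContinuous.ae_le ?_
    filter_upwards [ae_restrict_mem measurableSet_Ioi] with v hv using hfin v hv
  · rw [lintegral_smul_measure]
    exact ENNReal.mul_ne_top ENNReal.ofReal_ne_top hint

/- Given the first point, the others form a Poisson process beyond it: this is exact when the first
point is rounded up to a grid, and the mesh of the grid tends to zero. -/
theorem lintegral_iInf_mul_expNeg_tsum (hU : IsHalfLinePPP U c Pr) {F : ℝ → ℝ≥0∞}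
    {g : ℝ → ℝ → ℝ≥0∞} (hF : Measurable F) (hFint : ∫⁻ ω, F (⨅ n, U n ω) ∂Pr ≠ ∞)
    (hgm : Measurable (Function.uncurry g))
    (hmono : ∀ v > 0, ∀ u u', 0 < u → u ≤ u' → g u v ≤ g u' v)
    (hcont : ∀ v > 0, ∀ u > 0, ContinuousAt (fun u => g u v) u)
    (hgtop : ∀ v > 0, ∀ u > 0, g u v ≠ ∞)
    (hint : ∀ u > 0, ∫⁻ v in Ioi 0, (1 - expNeg (g u v)) ≠ ∞) :
    ∫⁻ ω, F (⨅ n, U n ω) *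
        expNeg (∑' n, (Ioi (⨅ n, U n ω)).indicator (g (⨅ n, U n ω)) (U n ω)) ∂Pr =
      ∫⁻ ω, F (⨅ n, U n ω) * expNeg (ENNReal.ofReal c *
        ∫⁻ v in Ioi (⨅ n, U n ω), (1 - expNeg (g (⨅ n, U n ω) v))) ∂Pr := by
  have hg (t) : Measurable (g t) := hgm.comp measurable_prodMk_left
  have hsum : ∀ᵐ ω ∂Pr, ∀ R : ℕ, ∑' n, g (R + 1) (U n ω) ≠ ∞ := ae_all_iff.2 fun R =>
    hU.ae_tsum_ne_top (hg _) (fun v hv => hgtop v hv _ (by positivity)) (hint _ (by positivity))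
  refine tendsto_nhds_unique (f := fun m => ∫⁻ ω, F (⨅ n, U n ω) *
    expNeg (∑' n, (Ici (gridAbove m (⨅ n, U n ω))).indicator
      (g (gridAbove m (⨅ n, U n ω))) (U n ω)) ∂Pr) (l := atTop) ?_ ?_
  · refine tendsto_lintegral_mul_expNeg (hF.comp hU.measurable_iInf) hFint (fun m => ?_) ?_
    · exact Measurable.tsum fun n => (measurable_indicator_Ici_apply hgm).comp
        (((measurable_gridAbove m).comp hU.measurable_iInf).prodMk
          (IsPoissonProcess.measurable hU n))
    filter_upwards [hU.ae_iInf_pos, hU.ae_pos, hsum] with ω hω hpos hfin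
    simp_rw [← lintegral_count] at hfin ⊢
    exact tendsto_lintegral_indicator_gridAbove (measurable_of_countable _) (ae_of_all _ hpos) hg
      hmono hcont hfin hω
  · simp_rw [hU.lintegral_mul_expNeg_tsum_gridAbove _ hF hg]
    refine tendsto_lintegral_mul_expNeg (hF.comp hU.measurable_iInf) hFint (fun m => ?_) ?_
    · exact ((measurable_setLIntegral_Ici (measurable_uncurry_one_sub_expNeg hgm)).comp
        ((measurable_gridAbove m).comp hU.measurable_iInf)).const_mul _
    filter_upwards [hU.ae_iInf_pos] with ω hω
    exact ENNReal.Tendsto.const_mul (tendsto_setLIntegral_Ici_gridAbove hgm hmono hcont hint hω)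
      (.inr ENNReal.ofReal_ne_top)

end IsHalfLinePPP

end FirstPoint

section Integrals

lemma integrableOn_one_div_one_add_rpow {a : ℝ} (ha : 1 < a) :
    IntegrableOn (fun ν : ℝ => 1 / (1 + ν ^ a)) (Ioi 0) := by
  have hm : Measurable fun ν : ℝ => 1 / (1 + ν ^ a) := by fun_prop
  rw [← Ioc_union_Ioi_eq_Ioi (zero_le_one' ℝ)]
  refine IntegrableOn.union ?_ ?_
  · refine Measure.integrableOn_of_bounded (M := 1) (by simp) hm.aestronglyMeasurable ?_
    filter_upwards [ae_restrict_mem measurableSet_Ioc] with ν hν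
    have := Real.rpow_nonneg hν.1.le a
    rw [Real.norm_of_nonneg (by positivity), div_le_one (by positivity)]
    linarith
  · refine (integrableOn_Ioi_rpow_of_lt (neg_lt_neg ha) zero_lt_one).mono'
      hm.aestronglyMeasurable ?_
    filter_upwards [ae_restrict_mem measurableSet_Ioi] with ν hν
    have h0 : (0 : ℝ) < ν := zero_lt_one.trans hν
    have := Real.rpow_pos_of_pos h0 a
    rw [Real.norm_of_nonneg (by positivity), Real.rpow_neg h0.le, ← one_div]
    gcongr
    linarith

lemma one_sub_inv_one_add_ofReal {x : ℝ} (hx : 0 ≤ x) :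
    1 - (1 + ENNReal.ofReal x)⁻¹ = ENNReal.ofReal (x / (1 + x)) := by
  rw [← ENNReal.ofReal_one, ← ENNReal.ofReal_add zero_le_one hx,
    ← ENNReal.ofReal_inv_of_pos (by positivity), ← ENNReal.ofReal_sub _ (by positivity)]
  congr 1
  field_simp
  ring

lemma lintegral_one_sub_inv_one_add_rpow {a : ℝ} (ha : 1 < a) {s p : ℝ} (hs : 0 < s) (hp : 0 ≤ p) :
    ∫⁻ v in Ioi p, (1 - (1 + ENNReal.ofReal ((s / v) ^ a))⁻¹) =
      ENNReal.ofReal (s * ∫ ν in Ioi (s⁻¹ * p), 1 / (1 + ν ^ a)) := by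
  have heq : ∀ v ∈ Ioi p, 1 - (1 + ENNReal.ofReal ((s / v) ^ a))⁻¹ =
      ENNReal.ofReal (1 / (1 + (s⁻¹ * v) ^ a)) := fun v hv => by
    have hv : 0 < v := hp.trans_lt hv
    have hx : 0 < (s / v) ^ a := Real.rpow_pos_of_pos (by positivity) a
    rw [one_sub_inv_one_add_ofReal hx.le]
    congr 1
    rw [show s⁻¹ * v = (s / v)⁻¹ by field_simp, Real.inv_rpow (by positivity)]
    field_simp
    ring
  have hint : IntegrableOn (fun v => 1 / (1 + (s⁻¹ * v) ^ a)) (Ioi p) :=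
    (integrableOn_Ioi_comp_mul_left_iff (fun ν : ℝ => 1 / (1 + ν ^ a)) p (inv_pos.2 hs)).2
      ((integrableOn_one_div_one_add_rpow ha).mono_set (Ioi_subset_Ioi (by positivity)))
  rw [setLIntegral_congr_fun measurableSet_Ioi heq, ← ofReal_integral_eq_lintegral_ofReal hint]
  · rw [integral_comp_mul_left_Ioi (fun ν : ℝ => 1 / (1 + ν ^ a)) p (inv_pos.2 hs), inv_inv,
      smul_eq_mul]
  · filter_upwards [ae_restrict_mem measurableSet_Ioi] with v hv
    have hv : 0 < v := hp.trans_lt hv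
    have := Real.rpow_nonneg (show 0 ≤ s⁻¹ * v by positivity) a
    simp only [Pi.zero_apply]
    positivity

lemma rho_nonneg (α β : ℝ) (hβ : 0 ≤ β) : 0 ≤ rho α β :=
  setIntegral_nonneg measurableSet_Ioi fun ν hν => by
    have : 0 < ν := (Real.rpow_nonneg hβ _).trans_lt hν
    positivity

lemma rhoInf_nonneg (α : ℝ) : 0 ≤ rhoInf α :=
  setIntegral_nonneg measurableSet_Ioi fun ν (hν : 0 < ν) => by positivity

lemma rpow_two_div_rpow_half {α : ℝ} (hα : α ≠ 0) {κ : ℝ} (hκ : 0 ≤ κ) :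
    (κ ^ (2 / α)) ^ (α / 2) = κ := by
  rw [← Real.rpow_mul hκ, div_mul_div_cancel₀ hα, div_self two_ne_zero, Real.rpow_one]

lemma setLIntegral_Ioi_pathLoss {α : ℝ} (hα : 2 < α) {β u : ℝ} (hβ : 0 < β) (hu : 0 < u) :
    ∫⁻ v in Ioi u, (1 - (1 + ENNReal.ofReal (β * (u / v) ^ (α / 2)))⁻¹) =
      ENNReal.ofReal (β ^ (2 / α) * u * rho α β) := by
  have hb : 0 < β ^ (2 / α) := Real.rpow_pos_of_pos hβ _
  have h := lintegral_one_sub_inv_one_add_rpow (a := α / 2) (by linarith)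
    (s := β ^ (2 / α) * u) (by positivity) hu.le
  have hlow : (β ^ (2 / α) * u)⁻¹ * u = β ^ (-(2 / α)) := by
    rw [Real.rpow_neg hβ.le]
    field_simp
  rw [hlow] at h
  rw [rho, ← h]
  refine setLIntegral_congr_fun measurableSet_Ioi fun v hv => ?_
  have hv : 0 < v := hu.trans hv
  simp only [mul_div_assoc]
  rw [Real.mul_rpow hb.le (by positivity), rpow_two_div_rpow_half (by linarith) hβ.le]

lemma setLIntegral_Ioi_zero_pathLoss {α : ℝ} (hα : 2 < α) {κ : ℝ} (hκ : 0 ≤ κ) :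
    ∫⁻ v in Ioi 0, (1 - (1 + ENNReal.ofReal (κ * v ^ (-(α / 2))))⁻¹) =
      ENNReal.ofReal (κ ^ (2 / α) * rhoInf α) := by
  rcases hκ.eq_or_lt with rfl | hκ
  · have : (0 : ℝ) ^ (2 / α) = 0 := Real.zero_rpow (by positivity)
    simp [this]
  have hb : 0 < κ ^ (2 / α) := Real.rpow_pos_of_pos hκ _
  have h := lintegral_one_sub_inv_one_add_rpow (a := α / 2) (by linarith) hb le_rfl
  rw [mul_zero] at h
  rw [rhoInf, ← h]
  refine setLIntegral_congr_fun measurableSet_Ioi fun v (hv : 0 < v) => ?_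
  rw [Real.div_rpow hb.le hv.le, rpow_two_div_rpow_half (by linarith) hκ.le,
    Real.rpow_neg hv.le, ← div_eq_mul_inv]

end Integrals

section Independence

variable {Ω : Type*} [MeasurableSpace Ω] {Pr : Measure Ω}
  {𝓤 𝓥 𝓦 : Type*} [MeasurableSpace 𝓤] [MeasurableSpace 𝓥] [MeasurableSpace 𝓦]

lemma indepFun_tsum_ite_eq {X : ℕ → Ω → 𝓤} (hX : ∀ n, Measurable (X n)) (hi : iIndepFun X Pr)
    {g : ℕ → 𝓤 → ℝ≥0∞} (hg : ∀ n, Measurable (g n)) (j : ℕ) :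
    IndepFun (fun ω => ∑' n, if n = j then 0 else g n (X n ω)) (X j) Pr := by
  let m (n : ℕ) : MeasurableSpace Ω := MeasurableSpace.comap (X n) inferInstance
  have hmeas : Measurable[⨆ n ∈ ({j}ᶜ : Set ℕ), m n]
      fun ω => ∑' n, if n = j then 0 else g n (X n ω) := by
    let _ : MeasurableSpace Ω := ⨆ n ∈ ({j}ᶜ : Set ℕ), m n
    refine Measurable.tsum fun n => ?_
    by_cases hn : n = j
    · simp only [hn, if_true]
      exact measurable_const
    · simp only [hn, if_false]
      exact (hg n).comp (Measurable.mono (comap_measurable (X n))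
        (le_iSup₂_of_le (f := fun n _ => m n) n (by simpa using hn) le_rfl) le_rfl)
  have h := indep_iSup_of_disjoint (m := m) (fun n => (hX n).comap_le)
    ((iIndepFun_iff_iIndep _ _ _).1 hi) (S := {j}ᶜ) (T := {j}) disjoint_compl_left
  rw [IndepFun_iff_Indep]
  exact indep_of_indep_of_le_left (indep_of_indep_of_le_right h (by simp [m])) hmeas.comap_le

variable [IsProbabilityMeasure Pr]

lemma measure_prodMk_mem_of_indepFun {U : Ω → 𝓤} {V : Ω → 𝓥} (hU : AEMeasurable U Pr)
    (hV : AEMeasurable V Pr) (h : IndepFun U V Pr) {S : Set (𝓤 × 𝓥)} (hS : MeasurableSet S) :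
    Pr {ω | (U ω, V ω) ∈ S} = ∫⁻ ω, Pr.map V (Prod.mk (U ω) ⁻¹' S) ∂Pr := by
  have := Measure.isProbabilityMeasure_map (μ := Pr) hV
  rw [← lintegral_map' (measurable_measure_prodMk_left hS).aemeasurable hU, ← Measure.prod_apply hS,
    ← (indepFun_iff_map_prod_eq_prod_map_map hU hV).1 h,
    Measure.map_apply_of_aemeasurable (hU.prodMk hV) hS]
  rfl

lemma indepFun_prodMk_swap {U : Ω → 𝓤} {V : Ω → 𝓥} {W : Ω → 𝓦} (hU : AEMeasurable U Pr)
    (hV : AEMeasurable V Pr) (hW : AEMeasurable W Pr) (hUV : IndepFun U V Pr)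
    (hUVW : IndepFun (fun ω => (U ω, V ω)) W Pr) : IndepFun (fun ω => (U ω, W ω)) V Pr := by
  have hUW : IndepFun U W Pr := hUVW.comp measurable_fst measurable_id
  have := Measure.isProbabilityMeasure_map (μ := Pr) hV
  have := Measure.isProbabilityMeasure_map (μ := Pr) hW
  rw [indepFun_iff_map_prod_eq_prod_map_map (hU.prodMk hW) hV,
    (indepFun_iff_map_prod_eq_prod_map_map hU hW).1 hUW, Measure.ext_prod₃_iff']
  intro A B C hA hB hC
  calc Pr.map (fun ω => ((U ω, W ω), V ω)) ((A ×ˢ B) ×ˢ C)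
      = Pr.map (fun ω => ((U ω, V ω), W ω)) ((A ×ˢ C) ×ˢ B) := by
        rw [Measure.map_apply_of_aemeasurable ((hU.prodMk hW).prodMk hV) ((hA.prod hB).prod hC),
          Measure.map_apply_of_aemeasurable ((hU.prodMk hV).prodMk hW) ((hA.prod hC).prod hB)]
        congr 1
        ext ω
        simp only [mem_preimage, mem_prod, and_right_comm]
    _ = (((Pr.map U).prod (Pr.map W)).prod (Pr.map V)) ((A ×ˢ B) ×ˢ C) := by
        rw [(indepFun_iff_map_prod_eq_prod_map_map (hU.prodMk hV) hW).1 hUVW,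
          (indepFun_iff_map_prod_eq_prod_map_map hU hV).1 hUV]
        simp only [Measure.prod_prod]
        ring

end Independence

section Exponential

variable {Ω : Type*} [MeasurableSpace Ω] {Pr : Measure Ω} [IsProbabilityMeasure Pr]

instance : IsProbabilityMeasure (expMeasure 1) := isProbabilityMeasure_expMeasure one_pos

lemma lintegral_expNeg_mul_expMeasure {k : ℝ} (hk : 0 ≤ k) :
    ∫⁻ x, expNeg (ENNReal.ofReal (k * x)) ∂expMeasure 1 = (1 + ENNReal.ofReal k)⁻¹ := by
  have hk' : 0 < 1 + k := by positivity
  have htilt (x : ℝ) (hx : x ∈ Ioi (0 : ℝ)) :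
      ENNReal.ofReal (1 * Real.exp (-(1 * x))) * expNeg (ENNReal.ofReal (k * x)) =
      (1 + ENNReal.ofReal k)⁻¹ * (ENNReal.ofReal ((1 + k) * Real.exp (-((1 + k) * x))) * 1) := by
    have hx : 0 < x := hx
    rw [← ENNReal.ofReal_one, ← ENNReal.ofReal_add zero_le_one hk,
      ← ENNReal.ofReal_inv_of_pos hk', expNeg_ofReal (by positivity),
      ← ENNReal.ofReal_mul (by positivity), ← ENNReal.ofReal_mul (by positivity),
      ← ENNReal.ofReal_mul (by positivity), one_mul, one_mul, mul_one, inv_mul_cancel_left₀ hk'.ne',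
      ← Real.exp_add]
    ring_nf
  have := isProbabilityMeasure_expMeasure hk'
  rw [lintegral_expMeasure (by fun_prop), setLIntegral_congr_fun measurableSet_Ioi htilt,
    lintegral_const_mul _ (by fun_prop),
    ← lintegral_expMeasure (r := 1 + k) (measurable_const (a := (1 : ℝ≥0∞))), lintegral_const,
    measure_univ, mul_one, mul_one]

lemma expMeasure_one_lt_ofReal (K : ℝ≥0∞) :
    expMeasure 1 {x | K < ENNReal.ofReal x} = expNeg K := by
  induction K with
  | top => simp
  | coe k =>
    have : {x : ℝ | (k : ℝ≥0∞) < ENNReal.ofReal x} = Ioi (k : ℝ) := by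
      ext x
      rw [← ENNReal.ofReal_coe_nnreal]
      exact ENNReal.ofReal_lt_ofReal_iff_of_nonneg k.2
    rw [this, expMeasure_Ioi one_pos k.coe_nonneg, one_mul, ENNReal.ofReal_coe_nnreal]

lemma measure_lt_ofReal_of_indepFun {T : Ω → ℝ≥0∞} (hT : AEMeasurable T Pr) {Y : Ω → ℝ}
    (hY : HasLaw Y (expMeasure 1) Pr) (h : IndepFun T Y Pr) :
    Pr {ω | T ω < ENNReal.ofReal (Y ω)} = ∫⁻ ω, expNeg (T ω) ∂Pr := by
  have hS : MeasurableSet {q : ℝ≥0∞ × ℝ | q.1 < ENNReal.ofReal q.2} :=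
    measurableSet_lt (by fun_prop) (by fun_prop)
  refine (measure_prodMk_mem_of_indepFun hT hY.aemeasurable h hS).trans ?_
  rw [hY.map_eq]
  exact lintegral_congr fun ω => expMeasure_one_lt_ofReal (T ω)

lemma infinitePi_expMeasure_tsum_lt (j : ℕ) (K : ℝ≥0∞) {x : ℕ → ℝ} (hx : ∀ n, 0 ≤ x n) :
    (Measure.infinitePi fun _ : ℕ => expMeasure 1)
        {y | K + ∑' n, (if n = j then 0 else ENNReal.ofReal (x n * y n)) < ENNReal.ofReal (y j)} =
      expNeg K * expNeg (∑' n, if n = j then 0 else negLog (1 + ENNReal.ofReal (x n))⁻¹) := by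
  have hm : Measurable fun y : ℕ → ℝ => ∑' n, if n = j then 0 else ENNReal.ofReal (x n * y n) :=
    Measurable.tsum fun n => by split_ifs <;> fun_prop
  have hind := indepFun_tsum_ite_eq (fun n => measurable_pi_apply n)
    (iIndepFun_infinitePi (P := fun _ : ℕ => expMeasure 1) (X := fun _ y => y)
      fun _ => measurable_id)
    (g := fun n y => ENNReal.ofReal (x n * y)) (fun n => by fun_prop) j
  rw [measure_lt_ofReal_of_indepFun (hm.const_add K).aemeasurable
    { aemeasurable := (measurable_pi_apply j).aemeasurable
      map_eq := Measure.infinitePi_map_eval (fun _ : ℕ => expMeasure 1) j }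
    (hind.comp (measurable_const_add K) measurable_id)]
  simp only [expNeg_add]
  rw [lintegral_const_mul _ (by fun_prop), lintegral_expNeg_tsum_infinitePi (expMeasure 1)
    (g := fun n y => if n = j then 0 else ENNReal.ofReal (x n * y))
    (fun n => by split_ifs <;> fun_prop)]
  congr 3 with n
  split_ifs
  · simp [negLog]
  · rw [lintegral_expNeg_mul_expMeasure (hx n)]

end Exponential

section ShotNoise

variable {Ω : Type*} [MeasurableSpace Ω] {Pr : Measure Ω} [IsProbabilityMeasure Pr]
  {π₀ : Measure ℝ} [IsProbabilityMeasure π₀] {α : ℝ}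

lemma rpow_neg_eq_sq_rpow {r : ℝ} (hr : 0 ≤ r) (α : ℝ) : r ^ (-α) = (r ^ 2) ^ (-(α / 2)) := by
  rw [← Real.rpow_natCast r 2, ← Real.rpow_mul hr]
  congr 1
  push_cast
  ring

lemma one_sub_lintegral_expNeg_mul_expMeasure_prod (hπ₀ : ∀ᵐ p ∂π₀, 0 ≤ p) {κ : ℝ} (hκ : 0 ≤ κ) :
    1 - ∫⁻ m : ℝ × ℝ, expNeg (ENNReal.ofReal (κ * (m.2 * m.1))) ∂((expMeasure 1).prod π₀) =
      ∫⁻ p, (1 - (1 + ENNReal.ofReal (κ * p))⁻¹) ∂π₀ := by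
  have hle (x : ℝ≥0∞) : (1 + x)⁻¹ ≤ 1 := ENNReal.inv_le_one.2 le_self_add
  have hfin : ∫⁻ p, (1 + ENNReal.ofReal (κ * p))⁻¹ ∂π₀ ≤ 1 := by
    simpa using lintegral_mono (μ := π₀) fun p => hle (ENNReal.ofReal (κ * p))
  rw [lintegral_sub (by fun_prop) (hfin.trans_lt ENNReal.one_lt_top).ne
    (ae_of_all _ fun p => hle _), lintegral_const, measure_univ, mul_one,
    lintegral_prod_symm _ (by fun_prop)]
  congr 1
  refine lintegral_congr_ae ?_
  filter_upwards [hπ₀] with p hp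
  simp_rw [← lintegral_expNeg_mul_expMeasure (mul_nonneg hκ hp), mul_assoc]

lemma setLIntegral_one_sub_lintegral_expNeg_pathLoss (hπ₀ : ∀ᵐ p ∂π₀, 0 ≤ p) (hα : 2 < α)
    {κ : ℝ} (hκ : 0 ≤ κ) :
    ∫⁻ v in Ioi 0, (1 - ∫⁻ m : ℝ × ℝ, expNeg (ENNReal.ofReal (κ * (m.2 * m.1 * v ^ (-(α / 2)))))
        ∂((expMeasure 1).prod π₀)) =
      ENNReal.ofReal (κ ^ (2 / α) * rhoInf α) * ∫⁻ p, ENNReal.ofReal (p ^ (2 / α)) ∂π₀ := by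
  have hmark (v : ℝ) (hv : v ∈ Ioi (0 : ℝ)) :
      1 - ∫⁻ m : ℝ × ℝ, expNeg (ENNReal.ofReal (κ * (m.2 * m.1 * v ^ (-(α / 2)))))
        ∂((expMeasure 1).prod π₀) =
      ∫⁻ p, (1 - (1 + ENNReal.ofReal (κ * p * v ^ (-(α / 2))))⁻¹) ∂π₀ := by
    have h := one_sub_lintegral_expNeg_mul_expMeasure_prod hπ₀
      (mul_nonneg hκ (Real.rpow_nonneg (le_of_lt hv) (-(α / 2))))
    simpa only [mul_comm, mul_left_comm, mul_assoc] using h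
  rw [setLIntegral_congr_fun measurableSet_Ioi hmark, lintegral_lintegral_swap (by fun_prop),
    ← lintegral_const_mul _ (by fun_prop)]
  refine lintegral_congr_ae ?_
  filter_upwards [hπ₀] with p hp
  rw [setLIntegral_Ioi_zero_pathLoss hα (mul_nonneg hκ hp), Real.mul_rpow hκ hp,
    ← ENNReal.ofReal_mul (mul_nonneg (by positivity) (rhoInf_nonneg α)), mul_right_comm]

variable {X : ℕ → Ω → Plane} {c : ℝ} {M : ℕ → Ω → ℝ × ℝ}

theorem lintegral_expNeg_shotNoise (hc : 0 ≤ c) (hX : IsHomogeneousPPP X c Pr)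
    (hM : ∀ n, HasLaw (M n) ((expMeasure 1).prod π₀) Pr) (hi : iIndepFun M Pr)
    (hXM : IndepFun (fun ω n => X n ω) (fun ω n => M n ω) Pr)
    (hπ₀ : ∀ᵐ p ∂π₀, 0 ≤ p) (hα : 2 < α) {κ : ℝ} (hκ : 0 ≤ κ) :
    ∫⁻ ω, expNeg (∑' n, ENNReal.ofReal (κ * ((M n ω).2 * (M n ω).1 * ‖X n ω‖ ^ (-α)))) ∂Pr =
      expNeg (ENNReal.ofReal (Real.pi * c * κ ^ (2 / α) * rhoInf α) *
        ∫⁻ p, ENNReal.ofReal (p ^ (2 / α)) ∂π₀) := by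
  have hUM : IndepFun (fun ω n => ‖X n ω‖ ^ 2) (fun ω n => M n ω) Pr :=
    hXM.comp (φ := fun x n => ‖x n‖ ^ 2) (ψ := id) (by fun_prop) measurable_id
  have hlaplace := (hX.sq_norm hc).marked_laplace_functional hM hi hUM
    (g := fun q : ℝ × ℝ × ℝ => ENNReal.ofReal (κ * (q.2.2 * q.2.1 * q.1 ^ (-(α / 2)))))
    (by fun_prop)
  simp_rw [rpow_neg_eq_sq_rpow (norm_nonneg _) α]
  rw [hlaplace, lintegral_smul_measure, setLIntegral_one_sub_lintegral_expNeg_pathLoss hπ₀ hα hκ,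
    smul_eq_mul, ← mul_assoc, ← ENNReal.ofReal_mul (by positivity), ← mul_assoc]

lemma ae_shotNoise_ne_top (hc : 0 ≤ c) (hX : IsHomogeneousPPP X c Pr)
    (hM : ∀ n, HasLaw (M n) ((expMeasure 1).prod π₀) Pr) (hi : iIndepFun M Pr)
    (hXM : IndepFun (fun ω n => X n ω) (fun ω n => M n ω) Pr)
    (hπ₀ : ∀ᵐ p ∂π₀, 0 ≤ p) (hα : 2 < α) (hmom : ∫⁻ p, ENNReal.ofReal (p ^ (2 / α)) ∂π₀ ≠ ∞) :
    ∀ᵐ ω ∂Pr, ∑' n, ENNReal.ofReal ((M n ω).2 * (M n ω).1 * ‖X n ω‖ ^ (-α)) ≠ ∞ := by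
  have hmeas (n : ℕ) :
      AEMeasurable (fun ω => ENNReal.ofReal ((M n ω).2 * (M n ω).1 * ‖X n ω‖ ^ (-α))) Pr := by
    have := (hM n).aemeasurable
    have := (IsPoissonProcess.measurable hX n).aemeasurable (μ := Pr)
    fun_prop
  have hpow : Tendsto (fun n : ℕ => (1 / ((n : ℝ) + 1)) ^ (2 / α)) atTop (𝓝 0) := by
    have := (tendsto_one_div_add_atTop_nhds_zero_nat (𝕜 := ℝ)).rpow_const (p := 2 / α)
      (Or.inr (by positivity))
    rwa [Real.zero_rpow (by positivity)] at this
  have hexp := ENNReal.Tendsto.mul_const (ENNReal.tendsto_ofReal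
    ((hpow.const_mul (Real.pi * c)).mul_const (rhoInf α))) (Or.inr hmom)
  refine ae_ne_top_of_tendsto_laplace (c := fun n : ℕ => ENNReal.ofReal (1 / ((n : ℝ) + 1)))
    (AEMeasurable.tsum hmeas) (fun n => (ENNReal.ofReal_pos.2 (by positivity)).ne') ?_
  have hn (n : ℕ) : (0 : ℝ) ≤ 1 / ((n : ℝ) + 1) := by positivity
  simp_rw [← ENNReal.tsum_mul_left, ← ENNReal.ofReal_mul (hn _),
    lintegral_expNeg_shotNoise hc hX hM hi hXM hπ₀ hα (hn _)]
  simpa [Function.comp_def] using (continuous_expNeg.tendsto _).comp hexp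

end ShotNoise

section AllowedPower

lemma forall_notMem_of_lt_div_iSup_rpow {v a : ℕ → ℝ} (hv : ∀ n, 0 < v n) {α ζ u : ℝ}
    (hα : 0 < α) (hζ : 0 < ζ) (hu : 0 < u)
    (h : u < (ζ / ⨆ n, a n * v n ^ (-(α / 2))) ^ (2 / α)) (n : ℕ) :
    (v n, a n) ∉ Iic (u * ζ ^ (-(2 / α))) ×ˢ Ioi 1 := by
  rintro ⟨hvn : v n ≤ _, han : 1 < a n⟩
  set H := ⨆ n, a n * v n ^ (-(α / 2)) with hH
  have hbdd : BddAbove (range fun n => a n * v n ^ (-(α / 2))) := by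
    by_contra hbdd
    rw [hH, Real.iSup_of_not_bddAbove hbdd, div_zero, Real.zero_rpow (by positivity)] at h
    exact h.not_gt hu
  have hlow : ζ / u ^ (α / 2) ≤ H :=
    calc ζ / u ^ (α / 2) = (u * ζ ^ (-(2 / α))) ^ (-(α / 2)) := by
          rw [Real.rpow_neg hζ.le, Real.rpow_neg (by positivity),
            Real.mul_rpow hu.le (by positivity), Real.inv_rpow (by positivity),
            rpow_two_div_rpow_half hα.ne' hζ.le]
          field_simp
      _ ≤ v n ^ (-(α / 2)) := Real.rpow_le_rpow_of_nonpos (hv n) hvn (by linarith)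
      _ ≤ a n * v n ^ (-(α / 2)) :=
          le_mul_of_one_le_left (Real.rpow_nonneg (hv n).le _) han.le
      _ ≤ H := le_ciSup hbdd n
  have hHpos : 0 < H := lt_of_lt_of_le (by positivity) hlow
  refine h.not_ge ?_
  calc (ζ / H) ^ (2 / α) ≤ (u ^ (α / 2)) ^ (2 / α) :=
        Real.rpow_le_rpow (by positivity) ((div_le_comm₀ (by positivity) hHpos).1 hlow)
          (by positivity)
    _ = u := by
        rw [← Real.rpow_mul hu.le, div_mul_div_cancel₀' hα.ne', div_self two_ne_zero, Real.rpow_one]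

variable {Ω : Type*} [MeasurableSpace Ω] {Pr : Measure Ω}

lemma ae_pos_of_hasLaw_expMeasure {Z : Ω → ℝ} (hZ : HasLaw Z (expMeasure 1) Pr) :
    ∀ᵐ ω ∂Pr, 0 < Z ω := by
  have h : expMeasure 1 (Iic 0) = 0 := by
    rw [← Iio_insert, insert_eq]
    exact measure_union_null (expMeasure_singleton 1 0) (expMeasure_Iio_zero 1)
  rw [← hZ.map_eq, Measure.map_apply_of_aemeasurable hZ.aemeasurable measurableSet_Iic] at h
  filter_upwards [measure_eq_zero_iff_ae_notMem.1 h] with ω hω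
  simpa using hω

variable [IsProbabilityMeasure Pr]

lemma IsPoissonProcess.measure_forall_marked_notMem {E 𝓜 : Type*} [MeasurableSpace E]
    [MeasurableSpace 𝓜] {X : ℕ → Ω → E} {Λ : Measure E} [SigmaFinite Λ] {M : ℕ → Ω → 𝓜}
    {ν : Measure 𝓜} [IsProbabilityMeasure ν] (hX : IsPoissonProcess X Λ Pr)
    (hM : ∀ n, HasLaw (M n) ν Pr) (hMi : iIndepFun M Pr)
    (hXM : IndepFun (fun ω n => X n ω) (fun ω n => M n ω) Pr) {B : Set (E × 𝓜)}
    (hB : MeasurableSet B) :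
    Pr {ω | ∀ n, (X n ω, M n ω) ∉ B} = expNeg ((Λ.prod ν) B) := by
  have hnull : NullMeasurableSet {ω | ∀ n, (X n ω, M n ω) ∉ B} Pr := by
    simp only [ofPred_forall]
    exact NullMeasurableSet.iInter fun n =>
      ((hX.measurable n).aemeasurable.prodMk (hM n).aemeasurable).nullMeasurableSet_preimage
        hB.compl
  have hvoid (ω : Ω) : expNeg (∑' n, B.indicator (fun _ => ∞) (X n ω, M n ω)) =
      {ω | ∀ n, (X n ω, M n ω) ∉ B}.indicator 1 ω := by
    by_cases hω : ∀ n, (X n ω, M n ω) ∉ B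
    · simp [indicator_of_notMem (hω _), indicator_of_mem (s := {ω | ∀ n, (X n ω, M n ω) ∉ B}) hω]
    · rw [indicator_of_notMem (s := {ω | ∀ n, (X n ω, M n ω) ∉ B}) hω]
      obtain ⟨n, hn⟩ := not_forall_not.1 hω
      rw [ENNReal.tsum_eq_top_of_eq_top ⟨n, indicator_of_mem hn _⟩, expNeg_top]
  have hmark (x : E) : 1 - ∫⁻ m, expNeg (B.indicator (fun _ => ∞) (x, m)) ∂ν =
      ν (Prod.mk x ⁻¹' B) := by
    have hpre := measurable_prodMk_left (x := x) hB
    have : (fun m => expNeg (B.indicator (fun _ => ∞) (x, m))) =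
        (Prod.mk x ⁻¹' B)ᶜ.indicator 1 := by
      ext m
      by_cases hm : (x, m) ∈ B <;> simp [hm]
    rw [this, lintegral_indicator_one hpre.compl, ← prob_compl_eq_one_sub hpre.compl, compl_compl]
  rw [← lintegral_indicator_one₀ hnull, Measure.prod_apply hB]
  simp_rw [← hvoid, ← hmark]
  exact hX.marked_laplace_functional hM hMi hXM (measurable_const.indicator hB)

variable {Y : ℕ → Ω → Plane} {G : ℕ → Ω → ℝ} {μ α ζ : ℝ}

lemma measure_lt_div_iSup_rpow_le (hμ : 0 ≤ μ) (hY : IsHomogeneousPPP Y μ Pr)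
    (hG : ∀ n, HasLaw (G n) (expMeasure 1) Pr) (hi : iIndepFun G Pr)
    (hYG : IndepFun (fun ω n => Y n ω) (fun ω n => G n ω) Pr) (hζ : 0 < ζ) (hα : 0 < α)
    {u : ℝ} (hu : 0 < u) :
    Pr {ω | u < (ζ / ⨆ i, G i ω * ‖Y i ω‖ ^ (-α)) ^ (2 / α)} ≤
      ENNReal.ofReal (Real.exp (-(Real.pi * μ * ζ ^ (-(2 / α)) * Real.exp (-1)) * u)) := by
  have hV := hY.sq_norm hμ
  have hVG : IndepFun (fun ω n => ‖Y n ω‖ ^ 2) (fun ω n => G n ω) Pr :=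
    hYG.comp (φ := fun y n => ‖y n‖ ^ 2) (by fun_prop) measurable_id
  have hvoid := hV.measure_forall_marked_notMem hG hi hVG
    (B := Iic (u * ζ ^ (-(2 / α))) ×ˢ Ioi 1) (measurableSet_Iic.prod measurableSet_Ioi)
  rw [Measure.prod_prod, expMeasure_Ioi one_pos zero_le_one, Measure.smul_apply,
    Measure.restrict_apply measurableSet_Iic, Iic_inter_Ioi, Real.volume_Ioc, sub_zero, smul_eq_mul,
    mul_one, expNeg_ofReal zero_le_one, ← ENNReal.ofReal_mul (by positivity),
    ← ENNReal.ofReal_mul (by positivity), expNeg_ofReal (by positivity)] at hvoid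
  refine (measure_mono_ae ?_).trans (hvoid.trans_le (ENNReal.ofReal_le_ofReal ?_))
  · filter_upwards [hV.ae_pos] with ω hpos hω
    simp_rw [rpow_neg_eq_sq_rpow (norm_nonneg _)] at hω
    exact forall_notMem_of_lt_div_iSup_rpow hpos hα hζ hu hω
  · exact le_of_eq (by ring_nf)

theorem lintegral_div_iSup_rpow_ne_top (hμ : 0 < μ) (hY : IsHomogeneousPPP Y μ Pr)
    (hG : ∀ n, HasLaw (G n) (expMeasure 1) Pr) (hi : iIndepFun G Pr)
    (hYG : IndepFun (fun ω n => Y n ω) (fun ω n => G n ω) Pr) (x : Plane) (hζ : 0 < ζ)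
    (hα : 0 < α) :
    ∫⁻ ω, ENNReal.ofReal ((ζ / ⨆ i, G i ω * ‖x - Y i ω‖ ^ (-α)) ^ (2 / α)) ∂Pr ≠ ∞ := by
  have hXY : IsHomogeneousPPP (fun n ω => x - Y n ω) μ Pr := by
    have := IsPoissonProcess.map hY (φ := fun y => x - y) (by fun_prop)
    rwa [Measure.map_smul, (volume.measurePreserving_sub_left x).map_eq] at this
  have hXG : IndepFun (fun ω n => x - Y n ω) (fun ω n => G n ω) Pr :=
    hYG.comp (φ := fun y n => x - y n) (by fun_prop) measurable_id
  have hmeas : AEMeasurable (fun ω => ⨆ i, G i ω * ‖x - Y i ω‖ ^ (-α)) Pr :=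
    AEMeasurable.iSup fun i => by
      have := (IsPoissonProcess.measurable hY i).aemeasurable (μ := Pr)
      have := (hG i).aemeasurable
      fun_prop
  have hnonneg : ∀ᵐ ω ∂Pr, 0 ≤ ⨆ i, G i ω * ‖x - Y i ω‖ ^ (-α) := by
    filter_upwards [ae_all_iff.2 fun n => ae_pos_of_hasLaw_expMeasure (hG n)] with ω hω
    exact Real.iSup_nonneg fun i => mul_nonneg (hω i).le (by positivity)
  rw [lintegral_eq_lintegral_meas_lt Pr _ (by fun_prop)]
  · refine ne_top_of_le_ne_top ?_ (setLIntegral_mono (by fun_prop) fun u hu =>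
      measure_lt_div_iSup_rpow_le hμ.le hXY hG hi hXG hζ hα hu)
    exact (integrableOn_exp_mul_Ioi (neg_neg_of_pos (by positivity)) 0).lintegral_lt_top.ne
  · filter_upwards [hnonneg] with ω hω
    simp only [Pi.zero_apply]
    positivity

end AllowedPower

section Serving

lemma measurable_sInf_setOf_mem {𝓤 : Type*} [MeasurableSpace 𝓤] {S : ℕ → Set 𝓤}
    (hS : ∀ n, MeasurableSet (S n)) : Measurable fun x => sInf {n | x ∈ S n} := by
  refine measurable_of_Iic fun n => ?_
  have hpre : (fun x => sInf {n | x ∈ S n}) ⁻¹' Iic n = (⋃ m ≤ n, S m) ∪ ⋂ m, (S m)ᶜ := by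
    ext x
    simp only [mem_preimage, mem_Iic, mem_union, mem_iUnion, mem_iInter, mem_compl_iff, exists_prop]
    refine ⟨fun hle => ?_, ?_⟩
    · by_cases hne : {m | x ∈ S m}.Nonempty
      · exact Or.inl ⟨_, hle, Nat.sInf_mem hne⟩
      · exact Or.inr fun m hm => hne ⟨m, hm⟩
    · rintro (⟨m, hm, hxm⟩ | hnone)
      · exact (Nat.sInf_le hxm).trans hm
      · simp [hnone]
  rw [hpre]
  exact (MeasurableSet.biUnion (to_countable _) fun m _ => hS m).union
    (MeasurableSet.iInter fun m => (hS m).compl)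

/-- The index of the station of the configuration `x` that provides the maximum average received
power at the origin, when all stations transmit with power `p`; as for `Downlink.serving`, ties are
resolved in favour of the smallest index. -/
noncomputable def servingIndex (p α : ℝ) (x : ℕ → Plane) : ℕ :=
  sInf {f : ℕ | ∀ j, p * ‖x j‖ ^ (-α) ≤ p * ‖x f‖ ^ (-α)}

lemma measurable_servingIndex (p α : ℝ) : Measurable (servingIndex p α) := by
  refine measurable_sInf_setOf_mem
    (S := fun n => {x : ℕ → Plane | ∀ j, p * ‖x j‖ ^ (-α) ≤ p * ‖x n‖ ^ (-α)}) fun n => ?_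
  simp only [ofPred_forall]
  exact MeasurableSet.iInter fun j => measurableSet_le (by fun_prop) (by fun_prop)

lemma measurable_apply_servingIndex (p α : ℝ) :
    Measurable fun x : ℕ → Plane => x (servingIndex p α x) := by
  have heval : Measurable fun q : (ℕ → Plane) × ℕ => q.1 q.2 :=
    measurable_from_prod_countable_left fun n => measurable_pi_apply n
  exact heval.comp (measurable_id.prodMk (measurable_servingIndex p α))

lemma sq_norm_servingIndex_le {p α : ℝ} (hp : 0 < p) (hα : 0 < α) {x : ℕ → Plane}
    (hpos : ∀ n, 0 < ‖x n‖ ^ 2) (hmin : ∃ j, ∀ i, ‖x j‖ ^ 2 ≤ ‖x i‖ ^ 2) (i : ℕ) :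
    ‖x (servingIndex p α x)‖ ^ 2 ≤ ‖x i‖ ^ 2 := by
  have hiff (f j) : p * ‖x j‖ ^ (-α) ≤ p * ‖x f‖ ^ (-α) ↔ ‖x f‖ ^ 2 ≤ ‖x j‖ ^ 2 := by
    rw [mul_le_mul_iff_right₀ hp, rpow_neg_eq_sq_rpow (norm_nonneg _),
      rpow_neg_eq_sq_rpow (norm_nonneg _)]
    exact Real.rpow_le_rpow_iff_of_neg (hpos j) (hpos f) (by linarith)
  obtain ⟨j, hj⟩ := hmin
  have hne : {f : ℕ | ∀ j, p * ‖x j‖ ^ (-α) ≤ p * ‖x f‖ ^ (-α)}.Nonempty :=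
    ⟨j, fun i => (hiff j i).2 (hj i)⟩
  exact (hiff _ i).1 (Nat.sInf_mem hne i)

variable {Ω : Type*} [MeasurableSpace Ω] {Pr : Measure Ω} [IsProbabilityMeasure Pr]

lemma ae_servingIndex_nearest {X : ℕ → Ω → Plane} {c : ℝ} (hc : 0 ≤ c)
    (hX : IsHomogeneousPPP X c Pr) {p α : ℝ} (hp : 0 < p) (hα : 0 < α) :
    ∀ᵐ ω ∂Pr, ‖X (servingIndex p α fun n => X n ω) ω‖ ^ 2 = ⨅ n, ‖X n ω‖ ^ 2 ∧
      ∀ n, n ≠ servingIndex p α (fun n => X n ω) → ⨅ n, ‖X n ω‖ ^ 2 < ‖X n ω‖ ^ 2 := by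
  have hU := hX.sq_norm hc
  filter_upwards [hU.ae_pos, hU.ae_exists_forall_le, hU.ae_injective] with ω hpos hmin hinj
  have hle := sq_norm_servingIndex_le (x := fun n => X n ω) hp hα hpos hmin
  have hinf : ‖X (servingIndex p α fun n => X n ω) ω‖ ^ 2 = ⨅ n, ‖X n ω‖ ^ 2 :=
    le_antisymm (le_ciInf hle) (ciInf_le ⟨0, by rintro _ ⟨n, rfl⟩; exact (hpos n).le⟩ _)
  refine ⟨hinf, fun n hn => ?_⟩
  rw [← hinf]
  exact (hle n).lt_of_ne fun h => hn (hinj h.symm)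

end Serving

section Interferer

variable {α β : ℝ}

/-- The contribution of an interferer at squared distance `v` to the exponent of the coverage
probability at threshold `β`, when the serving station is at squared distance `u`: under Rayleigh
fading, `exp (-interfererExponent α β u v)` is the factor by which the interferer reduces it. -/
noncomputable def interfererExponent (α β u v : ℝ) : ℝ≥0∞ :=
  negLog (1 + ENNReal.ofReal (β * (u / v) ^ (α / 2)))⁻¹

lemma expNeg_interfererExponent (α β u v : ℝ) :
    expNeg (interfererExponent α β u v) = (1 + ENNReal.ofReal (β * (u / v) ^ (α / 2)))⁻¹ :=
  expNeg_negLog_inv_one_add _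

lemma measurable_interfererExponent (α β : ℝ) :
    Measurable (Function.uncurry (interfererExponent α β)) := by
  unfold interfererExponent Function.uncurry
  fun_prop

lemma interfererExponent_ne_top (α β u v : ℝ) : interfererExponent α β u v ≠ ∞ :=
  negLog_inv_one_add_ne_top ENNReal.ofReal_ne_top

lemma interfererExponent_mono_left (hα : 0 ≤ α) (hβ : 0 ≤ β) {u u' v : ℝ} (hv : 0 < v) (hu : 0 < u)
    (huu' : u ≤ u') : interfererExponent α β u v ≤ interfererExponent α β u' v := by
  refine negLog_antitone (ENNReal.inv_le_inv.2 ?_)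
  gcongr

lemma continuous_interfererExponent_left (hα : 0 ≤ α) (β v : ℝ) :
    Continuous fun u => interfererExponent α β u v := by
  have hpow : Continuous fun u : ℝ => β * (u / v) ^ (α / 2) :=
    ((continuous_id.div_const v).rpow_const fun _ => Or.inr (by positivity)).const_mul β
  exact continuous_negLog.comp
    (continuous_inv.comp ((ENNReal.continuous_ofReal.comp hpow).const_add 1))

lemma setLIntegral_Ioi_interfererExponent (hα : 2 < α) (hβ : 0 < β) {u : ℝ} (hu : 0 < u) :
    ∫⁻ v in Ioi u, (1 - expNeg (interfererExponent α β u v)) =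
      ENNReal.ofReal (β ^ (2 / α) * u * rho α β) := by
  simp_rw [expNeg_interfererExponent]
  exact setLIntegral_Ioi_pathLoss hα hβ hu

lemma setLIntegral_Ioi_zero_interfererExponent_ne_top (hα : 2 < α) (hβ : 0 ≤ β) {u : ℝ}
    (hu : 0 ≤ u) : ∫⁻ v in Ioi 0, (1 - expNeg (interfererExponent α β u v)) ≠ ∞ := by
  have heq (v : ℝ) (hv : v ∈ Ioi (0 : ℝ)) : 1 - expNeg (interfererExponent α β u v) =
      1 - (1 + ENNReal.ofReal (β * u ^ (α / 2) * v ^ (-(α / 2))))⁻¹ := by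
    rw [expNeg_interfererExponent, Real.div_rpow hu (le_of_lt hv), Real.rpow_neg (le_of_lt hv),
      mul_div_assoc', ← div_eq_mul_inv]
  rw [setLIntegral_congr_fun measurableSet_Ioi heq,
    setLIntegral_Ioi_zero_pathLoss hα (mul_nonneg hβ (Real.rpow_nonneg hu _))]
  exact ENNReal.ofReal_ne_top

variable {Ω : Type*} [MeasurableSpace Ω] {Pr : Measure Ω} [IsProbabilityMeasure Pr]

lemma lintegral_serving {X : ℕ → Ω → Plane} {c : ℝ} (hc : 0 < c) (hX : IsHomogeneousPPP X c Pr)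
    {p : ℝ} (hp : 0 < p) (hα : 2 < α) (hβ : 0 < β) {F : ℝ → ℝ≥0∞} (hF : Measurable F)
    (hF1 : ∀ u, F u ≤ 1) :
    ∫⁻ ω, F (‖X (servingIndex p α fun n => X n ω) ω‖ ^ 2) *
        expNeg (∑' n, if n = servingIndex p α (fun n => X n ω) then 0 else
          interfererExponent α β (‖X (servingIndex p α fun n => X n ω) ω‖ ^ 2) (‖X n ω‖ ^ 2)) ∂Pr =
      ∫⁻ u in Ioi 0, ENNReal.ofReal (Real.pi * c * Real.exp (-(Real.pi * c * u))) *
        (F u * expNeg (ENNReal.ofReal (Real.pi * c * (β ^ (2 / α) * u * rho α β)))) := by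
  have hU := hX.sq_norm hc.le
  have hπc : 0 < Real.pi * c := by positivity
  have hα0 : 0 < α := by linarith
  have hFint : ∫⁻ ω, F (⨅ n, ‖X n ω‖ ^ 2) ∂Pr ≠ ∞ :=
    ((lintegral_mono fun _ => hF1 _).trans_lt (by simp)).ne
  calc _ = ∫⁻ ω, F (⨅ n, ‖X n ω‖ ^ 2) * expNeg (∑' n, (Ioi (⨅ n, ‖X n ω‖ ^ 2)).indicator
          (interfererExponent α β (⨅ n, ‖X n ω‖ ^ 2)) (‖X n ω‖ ^ 2)) ∂Pr := by
        refine lintegral_congr_ae ?_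
        filter_upwards [ae_servingIndex_nearest hc.le hX hp hα0] with ω ⟨hinf, hlt⟩
        rw [hinf]
        congr 3 with n
        split_ifs with hn
        · rw [hn, hinf, indicator_of_notMem self_notMem_Ioi]
        · exact (indicator_of_mem (hlt n hn) _).symm
    _ = ∫⁻ ω, F (⨅ n, ‖X n ω‖ ^ 2) * expNeg (ENNReal.ofReal (Real.pi * c) *
          ∫⁻ v in Ioi (⨅ n, ‖X n ω‖ ^ 2),
            (1 - expNeg (interfererExponent α β (⨅ n, ‖X n ω‖ ^ 2) v))) ∂Pr :=
        hU.lintegral_iInf_mul_expNeg_tsum hF hFint (measurable_interfererExponent α β)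
          (fun v hv u u' hu => interfererExponent_mono_left hα0.le hβ.le hv hu)
          (fun v _ u _ => (continuous_interfererExponent_left hα0.le β v).continuousAt)
          (fun v _ u _ => interfererExponent_ne_top α β u v)
          fun u hu => setLIntegral_Ioi_zero_interfererExponent_ne_top hα hβ.le (le_of_lt hu)
    _ = ∫⁻ ω, F (⨅ n, ‖X n ω‖ ^ 2) * expNeg (ENNReal.ofReal
          (Real.pi * c * (β ^ (2 / α) * (⨅ n, ‖X n ω‖ ^ 2) * rho α β))) ∂Pr := by
        refine lintegral_congr_ae ?_
        filter_upwards [hU.ae_iInf_pos] with ω hpos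
        rw [setLIntegral_Ioi_interfererExponent hα hβ hpos, ← ENNReal.ofReal_mul hπc.le]
    _ = _ := by
        rw [← lintegral_map (f := fun u => F u * expNeg (ENNReal.ofReal
          (Real.pi * c * (β ^ (2 / α) * u * rho α β)))) (by fun_prop) hU.measurable_iInf,
          hU.map_iInf hπc, lintegral_expMeasure (by fun_prop)]

end Interferer

section FadingRace

variable {Ω : Type*} [MeasurableSpace Ω] {Pr : Measure Ω} [IsProbabilityMeasure Pr]
  {𝓦 : Type*} [MeasurableSpace 𝓦]

theorem measure_tsum_lt_ofReal_of_indepFun {W : Ω → 𝓦} (hW : AEMeasurable W Pr) {G : ℕ → Ω → ℝ}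
    (hG : ∀ n, HasLaw (G n) (expMeasure 1) Pr) (hi : iIndepFun G Pr)
    (hWG : IndepFun W (fun ω n => G n ω) Pr) {j : 𝓦 → ℕ} (hj : Measurable j) {K : 𝓦 → ℝ≥0∞}
    (hK : Measurable K) {b : 𝓦 → ℕ → ℝ} (hb : ∀ n, Measurable fun w => b w n)
    (hb0 : ∀ w n, 0 ≤ b w n) :
    Pr {ω | K (W ω) + ∑' n, (if n = j (W ω) then 0 else ENNReal.ofReal (b (W ω) n * G n ω)) <
        ENNReal.ofReal (G (j (W ω)) ω)} =
      ∫⁻ ω, expNeg (K (W ω)) * expNeg (∑' n, if n = j (W ω) then 0 else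
        negLog (1 + ENNReal.ofReal (b (W ω) n))⁻¹) ∂Pr := by
  have hGm : AEMeasurable (fun ω n => G n ω) Pr :=
    aemeasurable_pi_iff.2 fun n => (hG n).aemeasurable
  have hlaw : Pr.map (fun ω n => G n ω) = Measure.infinitePi fun _ : ℕ => expMeasure 1 := by
    rw [hi.map_fun_eq_infinitePi_map₀ hGm]
    congr 1
    exact funext fun n => (hG n).map_eq
  have hleft : Measurable fun q : 𝓦 × (ℕ → ℝ) => K q.1 +
      ∑' n, (if n = j q.1 then 0 else ENNReal.ofReal (b q.1 n * q.2 n)) := by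
    refine (hK.comp measurable_fst).add (Measurable.tsum fun n => ?_)
    refine Measurable.ite ?_ measurable_const ?_
    · exact measurableSet_eq_fun measurable_const (hj.comp measurable_fst)
    · have hbn : Measurable fun q : 𝓦 × (ℕ → ℝ) => b q.1 n := (hb n).comp measurable_fst
      exact ENNReal.measurable_ofReal.comp (hbn.mul (by fun_prop))
  have hright : Measurable fun q : 𝓦 × (ℕ → ℝ) => ENNReal.ofReal (q.2 (j q.1)) := by
    have heval : Measurable fun q : (ℕ → ℝ) × ℕ => q.1 q.2 :=
      measurable_from_prod_countable_left fun n => measurable_pi_apply n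
    exact ENNReal.measurable_ofReal.comp
      (heval.comp (measurable_snd.prodMk (hj.comp measurable_fst)))
  refine (measure_prodMk_mem_of_indepFun hW hGm hWG (measurableSet_lt hleft hright)).trans ?_
  rw [hlaw]
  exact lintegral_congr fun ω => infinitePi_expMeasure_tsum_lt (j (W ω)) (K (W ω)) (hb0 (W ω))

theorem measure_mul_add_tsum_lt_ofReal_of_indepFun {W : Ω → 𝓦} (hW : AEMeasurable W Pr)
    {G : ℕ → Ω → ℝ} (hG : ∀ n, HasLaw (G n) (expMeasure 1) Pr) (hi : iIndepFun G Pr)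
    (hWG : IndepFun W (fun ω n => G n ω) Pr) {J : Ω → ℝ≥0∞} (hJm : AEMeasurable J Pr)
    (hJ : IndepFun (fun ω => (W ω, fun n => G n ω)) J Pr) {j : 𝓦 → ℕ} (hj : Measurable j)
    {κ : 𝓦 → ℝ≥0∞} (hκ : Measurable κ) {b : 𝓦 → ℕ → ℝ} (hb : ∀ n, Measurable fun w => b w n)
    (hb0 : ∀ w n, 0 ≤ b w n) (τ : ℝ≥0∞) :
    Pr {ω | κ (W ω) * (J ω + τ) +
          ∑' n, (if n = j (W ω) then 0 else ENNReal.ofReal (b (W ω) n * G n ω)) <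
        ENNReal.ofReal (G (j (W ω)) ω)} =
      ∫⁻ ω, expNeg (κ (W ω) * τ) * (∫⁻ t, expNeg (κ (W ω) * t) ∂(Pr.map J)) *
        expNeg (∑' n, if n = j (W ω) then 0 else
          negLog (1 + ENNReal.ofReal (b (W ω) n))⁻¹) ∂Pr := by
  have hGm : AEMeasurable (fun ω n => G n ω) Pr :=
    aemeasurable_pi_iff.2 fun n => (hG n).aemeasurable
  let E (w : 𝓦) : ℝ≥0∞ :=
    expNeg (∑' n, if n = j w then 0 else negLog (1 + ENNReal.ofReal (b w n))⁻¹)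
  have hE : Measurable E := by
    refine measurable_expNeg.comp (Measurable.tsum fun n => Measurable.ite ?_ measurable_const ?_)
    · exact measurableSet_eq_fun measurable_const hj
    · have := hb n
      fun_prop
  have hrace := measure_tsum_lt_ofReal_of_indepFun (W := fun ω => (W ω, J ω)) (hW.prodMk hJm) hG hi
    (indepFun_prodMk_swap hW hGm hJm hWG hJ) (hj.comp measurable_fst)
    (K := fun w => κ w.1 * (w.2 + τ)) (by fun_prop) (b := fun w => b w.1)
    (fun n => (hb n).comp measurable_fst) fun w => hb0 w.1
  have hWJ : IndepFun W J Pr := hJ.comp measurable_fst measurable_id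
  refine hrace.trans ((lintegral_comp_prodMk_of_indepFun hW hJm hWJ
    (F := fun w => expNeg (κ w.1 * (w.2 + τ)) * E w.1) (by fun_prop)).trans ?_)
  refine lintegral_congr fun ω => ?_
  simp_rw [mul_add, expNeg_add]
  rw [lintegral_mul_const _ (by fun_prop), lintegral_mul_const _ (by fun_prop),
    mul_comm (∫⁻ _, _ ∂_)]

end FadingRace

section ChangeOfVariables

lemma setLIntegral_Ioi_comp_mul {b : ℝ} (hb : 0 < b) (f : ℝ → ℝ≥0∞) :
    ∫⁻ u in Ioi 0, f u = ∫⁻ z in Ioi 0, ENNReal.ofReal b * f (b * z) := by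
  have h := lintegral_image_eq_lintegral_abs_deriv_mul (s := Ioi (0 : ℝ)) (f := fun z => b * z)
    (f' := fun _ => b) measurableSet_Ioi
    (fun x _ => by simpa using ((hasDerivAt_id x).const_mul b).hasDerivWithinAt)
    (fun x _ y _ hxy => mul_left_cancel₀ hb.ne' hxy) f
  rw [image_mul_left_Ioi hb, mul_zero] at h
  simpa [abs_of_pos hb] using h

lemma mul_rpow_half_rpow_two_div {α β z : ℝ} (hα : α ≠ 0) (hβ : 0 ≤ β) (hz : 0 ≤ z) :
    (β * z ^ (α / 2)) ^ (2 / α) = β ^ (2 / α) * z := by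
  rw [Real.mul_rpow hβ (Real.rpow_nonneg hz _), ← Real.rpow_mul hz,
    div_mul_div_cancel₀ two_ne_zero, div_self hα, Real.rpow_one]

lemma div_mul_rpow_two_div_mul_rpow_half {α p z : ℝ} (hα : α ≠ 0) (hp : 0 < p) (hz : 0 ≤ z)
    (β : ℝ) : β / p * (p ^ (2 / α) * z) ^ (α / 2) = β * z ^ (α / 2) := by
  rw [Real.mul_rpow (Real.rpow_nonneg hp.le _) hz, rpow_two_div_rpow_half hα hp.le, ← mul_assoc,
    div_mul_cancel₀ β hp.ne']

end ChangeOfVariables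

section Coverage

lemma ofReal_mul_tsum_ite_eq_tsum_ite {p a β u : ℝ} (hp : 0 < p) (hβ : 0 ≤ β) (hu : 0 ≤ u)
    {g v : ℕ → ℝ} (hv : ∀ n, 0 ≤ v n) (k : ℕ) :
    ENNReal.ofReal (β / p * u ^ a) *
        ∑' n, (if n = k then 0 else ENNReal.ofReal (p * g n * v n ^ (-a))) =
      ∑' n, if n = k then 0 else ENNReal.ofReal (β * (u / v n) ^ a * g n) := by
  have hκ : 0 ≤ β / p * u ^ a := by positivity
  rw [← ENNReal.tsum_mul_left]
  refine tsum_congr fun n => ?_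
  split_ifs
  · rw [mul_zero]
  · rw [← ENNReal.ofReal_mul hκ, Real.div_rpow hu (hv n), Real.rpow_neg (hv n)]
    congr 1
    field_simp

lemma toReal_tsum_ite_ofReal {f : ℕ → ℝ} (hf : ∀ n, 0 ≤ f n) (k : ℕ) :
    (∑' n, if n = k then 0 else ENNReal.ofReal (f n)).toReal = ∑' n, if n = k then 0 else f n := by
  have hne (n : ℕ) : (if n = k then 0 else ENNReal.ofReal (f n)) ≠ ∞ := by
    split_ifs
    exacts [ENNReal.zero_ne_top, ENNReal.ofReal_ne_top]
  rw [ENNReal.tsum_toReal_eq hne]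
  refine tsum_congr fun n => ?_
  split_ifs
  exacts [ENNReal.toReal_zero, ENNReal.toReal_ofReal (hf n)]

lemma lt_sinr_iff {p a β τ : ℝ} (hp : 0 < p) (hβ : 0 ≤ β) (hτ : 0 ≤ τ) {g v : ℕ → ℝ}
    (hg : ∀ n, 0 < g n) (hv : ∀ n, 0 < v n)
    (hS : ∑' n, ENNReal.ofReal (p * g n * v n ^ (-a)) ≠ ∞) {J : ℝ≥0∞} (hJ : J ≠ ∞) (k : ℕ) :
    β < p * g k * v k ^ (-a) /
        ((∑' n, if n = k then 0 else p * g n * v n ^ (-a)) + J.toReal + τ) ↔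
      ENNReal.ofReal (β / p * v k ^ a) * (J + ENNReal.ofReal τ) +
        ∑' n, (if n = k then 0 else ENNReal.ofReal (β * (v k / v n) ^ a * g n)) <
          ENNReal.ofReal (g k) := by
  have hterm (n : ℕ) : 0 < p * g n * v n ^ (-a) :=
    mul_pos (mul_pos hp (hg n)) (Real.rpow_pos_of_pos (hv n) _)
  have hvk : 0 < v k ^ a := Real.rpow_pos_of_pos (hv k) a
  set S := ∑' n, if n = k then 0 else ENNReal.ofReal (p * g n * v n ^ (-a)) with hSdef
  have hStop : S ≠ ∞ := ne_top_of_le_ne_top hS <| ENNReal.tsum_le_tsum fun n => by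
    split_ifs
    exacts [zero_le, le_rfl]
  -- The interference does not vanish, so the ratio involves no division by zero.
  have hSpos : 0 < S.toReal := by
    refine ENNReal.toReal_pos (fun h => ?_) hStop
    have := ENNReal.tsum_eq_zero.1 h (k + 1)
    simp [(hterm (k + 1)).not_ge] at this
  have hI : 0 < S.toReal + J.toReal + τ := by
    have := ENNReal.toReal_nonneg (a := J)
    linarith
  have hκ : 0 ≤ β / p * v k ^ a := by positivity
  have hright : ENNReal.ofReal (β / p * v k ^ a) * (J + ENNReal.ofReal τ) +
      ENNReal.ofReal (β / p * v k ^ a) * S =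
      ENNReal.ofReal (β / p * v k ^ a * (S.toReal + J.toReal + τ)) := by
    rw [← mul_add, ENNReal.ofReal_mul hκ, ENNReal.ofReal_add (by positivity) hτ,
      ENNReal.ofReal_add (by positivity) (by positivity), ENNReal.ofReal_toReal hStop,
      ENNReal.ofReal_toReal hJ, add_comm, add_assoc]
  rw [← toReal_tsum_ite_ofReal fun n => (hterm n).le,
    ← ofReal_mul_tsum_ite_eq_tsum_ite hp hβ (hv k).le fun n => (hv n).le, ← hSdef, hright,
    ENNReal.ofReal_lt_ofReal_iff (hg k), lt_div_iff₀ hI, Real.rpow_neg (hv k).le,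
    ← div_eq_mul_inv, lt_div_iff₀ hvk, mul_comm p, ← div_lt_iff₀ hp]
  refine iff_of_eq (congrArg (· < g k) ?_)
  ring

variable {Ω : Type*} [MeasurableSpace Ω] {Pr : Measure Ω} [IsProbabilityMeasure Pr]
  {X : ℕ → Ω → Plane} {G : ℕ → Ω → ℝ} {J : Ω → ℝ≥0∞} {c p α β τ : ℝ}

lemma ae_ownSignal_ne_top (hc : 0 ≤ c) (hX : IsHomogeneousPPP X c Pr)
    (hG : ∀ n, HasLaw (G n) (expMeasure 1) Pr) (hi : iIndepFun G Pr)
    (hXG : IndepFun (fun ω n => X n ω) (fun ω n => G n ω) Pr) (hp : 0 ≤ p) (hα : 2 < α) :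
    ∀ᵐ ω ∂Pr, ∑' n, ENNReal.ofReal (p * G n ω * ‖X n ω‖ ^ (-α)) ≠ ∞ := by
  have hM (n : ℕ) : HasLaw (fun ω => (G n ω, p)) ((expMeasure 1).prod (Measure.dirac p)) Pr :=
    { aemeasurable := (hG n).aemeasurable.prodMk aemeasurable_const
      map_eq := by
        rw [← (hG n).map_eq, Measure.prod_dirac,
          AEMeasurable.map_map_of_aemeasurable (by fun_prop) (hG n).aemeasurable]
        rfl }
  refine ae_shotNoise_ne_top (M := fun n ω => (G n ω, p)) hc hX hM
    (hi.comp (fun _ y => (y, p)) fun _ => by fun_prop)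
    (hXG.comp (φ := id) (ψ := fun (y : ℕ → ℝ) n => (y n, p)) measurable_id (by fun_prop)) ?_ hα ?_
  · rwa [ae_dirac_eq]
  · rw [lintegral_dirac]
    exact ENNReal.ofReal_ne_top

theorem measure_lt_sinr (hc : 0 < c) (hX : IsHomogeneousPPP X c Pr)
    (hG : ∀ n, HasLaw (G n) (expMeasure 1) Pr) (hi : iIndepFun G Pr)
    (hXG : IndepFun (fun ω n => X n ω) (fun ω n => G n ω) Pr) (hJm : AEMeasurable J Pr)
    (hJ : IndepFun (fun ω => (fun n => X n ω, fun n => G n ω)) J Pr)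
    (hp : 0 < p) (hα : 2 < α) (hβ : 0 < β) (hτ : 0 ≤ τ) (hJtop : ∀ᵐ ω ∂Pr, J ω ≠ ∞) :
    Pr {ω | β < p * G (servingIndex p α fun n => X n ω) ω *
        ‖X (servingIndex p α fun n => X n ω) ω‖ ^ (-α) /
        ((∑' f, if f = servingIndex p α (fun n => X n ω) then 0 else
          p * G f ω * ‖X f ω‖ ^ (-α)) + (J ω).toReal + τ)} =
      ∫⁻ z in Ioi 0, ENNReal.ofReal (Real.pi * c * p ^ (2 / α) * Real.exp (-(β * τ * z ^ (α / 2))) *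
          Real.exp (-(Real.pi * c * p ^ (2 / α) * z)) *
          Real.exp (-(Real.pi * c * p ^ (2 / α) * (β * z ^ (α / 2)) ^ (2 / α) * rho α β))) *
        ∫⁻ ω, expNeg (ENNReal.ofReal (β * z ^ (α / 2)) * J ω) ∂Pr := by
  have hserv : Measurable fun x : ℕ → Plane => ‖x (servingIndex p α x)‖ ^ 2 :=
    (measurable_apply_servingIndex p α).norm.pow_const 2
  have hb (n : ℕ) : Measurable fun x : ℕ → Plane =>
      β * (‖x (servingIndex p α x)‖ ^ 2 / ‖x n‖ ^ 2) ^ (α / 2) :=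
    ((hserv.fun_div ((measurable_pi_apply n).norm.pow_const 2)).pow_const _).const_mul β
  let κ (u : ℝ) : ℝ := β / p * u ^ (α / 2)
  let F (u : ℝ) : ℝ≥0∞ := expNeg (ENNReal.ofReal (κ u) * ENNReal.ofReal τ) *
    ∫⁻ t, expNeg (ENNReal.ofReal (κ u) * t) ∂(Pr.map J)
  have hJprob := Measure.isProbabilityMeasure_map (μ := Pr) hJm
  have hF : Measurable F := Measurable.mul (by fun_prop) (Measurable.lintegral_prod_right'
    (f := fun q : ℝ × ℝ≥0∞ => expNeg (ENNReal.ofReal (κ q.1) * q.2)) (by fun_prop))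
  have hF1 (u : ℝ) : F u ≤ 1 := mul_le_one' (expNeg_le_one _) (lintegral_expNeg_le_one _ _)
  have hrace := measure_mul_add_tsum_lt_ofReal_of_indepFun (W := fun ω n => X n ω)
    (measurable_pi_iff.2 (IsPoissonProcess.measurable hX)).aemeasurable hG hi hXG hJm hJ
    (measurable_servingIndex p α)
    (κ := fun x => ENNReal.ofReal (κ (‖x (servingIndex p α x)‖ ^ 2))) (by fun_prop)
    (b := fun x n => β * (‖x (servingIndex p α x)‖ ^ 2 / ‖x n‖ ^ 2) ^ (α / 2))
    hb (fun x n => by positivity) (ENNReal.ofReal τ)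
  calc _ = _ := measure_congr ?_
    _ = _ := hrace
    _ = _ := lintegral_serving hc hX hp hα hβ hF hF1
    _ = _ := setLIntegral_Ioi_comp_mul (Real.rpow_pos_of_pos hp (2 / α)) _
    _ = _ := setLIntegral_congr_fun measurableSet_Ioi fun z (hz : 0 < z) => ?_
  · filter_upwards [ae_all_iff.2 fun n => ae_pos_of_hasLaw_expMeasure (hG n),
      ae_ownSignal_ne_top hc.le hX hG hi hXG hp.le hα, hJtop, (hX.sq_norm hc.le).ae_pos]
      with ω hGω hSω hJω hXω
    simp_rw [rpow_neg_eq_sq_rpow (norm_nonneg _) α] at hSω ⊢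
    exact propext (lt_sinr_iff hp hβ.le hτ hGω hXω hSω hJω _)
  · have hρ := rho_nonneg α β hβ.le
    have hκz : κ (p ^ (2 / α) * z) = β * z ^ (α / 2) :=
      div_mul_rpow_two_div_mul_rpow_half (by linarith) hp hz.le β
    simp only [F, hκz, mul_rpow_half_rpow_two_div (α := α) (by linarith) hβ.le hz.le]
    rw [lintegral_map' (by fun_prop) hJm, ← ENNReal.ofReal_mul (by positivity),
      expNeg_ofReal (by positivity), expNeg_ofReal (by positivity),
      mul_right_comm (ENNReal.ofReal (Real.exp _)), ← ENNReal.ofReal_mul (by positivity),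
      ← mul_assoc (ENNReal.ofReal _), ← ENNReal.ofReal_mul (by positivity),
      ← mul_assoc (ENNReal.ofReal _), ← ENNReal.ofReal_mul (by positivity)]
    congr 2
    ring_nf

end Coverage

section FiniteIndependence

variable {Ω ι : Type*} [MeasurableSpace Ω] {Pr : Measure Ω}

lemma lintegral_finset_prod_eq_prod_of_iIndepFun {f : ι → Ω → ℝ≥0∞} (hf : iIndepFun f Pr)
    (hm : ∀ i, AEMeasurable (f i) Pr) (t : Finset ι) :
    ∫⁻ ω, ∏ i ∈ t, f i ω ∂Pr = ∏ i ∈ t, ∫⁻ ω, f i ω ∂Pr := by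
  have hmk : ∀ᵐ ω ∂Pr, ∀ i ∈ t, f i ω = (hm i).mk (f i) ω :=
    (Finset.eventually_all t).2 fun i _ => (hm i).ae_eq_mk
  calc ∫⁻ ω, ∏ i ∈ t, f i ω ∂Pr = ∫⁻ ω, ∏ i ∈ t, (hm i).mk (f i) ω ∂Pr :=
        lintegral_congr_ae (hmk.mono fun _ hω => Finset.prod_congr rfl hω)
    _ = ∏ i ∈ t, ∫⁻ ω, (hm i).mk (f i) ω ∂Pr :=
        lintegral_prod_eq_prod_lintegral_of_indepFun t _ (hf.congr fun i => (hm i).ae_eq_mk)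
          fun i => (hm i).measurable_mk
    _ = _ := Finset.prod_congr rfl fun i _ => lintegral_congr_ae (hm i).ae_eq_mk.symm

lemma indepFun_finset_sum_of_iIndepFun {𝓜 : Type*} [MeasurableSpace 𝓜] {f : ι → Ω → 𝓜}
    (hf : iIndepFun f Pr) (hm : ∀ i, AEMeasurable (f i) Pr) {t : Finset ι} {j : ι} (hj : j ∉ t)
    {g : 𝓜 → ℝ≥0∞} (hg : Measurable g) :
    IndepFun (f j) (fun ω => ∑ i ∈ t, g (f i ω)) Pr := by
  have hsum : (fun ω => ∑ i ∈ t, g (f i ω)) = fun ω => ∑ i : t, g (f i ω) :=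
    funext fun ω => (Finset.sum_coe_sort t fun i => g (f i ω)).symm
  have hproj : Measurable fun q : ({j} : Finset ι) → 𝓜 => q ⟨j, Finset.mem_singleton_self j⟩ :=
    measurable_pi_apply _
  have hadd : Measurable fun q : t → 𝓜 => ∑ i, g (q i) := by fun_prop
  rw [hsum]
  exact (hf.indepFun_finset₀ {j} t (Finset.disjoint_singleton_left.2 hj) hm).comp hproj hadd

end FiniteIndependence

namespace Downlink

variable {O : Type*} [DecidableEq O] {N : Network O} {s : O} {Ω : Type*}

/-- The total power received by the typical user, on sub-band `l`, from the base stations of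
operator `k`. It is `ℝ≥0∞`-valued, so that no summability has to be known beforehand. -/
noncomputable def shotNoise (D : Downlink N s Ω) (l : Fin (N.numBands s)) (k : O) (ω : Ω) : ℝ≥0∞ :=
  ∑' f, ENNReal.ofReal (D.txPower l k f ω * D.gain l k f ω * ‖D.bs k f ω‖ ^ (-N.α))

/-- The interference, on sub-band `l`, from the base stations of all the buyers. -/
noncomputable def buyerInterference (D : Downlink N s Ω) (l : Fin (N.numBands s)) (ω : Ω) : ℝ≥0∞ :=
  ∑ b ∈ (N.group s l).erase s, D.shotNoise l b ω

lemma txPower_of_mem_erase (D : Downlink N s Ω) {l : Fin (N.numBands s)} {b : O}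
    (hb : b ∈ (N.group s l).erase s) : D.txPower l b = D.buyerPower l b := by
  funext f ω
  exact if_neg (Finset.ne_of_mem_erase hb)

lemma mem_sellers_union_buyers (hs : s ∈ N.sellers) {l : Fin (N.numBands s)} {k : O}
    (hk : k ∈ N.group s l) : k ∈ N.sellers ∪ N.buyers := by
  by_cases h : k = s
  · exact Finset.mem_union_left _ (h ▸ hs)
  · exact Finset.mem_union_right _ (N.group_subset s hs l (Finset.mem_erase.2 ⟨h, hk⟩))

lemma measurable_tsum_receivedPower (α : ℝ) : Measurable fun q : (ℕ → Plane) × (ℕ → ℝ × ℝ) =>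
    ∑' f, ENNReal.ofReal ((q.2 f).2 * (q.2 f).1 * ‖q.1 f‖ ^ (-α)) :=
  Measurable.tsum fun f => by fun_prop

namespace IsModel

variable [MeasurableSpace Ω] {D : Downlink N s Ω} {Pr : Measure Ω}

lemma aemeasurable_allowedPower (hD : D.IsModel Pr) (l : Fin (N.numBands s)) :
    AEMeasurable (D.allowedPower l) Pr := by
  refine AEMeasurable.const_div (AEMeasurable.iSup fun i => ?_) _
  have := (hD.ueGain_law l i).aemeasurable
  have := (IsPoissonProcess.measurable hD.ue_ppp i).aemeasurable (μ := Pr)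
  fun_prop

lemma aemeasurable_txPower (hD : D.IsModel Pr) {l : Fin (N.numBands s)} {k : O}
    (hk : k ∈ N.group s l) (f : ℕ) : AEMeasurable (D.txPower l k f) Pr := by
  unfold txPower
  split_ifs with h
  · exact aemeasurable_const
  · exact (hD.power_law l k (Finset.mem_erase.2 ⟨h, hk⟩) f).aemeasurable_fst

lemma hasLaw_txPower (hD : D.IsModel Pr) {l : Fin (N.numBands s)} {b : O}
    (hb : b ∈ (N.group s l).erase s) (f : ℕ) :
    HasLaw (D.txPower l b f) (Pr.map (D.allowedPower l)) Pr := by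
  rw [D.txPower_of_mem_erase hb]
  exact ⟨(hD.power_law l b hb f).aemeasurable_fst, (hD.power_law l b hb f).map_eq⟩

lemma hasLaw_marks [IsFiniteMeasure Pr] (hD : D.IsModel Pr) {l : Fin (N.numBands s)} {b : O}
    (hb : b ∈ (N.group s l).erase s) (f : ℕ) :
    HasLaw (fun ω => (D.gain l b f ω, D.txPower l b f ω))
      ((expMeasure 1).prod (Pr.map (D.allowedPower l))) Pr := by
  have hgain := hD.gain_law l b (Finset.mem_of_mem_erase hb) f
  have hpower := hD.hasLaw_txPower hb f
  refine ⟨hgain.aemeasurable.prodMk hpower.aemeasurable, ?_⟩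
  rw [(indepFun_iff_map_prod_eq_prod_map_map hgain.aemeasurable hpower.aemeasurable).1
    (hD.gain_indep_power l b (Finset.mem_of_mem_erase hb) f), hgain.map_eq, hpower.map_eq]

variable (hs : s ∈ N.sellers)
include hs

lemma ae_allowedPower_nonneg (hD : D.IsModel Pr) (l : Fin (N.numBands s)) :
    ∀ᵐ ω ∂Pr, 0 ≤ D.allowedPower l ω := by
  filter_upwards [ae_all_iff.2 fun i => ae_pos_of_hasLaw_expMeasure (hD.ueGain_law l i)] with ω hω
  exact div_nonneg (N.ζ_pos s hs).le
    (Real.iSup_nonneg fun i => mul_nonneg (hω i).le (by positivity))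

lemma ae_allowedPower_rpow_nonneg (hD : D.IsModel Pr) (l : Fin (N.numBands s)) :
    0 ≤ᵐ[Pr] fun ω => D.allowedPower l ω ^ (2 / N.α) :=
  (hD.ae_allowedPower_nonneg hs l).mono fun _ hω => Real.rpow_nonneg hω _

lemma ae_map_allowedPower_nonneg (hD : D.IsModel Pr) (l : Fin (N.numBands s)) :
    ∀ᵐ p ∂(Pr.map (D.allowedPower l)), 0 ≤ p :=
  (ae_map_iff (hD.aemeasurable_allowedPower l) measurableSet_Ici).2
    (hD.ae_allowedPower_nonneg hs l)

lemma powerMoment_nonneg (hD : D.IsModel Pr) (l : Fin (N.numBands s)) : 0 ≤ D.powerMoment Pr l :=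
  integral_nonneg_of_ae (hD.ae_allowedPower_rpow_nonneg hs l)

lemma ae_buyerPower_nonneg (hD : D.IsModel Pr) {l : Fin (N.numBands s)} {b : O}
    (hb : b ∈ (N.group s l).erase s) (f : ℕ) : ∀ᵐ ω ∂Pr, 0 ≤ D.buyerPower l b f ω := by
  have hlaw := hD.hasLaw_txPower hb f
  rw [← D.txPower_of_mem_erase hb]
  refine ae_of_ae_map hlaw.aemeasurable (p := fun p => 0 ≤ p) ?_
  rw [hlaw.map_eq]
  exact hD.ae_map_allowedPower_nonneg hs l

lemma measurable_bs (hD : D.IsModel Pr) {l : Fin (N.numBands s)} {k : O} (hk : k ∈ N.group s l) :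
    Measurable fun ω f => D.bs k f ω :=
  measurable_pi_iff.2 (IsPoissonProcess.measurable
    (hD.bs_ppp k (mem_sellers_union_buyers hs hk)))

lemma aemeasurable_bs_marks (hD : D.IsModel Pr) {l : Fin (N.numBands s)} {k : O}
    (hk : k ∈ N.group s l) :
    AEMeasurable (fun ω => ((fun f => D.bs k f ω), fun f => (D.gain l k f ω, D.txPower l k f ω)))
      Pr :=
  (hD.measurable_bs hs hk).aemeasurable.prodMk (aemeasurable_pi_iff.2 fun f =>
    (hD.gain_law l k hk f).aemeasurable.prodMk (hD.aemeasurable_txPower hk f))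

lemma aemeasurable_shotNoise (hD : D.IsModel Pr) {l : Fin (N.numBands s)} {k : O}
    (hk : k ∈ N.group s l) : AEMeasurable (D.shotNoise l k) Pr :=
  (measurable_tsum_receivedPower N.α).comp_aemeasurable (hD.aemeasurable_bs_marks hs hk)

lemma aemeasurable_buyerInterference (hD : D.IsModel Pr) (l : Fin (N.numBands s)) :
    AEMeasurable (D.buyerInterference l) Pr :=
  Finset.aemeasurable_fun_sum _ fun _ hb =>
    hD.aemeasurable_shotNoise hs (Finset.mem_of_mem_erase hb)

lemma indepFun_buyerInterference (hD : D.IsModel Pr) (l : Fin (N.numBands s)) :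
    IndepFun (fun ω => ((fun n => D.bs s n ω), fun n => D.gain l s n ω)) (D.buyerInterference l)
      Pr := by
  have hsum : D.buyerInterference l = fun ω =>
      ∑ k ∈ ((N.group s l).erase s).subtype (· ∈ N.group s l), D.shotNoise l k ω :=
    funext fun ω => (Finset.sum_subtype_of_mem (fun k => D.shotNoise l k ω)
      fun _ => Finset.mem_of_mem_erase).symm
  rw [hsum]
  exact (indepFun_finset_sum_of_iIndepFun (hD.operators_indep l)
    (fun k => hD.aemeasurable_bs_marks hs k.2) (j := ⟨s, N.seller_mem_group s hs l⟩)
    (t := ((N.group s l).erase s).subtype (· ∈ N.group s l)) (by simp)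
    (measurable_tsum_receivedPower N.α)).comp
    (φ := fun q => (q.1, fun n => (q.2 n).1)) (by fun_prop) measurable_id

variable [IsProbabilityMeasure Pr]

lemma lintegral_allowedPower_rpow_ne_top (hD : D.IsModel Pr) (l : Fin (N.numBands s)) :
    ∫⁻ ω, ENNReal.ofReal (D.allowedPower l ω ^ (2 / N.α)) ∂Pr ≠ ∞ :=
  lintegral_div_iSup_rpow_ne_top (N.ueIntensity_pos s (Finset.mem_union_left _ hs)) hD.ue_ppp
    (hD.ueGain_law l) (hD.ueGain_indep l) (hD.ue_indep_ueGain l) D.buyerSite (N.ζ_pos s hs)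
    (two_pos.trans N.two_lt_α)

lemma integrable_allowedPower_rpow (hD : D.IsModel Pr) (l : Fin (N.numBands s)) :
    Integrable (fun ω => D.allowedPower l ω ^ (2 / N.α)) Pr :=
  ⟨((hD.aemeasurable_allowedPower l).pow_const _).aestronglyMeasurable,
    (hasFiniteIntegral_iff_ofReal (hD.ae_allowedPower_rpow_nonneg hs l)).2
      (hD.lintegral_allowedPower_rpow_ne_top hs l).lt_top⟩

lemma lintegral_map_allowedPower (hD : D.IsModel Pr) (l : Fin (N.numBands s)) :
    ∫⁻ p, ENNReal.ofReal (p ^ (2 / N.α)) ∂(Pr.map (D.allowedPower l)) =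
      ENNReal.ofReal (D.powerMoment Pr l) := by
  rw [lintegral_map' (by fun_prop) (hD.aemeasurable_allowedPower l), powerMoment,
    ofReal_integral_eq_lintegral_ofReal (hD.integrable_allowedPower_rpow hs l)
      (hD.ae_allowedPower_rpow_nonneg hs l)]

lemma lintegral_expNeg_mul_shotNoise (hD : D.IsModel Pr) {l : Fin (N.numBands s)} {b : O}
    (hb : b ∈ (N.group s l).erase s) {κ : ℝ} (hκ : 0 ≤ κ) :
    ∫⁻ ω, expNeg (ENNReal.ofReal κ * D.shotNoise l b ω) ∂Pr =
      expNeg (ENNReal.ofReal (Real.pi * N.bsIntensity b * D.powerMoment Pr l * κ ^ (2 / N.α) *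
        rhoInf N.α)) := by
  have hbg := Finset.mem_of_mem_erase hb
  have hop := mem_sellers_union_buyers hs hbg
  have := Measure.isProbabilityMeasure_map (μ := Pr) (hD.aemeasurable_allowedPower l)
  have hc := (N.bsIntensity_pos b hop).le
  have hρ := rhoInf_nonneg N.α
  simp_rw [shotNoise, ← ENNReal.tsum_mul_left, ← ENNReal.ofReal_mul hκ]
  rw [lintegral_expNeg_shotNoise hc (hD.bs_ppp b hop) (hD.hasLaw_marks hb)
    (hD.marks_indep l b hbg) (hD.bs_indep_marks l b hbg) (hD.ae_map_allowedPower_nonneg hs l)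
    N.two_lt_α hκ, hD.lintegral_map_allowedPower hs l, ← ENNReal.ofReal_mul (by positivity)]
  congr 2
  ring

lemma ae_shotNoise_ne_top (hD : D.IsModel Pr) {l : Fin (N.numBands s)} {b : O}
    (hb : b ∈ (N.group s l).erase s) : ∀ᵐ ω ∂Pr, D.shotNoise l b ω ≠ ∞ := by
  have hbg := Finset.mem_of_mem_erase hb
  have hop := mem_sellers_union_buyers hs hbg
  have := Measure.isProbabilityMeasure_map (μ := Pr) (hD.aemeasurable_allowedPower l)
  exact SpectrumSharing.ae_shotNoise_ne_top (N.bsIntensity_pos b hop).le (hD.bs_ppp b hop)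
    (hD.hasLaw_marks hb) (hD.marks_indep l b hbg) (hD.bs_indep_marks l b hbg)
    (hD.ae_map_allowedPower_nonneg hs l) N.two_lt_α
    ((hD.lintegral_map_allowedPower hs l).trans_ne ENNReal.ofReal_ne_top)

lemma ae_buyerInterference_ne_top (hD : D.IsModel Pr) (l : Fin (N.numBands s)) :
    ∀ᵐ ω ∂Pr, D.buyerInterference l ω ≠ ∞ := by
  have h : ∀ᵐ ω ∂Pr, ∀ b ∈ (N.group s l).erase s, D.shotNoise l b ω ≠ ∞ :=
    (Finset.eventually_all _).2 fun b hb => hD.ae_shotNoise_ne_top hs hb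
  exact h.mono fun ω hω => ENNReal.sum_ne_top.2 hω

lemma lintegral_expNeg_mul_buyerInterference (hD : D.IsModel Pr) (l : Fin (N.numBands s)) {κ : ℝ}
    (hκ : 0 ≤ κ) :
    ∫⁻ ω, expNeg (ENNReal.ofReal κ * D.buyerInterference l ω) ∂Pr =
      expNeg (ENNReal.ofReal (Real.pi * (∑ b ∈ (N.group s l).erase s, N.bsIntensity b) *
        D.powerMoment Pr l * κ ^ (2 / N.α) * rhoInf N.α)) := by
  have hmem : ∀ b ∈ (N.group s l).erase s, b ∈ N.group s l := fun _ => Finset.mem_of_mem_erase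
  have hind : iIndepFun (fun (k : {k // k ∈ N.group s l}) ω =>
      expNeg (ENNReal.ofReal κ * D.shotNoise l k ω)) Pr :=
    (hD.operators_indep l).comp (fun _ q => expNeg (ENNReal.ofReal κ * ∑' f, ENNReal.ofReal
      ((q.2 f).2 * (q.2 f).1 * ‖q.1 f‖ ^ (-N.α)))) fun _ =>
        measurable_expNeg.comp ((measurable_tsum_receivedPower N.α).const_mul _)
  have hnonneg : ∀ b ∈ (N.group s l).erase s, 0 ≤ Real.pi * N.bsIntensity b *
      D.powerMoment Pr l * κ ^ (2 / N.α) * rhoInf N.α := fun b hb => by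
    have := N.bsIntensity_pos b (mem_sellers_union_buyers hs (hmem b hb))
    have := rhoInf_nonneg N.α
    have := hD.powerMoment_nonneg hs l
    positivity
  calc ∫⁻ ω, expNeg (ENNReal.ofReal κ * D.buyerInterference l ω) ∂Pr
      = ∫⁻ ω, ∏ k ∈ ((N.group s l).erase s).subtype (· ∈ N.group s l),
          expNeg (ENNReal.ofReal κ * D.shotNoise l k ω) ∂Pr := by
        simp_rw [buyerInterference, Finset.mul_sum, expNeg_sum]
        exact lintegral_congr fun ω => (Finset.prod_subtype_of_mem
          (fun k => expNeg (ENNReal.ofReal κ * D.shotNoise l k ω)) hmem).symm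
    _ = ∏ k ∈ ((N.group s l).erase s).subtype (· ∈ N.group s l),
          ∫⁻ ω, expNeg (ENNReal.ofReal κ * D.shotNoise l k ω) ∂Pr :=
        lintegral_finset_prod_eq_prod_of_iIndepFun hind (fun k => by
          have := hD.aemeasurable_shotNoise hs k.2
          fun_prop) _
    _ = ∏ b ∈ (N.group s l).erase s, ∫⁻ ω, expNeg (ENNReal.ofReal κ * D.shotNoise l b ω) ∂Pr :=
        Finset.prod_subtype_of_mem
          (fun k => ∫⁻ ω, expNeg (ENNReal.ofReal κ * D.shotNoise l k ω) ∂Pr) hmem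
    _ = ∏ b ∈ (N.group s l).erase s, expNeg (ENNReal.ofReal (Real.pi * N.bsIntensity b *
          D.powerMoment Pr l * κ ^ (2 / N.α) * rhoInf N.α)) :=
        Finset.prod_congr rfl fun b hb => hD.lintegral_expNeg_mul_shotNoise hs hb hκ
    _ = _ := by
        rw [← expNeg_sum, ← ENNReal.ofReal_sum_of_nonneg hnonneg]
        simp_rw [Finset.mul_sum, Finset.sum_mul]

end IsModel
end Downlink

section Integrand

lemma measurable_rho (α : ℝ) : Measurable (rho α) := by
  have htail : Measurable fun x : ℝ => ∫ ν, if x < ν then 1 / (1 + ν ^ (α / 2)) else 0 := by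
    refine (StronglyMeasurable.integral_prod_right
      (f := fun x ν : ℝ => if x < ν then 1 / (1 + ν ^ (α / 2)) else 0) ?_).measurable
    exact (Measurable.ite (measurableSet_lt measurable_fst measurable_snd) (by fun_prop)
      measurable_const).stronglyMeasurable
  have hrho : rho α = fun β => ∫ ν, if β ^ (-(2 / α)) < ν then 1 / (1 + ν ^ (α / 2)) else 0 := by
    funext β
    exact (integral_indicator measurableSet_Ioi).symm
  rw [hrho]
  exact htail.comp (by fun_prop : Measurable fun β : ℝ => β ^ (-(2 / α)))

lemma le_rho_of_one_le {α β : ℝ} (hα : 2 < α) (hβ : 1 ≤ β) : 1 / (1 + 2 ^ (α / 2)) ≤ rho α β := by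
  have hlow : β ^ (-(2 / α)) ≤ 1 :=
    Real.rpow_le_one_of_one_le_of_nonpos hβ (neg_nonpos.2 (by positivity))
  have hlow0 : 0 ≤ β ^ (-(2 / α)) := Real.rpow_nonneg (by linarith) _
  have hsub : Ioc (1 : ℝ) 2 ⊆ Ioi (β ^ (-(2 / α))) := fun ν hν => hlow.trans_lt hν.1
  have hint : IntegrableOn (fun ν : ℝ => 1 / (1 + ν ^ (α / 2))) (Ioi (β ^ (-(2 / α)))) :=
    (integrableOn_one_div_one_add_rpow (by linarith)).mono_set (Ioi_subset_Ioi hlow0)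
  calc 1 / (1 + 2 ^ (α / 2)) = ∫ _ in Ioc (1 : ℝ) 2, 1 / (1 + (2 : ℝ) ^ (α / 2)) := by
        rw [setIntegral_const, Real.volume_real_Ioc]
        norm_num
    _ ≤ ∫ ν in Ioc (1 : ℝ) 2, 1 / (1 + ν ^ (α / 2)) := by
        refine setIntegral_mono_on (by simp) (hint.mono_set hsub) measurableSet_Ioc fun ν hν => ?_
        have : 0 < ν := zero_lt_one.trans hν.1
        have := hν.2
        gcongr
    _ ≤ rho α β := by
        refine setIntegral_mono_set hint ?_ hsub.eventuallyLE
        filter_upwards [ae_restrict_mem measurableSet_Ioi] with ν hν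
        have : 0 < ν := hlow0.trans_lt hν
        simp only [Pi.zero_apply]
        positivity

variable {O : Type*} [DecidableEq O] {N : Network O} {s : O}

lemma measurable_coverageIntegrand (l : Fin (N.numBands s)) (M : ℝ) :
    Measurable fun q : ℝ × ℝ => coverageIntegrand N s l M (Real.exp q.1 - 1) q.2 := by
  have hrho : Measurable fun q : ℝ × ℝ => rho N.α (Real.exp q.1 - 1) :=
    (measurable_rho N.α).comp (by fun_prop)
  unfold coverageIntegrand laplaceInterference
  fun_prop

lemma lintegral_coverageIntegrand_prod (l : Fin (N.numBands s)) (M : ℝ) :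
    ∫⁻ q in Ioi (0 : ℝ) ×ˢ Ioi (0 : ℝ),
        ENNReal.ofReal (coverageIntegrand N s l M (Real.exp q.1 - 1) q.2) =
      ∫⁻ t in Ioi 0, ∫⁻ z in Ioi 0,
        ENNReal.ofReal (coverageIntegrand N s l M (Real.exp t - 1) z) := by
  rw [Measure.volume_eq_prod, ← Measure.prod_restrict, lintegral_prod]
  exact (measurable_coverageIntegrand l _).ennreal_ofReal.aemeasurable

lemma coverageIntegrand_nonneg (hs : s ∈ N.sellers) (l : Fin (N.numBands s)) (M β z : ℝ) :
    0 ≤ coverageIntegrand N s l M β z := by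
  have := N.bsIntensity_pos s (Finset.mem_union_left _ hs)
  have := N.PS_pos
  unfold coverageIntegrand laplaceInterference
  positivity

lemma sum_bsIntensity_erase_nonneg (hs : s ∈ N.sellers) (l : Fin (N.numBands s)) :
    0 ≤ ∑ b ∈ (N.group s l).erase s, N.bsIntensity b :=
  Finset.sum_nonneg fun b hb =>
    (N.bsIntensity_pos b (Finset.mem_union_right _ (N.group_subset s hs l hb))).le

lemma coverageIntegrand_le (hs : s ∈ N.sellers) (l : Fin (N.numBands s)) {M β z : ℝ} (hM : 0 ≤ M)
    (hβ : 1 ≤ β) (hz : 0 ≤ z) : coverageIntegrand N s l M β z ≤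
      Real.pi * N.bsIntensity s * N.PS ^ (2 / N.α) *
        Real.exp (-(Real.pi * N.bsIntensity s * N.PS ^ (2 / N.α) * β ^ (2 / N.α) *
          (1 / (1 + 2 ^ (N.α / 2))) * z)) := by
  have := N.bsIntensity_pos s (Finset.mem_union_left _ hs)
  have := N.PS_pos
  have hα := N.two_lt_α
  have hβ0 : 0 ≤ β := zero_le_one.trans hβ
  have hsum := sum_bsIntensity_erase_nonneg hs l
  have hrhoInf := rhoInf_nonneg N.α
  rw [coverageIntegrand, laplaceInterference,
    mul_rpow_half_rpow_two_div (two_pos.trans hα).ne' hβ0 hz]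
  set c := Real.pi * N.bsIntensity s * N.PS ^ (2 / N.α)
  have hc0 : 0 ≤ c := by positivity
  have hnoise : 0 ≤ β * N.σ ^ 2 * z ^ (N.α / 2) := by positivity
  have hvoid : 0 ≤ c * z := by positivity
  have hbuyer : 0 ≤ Real.pi * (∑ b ∈ (N.group s l).erase s, N.bsIntensity b) * M *
    (β ^ (2 / N.α) * z) * rhoInf N.α := by positivity
  have hseller : c * β ^ (2 / N.α) * (1 / (1 + 2 ^ (N.α / 2))) * z ≤
      c * (β ^ (2 / N.α) * z) * rho N.α β :=
    calc c * β ^ (2 / N.α) * (1 / (1 + 2 ^ (N.α / 2))) * z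
        = c * (β ^ (2 / N.α) * z) * (1 / (1 + 2 ^ (N.α / 2))) := by ring
      _ ≤ c * (β ^ (2 / N.α) * z) * rho N.α β :=
        mul_le_mul_of_nonneg_left (le_rho_of_one_le hα hβ) (by positivity)
  rw [mul_assoc, mul_assoc, ← Real.exp_add, ← Real.exp_add, ← Real.exp_add]
  refine mul_le_mul_of_nonneg_left (Real.exp_le_exp.2 ?_) hc0
  linarith

lemma lintegral_coverageIntegrand_le (hs : s ∈ N.sellers) (l : Fin (N.numBands s)) {M β : ℝ}
    (hM : 0 ≤ M) (hβ : 1 ≤ β) :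
    ∫⁻ z in Ioi 0, ENNReal.ofReal (coverageIntegrand N s l M β z) ≤
      ENNReal.ofReal ((1 + 2 ^ (N.α / 2)) * β ^ (-(2 / N.α))) := by
  have := N.bsIntensity_pos s (Finset.mem_union_left _ hs)
  have := N.PS_pos
  have hβ0 : 0 < β := zero_lt_one.trans_le hβ
  set c := Real.pi * N.bsIntensity s * N.PS ^ (2 / N.α)
  have hc0 : 0 < c := by positivity
  set r := c * β ^ (2 / N.α) * (1 / (1 + 2 ^ (N.α / 2))) with hr
  have hr0 : 0 < r := by positivity
  have := isProbabilityMeasure_expMeasure hr0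
  have hexp := lintegral_expMeasure (r := r) (measurable_const (a := (1 : ℝ≥0∞)))
  simp only [lintegral_const, measure_univ, mul_one] at hexp
  calc ∫⁻ z in Ioi 0, ENNReal.ofReal (coverageIntegrand N s l M β z)
      ≤ ∫⁻ z in Ioi 0, ENNReal.ofReal (c / r) * ENNReal.ofReal (r * Real.exp (-(r * z))) := by
        refine setLIntegral_mono (by fun_prop) fun z (hz : 0 < z) => ?_
        rw [← ENNReal.ofReal_mul (by positivity), ← mul_assoc, div_mul_cancel₀ _ hr0.ne']
        exact ENNReal.ofReal_le_ofReal (coverageIntegrand_le hs l hM hβ hz.le)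
    _ = ENNReal.ofReal (c / r) := by
        rw [lintegral_const_mul _ (by fun_prop), ← hexp, mul_one]
    _ = ENNReal.ofReal ((1 + 2 ^ (N.α / 2)) * β ^ (-(2 / N.α))) := by
        rw [hr, Real.rpow_neg hβ0.le]
        congr 1
        field_simp

end Integrand

lemma rpow_exp_sub_one_le {a t : ℝ} (ha : 0 ≤ a) (ht : 1 ≤ t) :
    (Real.exp t - 1) ^ (-a) ≤ 2 ^ a * Real.exp (-a * t) := by
  have hexp : 2 ≤ Real.exp t := by linarith [Real.add_one_le_exp t]
  calc (Real.exp t - 1) ^ (-a) ≤ (Real.exp t / 2) ^ (-a) :=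
        Real.rpow_le_rpow_of_nonpos (by positivity) (by linarith) (neg_nonpos.2 ha)
    _ = 2 ^ a * Real.exp (-a * t) := by
        rw [Real.div_rpow (Real.exp_pos t).le two_pos.le, ← Real.exp_mul,
          Real.rpow_neg two_pos.le, div_inv_eq_mul, mul_comm, mul_comm t]

namespace Downlink

variable {O : Type*} [DecidableEq O] {N : Network O} {s : O} {Ω : Type*} [MeasurableSpace Ω]

namespace IsModel

variable {D : Downlink N s Ω} {Pr : Measure Ω}

lemma aemeasurable_buyerPowers (hD : D.IsModel Pr) (l : Fin (N.numBands s)) :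
    AEMeasurable (D.buyerPowers l) Pr :=
  aemeasurable_pi_iff.2 fun b => aemeasurable_pi_iff.2 fun f =>
    (hD.power_law l b.1 b.2 f).aemeasurable_fst

variable (hs : s ∈ N.sellers)
include hs

lemma measurable_serving (hD : D.IsModel Pr) (l : Fin (N.numBands s)) : Measurable D.serving :=
  (measurable_servingIndex N.PS N.α).comp (hD.measurable_bs hs (N.seller_mem_group s hs l))

lemma aemeasurable_rpow_norm_bs (hD : D.IsModel Pr) {l : Fin (N.numBands s)} {k : O}
    (hk : k ∈ N.group s l) (f : ℕ) : AEMeasurable (fun ω => ‖D.bs k f ω‖ ^ (-N.α)) Pr :=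
  (((measurable_pi_apply f).comp (hD.measurable_bs hs hk)).norm.pow_const _).aemeasurable

lemma aemeasurable_signal (hD : D.IsModel Pr) (l : Fin (N.numBands s)) :
    AEMeasurable (fun ω => N.PS * D.gain l s (D.serving ω) ω * ‖D.bs s (D.serving ω) ω‖ ^ (-N.α))
      Pr := by
  have hsg := N.seller_mem_group s hs l
  have hgains : AEMeasurable (fun ω n => D.gain l s n ω) Pr :=
    aemeasurable_pi_iff.2 fun n => (hD.gain_law l s hsg n).aemeasurable
  have heval : Measurable fun q : (ℕ → ℝ) × ℕ => q.1 q.2 :=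
    measurable_from_prod_countable_left fun n => measurable_pi_apply n
  have hgain : AEMeasurable (fun ω => D.gain l s (D.serving ω) ω) Pr :=
    heval.comp_aemeasurable (hgains.prodMk (hD.measurable_serving hs l).aemeasurable)
  have hbs : Measurable fun ω => D.bs s (D.serving ω) ω :=
    (measurable_apply_servingIndex N.PS N.α).comp (hD.measurable_bs hs hsg)
  exact (hgain.const_mul _).mul (hbs.norm.pow_const _).aemeasurable

lemma aemeasurable_interference (hD : D.IsModel Pr) (l : Fin (N.numBands s)) :
    AEMeasurable (D.interference l) Pr := by
  have hsg := N.seller_mem_group s hs l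
  refine AEMeasurable.add (AEMeasurable.tsum fun f => ?_)
    (Finset.aemeasurable_fun_sum _ fun b hb => AEMeasurable.tsum fun f => ?_)
  · have hpower : AEMeasurable (fun ω => N.PS * D.gain l s f ω * ‖D.bs s f ω‖ ^ (-N.α)) Pr :=
      ((hD.gain_law l s hsg f).aemeasurable.const_mul _).mul
        (hD.aemeasurable_rpow_norm_bs hs hsg f)
    have hset : MeasurableSet {ω | f = D.serving ω}ᶜ :=
      (measurableSet_eq_fun measurable_const (hD.measurable_serving hs l)).compl
    refine (hpower.indicator hset).congr (ae_of_all _ fun ω => ?_)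
    by_cases h : f = D.serving ω <;> simp [h]
  · have hbg := Finset.mem_of_mem_erase hb
    exact ((hD.power_law l b hb f).aemeasurable_fst.mul
      (hD.gain_law l b hbg f).aemeasurable).mul (hD.aemeasurable_rpow_norm_bs hs hbg f)

lemma aemeasurable_sinr (hD : D.IsModel Pr) (l : Fin (N.numBands s)) :
    AEMeasurable (D.sinr l) Pr :=
  (hD.aemeasurable_signal hs l).div ((hD.aemeasurable_interference hs l).add_const _)

variable [IsProbabilityMeasure Pr]

lemma ae_sum_tsum_eq_toReal_buyerInterference (hD : D.IsModel Pr) (l : Fin (N.numBands s)) :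
    ∀ᵐ ω ∂Pr, ∑ b ∈ (N.group s l).erase s,
      ∑' f, D.buyerPower l b f ω * D.gain l b f ω * ‖D.bs b f ω‖ ^ (-N.α) =
        (D.buyerInterference l ω).toReal := by
  have hfin : ∀ᵐ ω ∂Pr, ∀ b ∈ (N.group s l).erase s, D.shotNoise l b ω ≠ ∞ :=
    (Finset.eventually_all _).2 fun b hb => hD.ae_shotNoise_ne_top hs hb
  have hnonneg : ∀ᵐ ω ∂Pr, ∀ b ∈ (N.group s l).erase s, ∀ f,
      0 ≤ D.buyerPower l b f ω ∧ 0 < D.gain l b f ω :=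
    (Finset.eventually_all _).2 fun b hb => ae_all_iff.2 fun f =>
      (hD.ae_buyerPower_nonneg hs hb f).and
        (ae_pos_of_hasLaw_expMeasure (hD.gain_law l b (Finset.mem_of_mem_erase hb) f))
  filter_upwards [hfin, hnonneg] with ω hfin hnonneg
  rw [buyerInterference, ENNReal.toReal_sum hfin]
  refine Finset.sum_congr rfl fun b hb => ?_
  rw [shotNoise, ENNReal.tsum_toReal_eq fun f => ENNReal.ofReal_ne_top]
  refine tsum_congr fun f => ?_
  obtain ⟨hpower, hgain⟩ := hnonneg b hb f
  rw [D.txPower_of_mem_erase hb, ENNReal.toReal_ofReal (by positivity)]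

lemma ae_sinr_nonneg (hD : D.IsModel Pr) (l : Fin (N.numBands s)) : ∀ᵐ ω ∂Pr, 0 ≤ D.sinr l ω := by
  have hPS := N.PS_pos
  filter_upwards [hD.ae_sum_tsum_eq_toReal_buyerInterference hs l, ae_all_iff.2 fun f =>
    ae_pos_of_hasLaw_expMeasure (hD.gain_law l s (N.seller_mem_group s hs l) f)] with ω hω hgain
  have hseller : 0 ≤ ∑' f, if f = D.serving ω then 0 else
      N.PS * D.gain l s f ω * ‖D.bs s f ω‖ ^ (-N.α) := tsum_nonneg fun f => by
    have := hgain f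
    split_ifs <;> positivity
  have hserving := hgain (D.serving ω)
  rw [sinr, interference, hω]
  positivity

lemma ae_log_one_add_sinr_nonneg (hD : D.IsModel Pr) (l : Fin (N.numBands s)) :
    0 ≤ᵐ[Pr] fun ω => Real.log (1 + D.sinr l ω) :=
  (hD.ae_sinr_nonneg hs l).mono fun _ hω => Real.log_nonneg (le_add_of_nonneg_right hω)

theorem measure_lt_sinr (hD : D.IsModel Pr) (l : Fin (N.numBands s)) {β : ℝ} (hβ : 0 < β) :
    Pr {ω | β < D.sinr l ω} = ∫⁻ z in Ioi 0,
      ENNReal.ofReal (coverageIntegrand N s l (D.powerMoment Pr l) β z) := by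
  have hsg := N.seller_mem_group s hs l
  have hsm := Finset.mem_union_left N.buyers hs
  have hc := N.bsIntensity_pos s hsm
  have hPS := N.PS_pos
  have hb := sum_bsIntensity_erase_nonneg hs l
  have hM := hD.powerMoment_nonneg hs l
  have hrhoInf := rhoInf_nonneg N.α
  have hXG : IndepFun (fun ω n => D.bs s n ω) (fun ω n => D.gain l s n ω) Pr :=
    (hD.bs_indep_marks l s hsg).comp (φ := id) (ψ := fun (q : ℕ → ℝ × ℝ) n => (q n).1)
      measurable_id (by fun_prop)
  have hcov := SpectrumSharing.measure_lt_sinr hc (hD.bs_ppp s hsm) (hD.gain_law l s hsg)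
    ((hD.marks_indep l s hsg).comp (fun _ q => q.1) fun _ => measurable_fst) hXG
    (hD.aemeasurable_buyerInterference hs l) (hD.indepFun_buyerInterference hs l) hPS
    N.two_lt_α hβ (sq_nonneg N.σ) (hD.ae_buyerInterference_ne_top hs l)
  have hset : {ω | β < D.sinr l ω} =ᵐ[Pr] {ω | β < N.PS * D.gain l s (D.serving ω) ω *
      ‖D.bs s (D.serving ω) ω‖ ^ (-N.α) /
        ((∑' f, if f = D.serving ω then 0 else N.PS * D.gain l s f ω * ‖D.bs s f ω‖ ^ (-N.α)) +
          (D.buyerInterference l ω).toReal + N.σ ^ 2)} := by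
    filter_upwards [hD.ae_sum_tsum_eq_toReal_buyerInterference hs l] with ω hω
    refine propext ?_
    change β < D.sinr l ω ↔ _
    rw [sinr, interference, hω]
    exact Iff.rfl
  rw [measure_congr hset]
  refine hcov.trans (setLIntegral_congr_fun measurableSet_Ioi fun z (hz : 0 < z) => ?_)
  rw [hD.lintegral_expNeg_mul_buyerInterference hs l (by positivity),
    expNeg_ofReal (by positivity), ← ENNReal.ofReal_mul (by positivity), coverageIntegrand,
    laplaceInterference, ← mul_assoc]

theorem lintegral_log_one_add_sinr (hD : D.IsModel Pr) (l : Fin (N.numBands s)) :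
    ∫⁻ ω, ENNReal.ofReal (Real.log (1 + D.sinr l ω)) ∂Pr =
      ∫⁻ t in Ioi 0, ∫⁻ z in Ioi 0,
        ENNReal.ofReal (coverageIntegrand N s l (D.powerMoment Pr l) (Real.exp t - 1) z) := by
  rw [lintegral_eq_lintegral_meas_lt Pr (hD.ae_log_one_add_sinr_nonneg hs l)
    (Real.measurable_log.comp_aemeasurable ((hD.aemeasurable_sinr hs l).const_add 1))]
  refine setLIntegral_congr_fun measurableSet_Ioi fun t (ht : 0 < t) => ?_
  have hβ : 0 < Real.exp t - 1 := by simpa using ht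
  rw [← hD.measure_lt_sinr hs l hβ]
  refine measure_congr ?_
  filter_upwards [hD.ae_sinr_nonneg hs l] with ω hω
  refine propext ?_
  change t < Real.log (1 + D.sinr l ω) ↔ Real.exp t - 1 < D.sinr l ω
  rw [Real.lt_log_iff_exp_lt (by linarith), sub_lt_iff_lt_add']

lemma lintegral_lintegral_coverageIntegrand_ne_top (hD : D.IsModel Pr) (l : Fin (N.numBands s)) :
    ∫⁻ t in Ioi 0, ∫⁻ z in Ioi 0,
      ENNReal.ofReal (coverageIntegrand N s l (D.powerMoment Pr l) (Real.exp t - 1) z) ≠ ∞ := by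
  have hα := N.two_lt_α
  set c : ℝ → ℝ≥0∞ := fun t => ∫⁻ z in Ioi 0,
    ENNReal.ofReal (coverageIntegrand N s l (D.powerMoment Pr l) (Real.exp t - 1) z)
  have hsmall : ∫⁻ t in Ioc 0 1, c t ≠ ∞ := by
    refine ne_top_of_le_ne_top (b := ∫⁻ _ in Ioc (0 : ℝ) 1, 1) (by simp)
      (setLIntegral_mono measurable_const fun t ht => ?_)
    have hβ : 0 < Real.exp t - 1 := by simpa using ht.1
    exact (hD.measure_lt_sinr hs l hβ).symm.trans_le prob_le_one
  have hlarge : ∫⁻ t in Ioi 1, c t ≠ ∞ := by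
    have hint : IntegrableOn (fun t => (1 + 2 ^ (N.α / 2)) * (2 ^ (2 / N.α) *
        Real.exp (-(2 / N.α) * t))) (Ioi 1) :=
      ((integrableOn_exp_mul_Ioi (neg_neg_of_pos (by positivity)) 1).const_mul _).const_mul _
    refine ne_top_of_le_ne_top hint.lintegral_lt_top.ne
      (setLIntegral_mono (by fun_prop) fun t (ht : 1 < t) => ?_)
    refine (lintegral_coverageIntegrand_le hs l (hD.powerMoment_nonneg hs l) ?_).trans
      (ENNReal.ofReal_le_ofReal ?_)
    · linarith [Real.add_one_le_exp t]
    · exact mul_le_mul_of_nonneg_left (rpow_exp_sub_one_le (by positivity) ht.le) (by positivity)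
  rw [← Ioc_union_Ioi_eq_Ioi (zero_le_one' ℝ), lintegral_union measurableSet_Ioi
    (Ioc_disjoint_Ioi le_rfl)]
  exact ENNReal.add_ne_top.2 ⟨hsmall, hlarge⟩

lemma integrable_log_one_add_sinr (hD : D.IsModel Pr) (l : Fin (N.numBands s)) :
    Integrable (fun ω => Real.log (1 + D.sinr l ω)) Pr := by
  refine ⟨(Real.measurable_log.comp_aemeasurable
    ((hD.aemeasurable_sinr hs l).const_add 1)).aestronglyMeasurable, ?_⟩
  rw [hasFiniteIntegral_iff_ofReal (hD.ae_log_one_add_sinr_nonneg hs l),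
    hD.lintegral_log_one_add_sinr hs l]
  exact (hD.lintegral_lintegral_coverageIntegrand_ne_top hs l).lt_top

lemma integrableOn_coverageIntegrand (hD : D.IsModel Pr) (l : Fin (N.numBands s)) :
    IntegrableOn (fun q : ℝ × ℝ =>
      coverageIntegrand N s l (D.powerMoment Pr l) (Real.exp q.1 - 1) q.2) (Ioi 0 ×ˢ Ioi 0) := by
  refine ⟨(measurable_coverageIntegrand l _).aestronglyMeasurable, ?_⟩
  rw [hasFiniteIntegral_iff_ofReal (ae_of_all _ fun q => coverageIntegrand_nonneg hs l _ _ _),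
    lintegral_coverageIntegrand_prod]
  exact (hD.lintegral_lintegral_coverageIntegrand_ne_top hs l).lt_top

theorem integral_log_one_add_sinr (hD : D.IsModel Pr) (l : Fin (N.numBands s)) :
    ∫ ω, Real.log (1 + D.sinr l ω) ∂Pr = ∫ t in Ioi 0, ∫ z in Ioi 0,
      coverageIntegrand N s l (D.powerMoment Pr l) (Real.exp t - 1) z := by
  have hint := hD.integrableOn_coverageIntegrand hs l
  rw [Measure.volume_eq_prod] at hint
  rw [← setIntegral_prod _ hint, ← Measure.volume_eq_prod,
    integral_eq_lintegral_of_nonneg_ae (hD.ae_log_one_add_sinr_nonneg hs l)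
      (hD.integrable_log_one_add_sinr hs l).aestronglyMeasurable,
    integral_eq_lintegral_of_nonneg_ae
      (ae_of_all _ fun q => coverageIntegrand_nonneg hs l _ _ _)
      (measurable_coverageIntegrand l _).aestronglyMeasurable,
    hD.lintegral_log_one_add_sinr hs l, lintegral_coverageIntegrand_prod]

lemma compProd_sinrLaw (hD : D.IsModel Pr) (l : Fin (N.numBands s)) :
    Pr.map (D.buyerPowers l) ⊗ₘ D.sinrLaw Pr l =
      Pr.map fun ω => (D.buyerPowers l ω, D.sinr l ω) :=
  compProd_map_condDistrib (hD.aemeasurable_sinr hs l)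

lemma integrable_log_one_add_compProd_sinrLaw (hD : D.IsModel Pr) (l : Fin (N.numBands s)) :
    Integrable (fun q : ({b // b ∈ (N.group s l).erase s} → ℕ → ℝ) × ℝ => Real.log (1 + q.2))
      (Pr.map (D.buyerPowers l) ⊗ₘ D.sinrLaw Pr l) := by
  rw [hD.compProd_sinrLaw hs l, integrable_map_measure
    (by fun_prop : Measurable _).aestronglyMeasurable
    ((hD.aemeasurable_buyerPowers l).prodMk (hD.aemeasurable_sinr hs l))]
  exact hD.integrable_log_one_add_sinr hs l

lemma ae_compProd_sinrLaw_nonneg (hD : D.IsModel Pr) (l : Fin (N.numBands s)) :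
    ∀ᵐ q ∂(Pr.map (D.buyerPowers l) ⊗ₘ D.sinrLaw Pr l), 0 ≤ q.2 := by
  rw [hD.compProd_sinrLaw hs l, ae_map_iff
    ((hD.aemeasurable_buyerPowers l).prodMk (hD.aemeasurable_sinr hs l))
    (measurableSet_le measurable_const measurable_snd)]
  exact hD.ae_sinr_nonneg hs l

theorem integral_sinrLaw (hD : D.IsModel Pr) (l : Fin (N.numBands s)) :
    ∫ p, (∫ γ, Real.log (1 + γ) ∂(D.sinrLaw Pr l p)) ∂(Pr.map (D.buyerPowers l)) =
      ∫ ω, Real.log (1 + D.sinr l ω) ∂Pr := by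
  have : IsMarkovKernel (D.sinrLaw Pr l) := by unfold sinrLaw; infer_instance
  rw [← Measure.integral_compProd (hD.integrable_log_one_add_compProd_sinrLaw hs l),
    hD.compProd_sinrLaw hs l,
    integral_map ((hD.aemeasurable_buyerPowers l).prodMk (hD.aemeasurable_sinr hs l))
      (by fun_prop : Measurable _).aestronglyMeasurable]

theorem integral_sinrLaw_eq_integral_measure_lt (hD : D.IsModel Pr) (l : Fin (N.numBands s)) :
    ∫ p, (∫ γ, Real.log (1 + γ) ∂(D.sinrLaw Pr l p)) ∂(Pr.map (D.buyerPowers l)) =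
      ∫ p, (∫ t in Ioi (0 : ℝ), (D.sinrLaw Pr l p).real {γ | t < Real.log (1 + γ)})
        ∂(Pr.map (D.buyerPowers l)) := by
  have : IsMarkovKernel (D.sinrLaw Pr l) := by unfold sinrLaw; infer_instance
  have hlog := hD.integrable_log_one_add_compProd_sinrLaw hs l
  have hcond := ((Measure.integrable_compProd_iff hlog.aestronglyMeasurable).1 hlog).1
  refine integral_congr_ae ?_
  filter_upwards [Measure.ae_ae_of_ae_compProd (hD.ae_compProd_sinrLaw_nonneg hs l), hcond]
    with p hp hint
  exact hint.integral_eq_integral_meas_lt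
    (hp.mono fun _ hγ => Real.log_nonneg (le_add_of_nonneg_right hγ))

end IsModel
end Downlink

end SpectrumSharing

theorem theorem4 {O : Type*} [DecidableEq O] (N : SpectrumSharing.Network O)
    (s : O) (hs : s ∈ N.sellers)
    {Ω : Type*} [MeasurableSpace Ω] (Pr : MeasureTheory.Measure Ω)
    [MeasureTheory.IsProbabilityMeasure Pr]
    (D : SpectrumSharing.Downlink N s Ω) (hD : D.IsModel Pr) :
    -- all the expectations and integrals below converge
    (∀ l, Integrable (fun ω => D.allowedPower l ω ^ (2 / N.α)) Pr ∧
      Integrable (fun ω => Real.log (1 + D.sinr l ω)) Pr ∧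
      IntegrableOn (fun q : ℝ × ℝ =>
        SpectrumSharing.coverageIntegrand N s l (D.powerMoment Pr l) (Real.exp q.1 - 1) q.2)
        (Ioi 0 ×ˢ Ioi 0)) ∧
    D.averageRate Pr =
      ∑ l, ∫ p, (∫ t in Ioi (0 : ℝ), (D.sinrLaw Pr l p).real {γ | t < Real.log (1 + γ)})
        ∂(Pr.map (D.buyerPowers l)) ∧
    D.averageRate Pr =
      ∑ l, ∫ t in Ioi (0 : ℝ), ∫ z in Ioi (0 : ℝ),
        SpectrumSharing.coverageIntegrand N s l (D.powerMoment Pr l) (Real.exp t - 1) z := by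
  refine ⟨fun l => ⟨hD.integrable_allowedPower_rpow hs l, hD.integrable_log_one_add_sinr hs l,
    hD.integrableOn_coverageIntegrand hs l⟩, ?_, ?_⟩
  · exact Finset.sum_congr rfl fun l _ => hD.integral_sinrLaw_eq_integral_measure_lt hs l
  · exact Finset.sum_congr rfl fun l _ =>
      (hD.integral_sinrLaw hs l).trans (hD.integral_log_one_add_sinr hs l)
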